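/- Let $\mathbb K=\mathbb C[\eta]/(\eta^2,\ i\eta+\eta i)$, so $(z+\eta w)(z'+\eta w')=zz'+\eta(\bar z w'+z'w)$; write $\operatorname{pp}(z+\eta w)=z$. For $z\ne 0$ the element $z+\eta w$ represents the direct isometry $u\mapsto (uz^2+zw)/|z|^2$ of $\mathbb R^2=\mathbb C$; this embeds $\mathrm{SE}(2)$ in $\mathbb P(\mathbb K)=\mathbb P^3_{\mathbb R}$. If $z\notin\mathbb R$ it is a rotation about $u(z+\eta w)=w/(\bar z-z)$. *Linkages.* A linkage is a finite connected graph (vertices: links, edges: joints) with a centre of rotation in $\mathbb R^2$ for every joint. For neighbouring links $a,b$ let $\mathrm{Rot}_{a,b}=\mathrm{Rot}_{b,a}\cong\mathbb P^1_{\mathbb R}$ be the group of rotations about the centre of their joint. A configuration is a family $(\sigma_{a,b})$ with $\sigma_{a,b}\in \mathrm{Rot}_{a,b}$ for all ordered pairs of neighbouring links, such that the composition along every directed cycle is the identity. Configurations form a Zariski closed subset of $(\mathbb P^1_{\mathbb R})^{2|E|}$; its dimension is the mobility. For arbitrary links $a,b$, $\sigma_{a,b}$ denotes the composition $\sigma_{a,h_1}\circ\sigma_{h_1,h_2}\circ\cdots\circ\sigma_{h_s,b}$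 along any path from $a$ to $b$ (the position of $a$ relative to $b$), and $R_{a,b}\subseteq\mathrm{SE}(2)\subseteq\mathbb P^3_{\mathbb R}$ is the set of all $\sigma_{a,b}$ that occur in configurations. Components are irreducible components in the real Zariski topology. *Motions.* $P=Z+\eta W\in\mathbb K[t]$ (with $Z,W\in\mathbb C[t]$) is a bounded motion polynomial if it is monic and $Z$ has no real root. Its motion is $\phi:\mathbb R\to\mathbb P^3_{\mathbb R}$, $t\mapsto [P(t)]$. A linkage strongly realizes $\phi$ through $R_{a,b}$ if $\operatorname{image}(\phi)\subseteq R_{a,b}$ and the Zariski closure of $\operatorname{image}(\phi)$ in $R_{a,b}$ is a component of $R_{a,b}$. *FactorMotionPolynomial.* The input is a bounded $P'=Z+\eta W$ such that $Z,W$ have no common nonconstant real factor. Write $Z=\prod_i (t-\alpha_i)^{r_i}(t-\overline{\alpha_i})^{s_i}$ with $r_i\ge s_i\geq 0$, $r_i>0$, and $\alpha_i\neq\alpha_j,\overline{\alpha_j}$ for $i\ne j$. Let $u_i,v_i$ be the multiplicities of $\alpha_i,\overline{\alpha_i}$ as roots of $W$, $m_i=\min(s_i,u_i+v_i)$, and $R=\prod_i((t-\alpha_i)(t-\overline{\alpha_i}))^{s_i-m_i}$.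 Let $q=(q_1,\dots,q_n)$ be the concatenation over $i$ of the lists consisting of $s_i-\min(s_i,v_i)$ copies of $\overline{\alpha_i}$, then $r_i+s_i-m_i$ copies of $\alpha_i$, then $s_i-\min(s_i,u_i)$ copies of $\overline{\alpha_i}$. Choose $w_j\in\mathbb C$ with $RW=\sum_j w_j\prod_{l<j}(t-\overline{q_l})\prod_{l>j}(t-q_l)$. The output is $R$ and $k_j=q_j-\eta w_j$ $(1\le j\le n)$. *ConstructStrongLinkage.* Given a bounded $P$, let $S\in\mathbb R[t]$ be a monic real factor of $P$ of maximal degree, and let $(k_1,\dots,k_n)$ be an output of FactorMotionPolynomial for $P/S$. For $a,b\in\mathbb K$ with $\operatorname{pp}(a)\neq\overline{\operatorname{pp}(b)}$ let $\operatorname{Flip}(a,b)=(c,d)$ be the unique pair with $\operatorname{pp}(c)=\operatorname{pp}(b)$, $\operatorname{pp}(d)=\operatorname{pp}(a)$, $(t-a)(t-b)=(t-c)(t-d)$. Choose $l_1\in\mathbb K$ with $\operatorname{pp}(l_1)\notin\mathbb R$ such that, with $(\tilde k_i,l_{i+1})=\operatorname{Flip}(l_i,k_i)$, for all $1\le i\le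 n$: $\operatorname{pp}(l_i),\operatorname{pp}(k_i)\notin\mathbb R$, $\operatorname{pp}(l_i)\ne\operatorname{pp}(k_i),\overline{\operatorname{pp}(k_i)}$ and $u(l_i)\neq u(k_i)$. The output is the ladder linkage $L$ with links $1,\dots,n+1$ (first row) and $1',\dots,(n+1)'$ (second row) and joints $\{i,i+1\}$, $\{i',(i+1)'\}$ $(1\le i\le n)$ and $\{j,j'\}$ $(1\le j\le n+1)$ with centres $u(k_i)$, $u(\tilde k_i)$ and $u(l_j)$, respectively. For $1\le h\le n$ let $F_h$ be the closed four-link linkage formed by the links $h,h+1,(h+1)',h'$ and the four joints between them. **Theorem.** Let $P$ be a bounded motion polynomial with motion $\phi$. Then ConstructStrongLinkage has an output for $P$, and for every output $L$, with configuration space $K$: 1. $L$ has mobility $1$, i.e. $\dim K=1$. 2. For every choice of components $B_h$ of the configuration spaces of $F_h$ $(1\le h\le n)$, the iterated pullback $K_B=\{x\in K: x|_{F_h}\in B_h \text{ for all } h\}$ is a component of $K$, the restriction maps $K_B\to B_h$ are isomorphisms of real algebraic varieties, and for any neighbouring links $a,b$ the projection $K_B\to\mathrm{Rot}_{a,b}\cong\mathbb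 P^1_{\mathbb R}$ is an isomorphism. Every component of $K$ is one of the $K_B$. 3. $L$ strongly realizes $\phi$, as the motion of the end link $n+1$ relative to the base link $1$: $\operatorname{image}(\phi)\subseteq R_{n+1,1}$, and the Zariski closure of $\operatorname{image}(\phi)$ in $R_{n+1,1}$ is a component of $R_{n+1,1}$. -/

import Mathlib

open Polynomial
open scoped ComplexConjugate LinearAlgebra.Projectivization

noncomputable section

namespace PlanarMotion

/-! ### Direct isometries of the plane

The Euclidean plane `ℝ²` is identified with `ℂ` via `(x, y) ↦ x + i y`. -/

/-- The group `SE(2)` of direct isometries of the plane (the product is composition of maps). -/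
def SE2 : Subgroup (ℂ ≃ᵃⁱ[ℝ] ℂ) where
  carrier := {σ | LinearMap.det (σ.linearIsometryEquiv.toLinearEquiv : ℂ →ₗ[ℝ] ℂ) = 1}
  mul_mem' := by
    intro a b ha hb
    have : ((a * b).linearIsometryEquiv.toLinearEquiv : ℂ →ₗ[ℝ] ℂ)
        = (a.linearIsometryEquiv.toLinearEquiv : ℂ →ₗ[ℝ] ℂ) ∘ₗ
          (b.linearIsometryEquiv.toLinearEquiv : ℂ →ₗ[ℝ] ℂ) := rfl
    simp only [Set.mem_ofPred_eq] at ha hb ⊢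
    rw [this, LinearMap.det_comp, ha, hb, one_mul]
  one_mem' := by
    have : ((1 : ℂ ≃ᵃⁱ[ℝ] ℂ).linearIsometryEquiv.toLinearEquiv : ℂ →ₗ[ℝ] ℂ)
        = LinearMap.id := rfl
    simp only [Set.mem_ofPred_eq]
    rw [this, LinearMap.det_id]
  inv_mem' := by
    intro a ha
    have : (a.linearIsometryEquiv.toLinearEquiv : ℂ →ₗ[ℝ] ℂ) ∘ₗ
        ((a⁻¹).linearIsometryEquiv.toLinearEquiv : ℂ →ₗ[ℝ] ℂ) = LinearMap.id := by
      ext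
      all_goals exact a.linearIsometryEquiv.apply_symm_apply _
    have h2 := congrArg LinearMap.det this
    simp only [Set.mem_ofPred_eq] at ha ⊢
    rwa [LinearMap.det_comp, ha, one_mul, LinearMap.det_id] at h2

/-- The subgroup of rotations around the point `p`. -/
def rotationsAbout (p : ℂ) : Subgroup SE2 where
  carrier := {σ | σ.1 p = p}
  mul_mem' := by
    intro a b ha hb
    change a.1 (b.1 p) = p
    rw [show b.1 p = p from hb]; exact ha
  one_mem' := rfl
  inv_mem' := by
    intro a ha
    change a.1.symm p = p
    have h : a.1 p = p := ha
    conv_lhs => rw [← h]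
    exact a.1.symm_apply_apply p

/-! ### The algebra `𝕂 = ℂ[η]/(η², iη + ηi)` -/

/-- The real algebra `𝕂`; the structure `⟨z, w⟩` stands for `z + η w`.
`pp` is the primal and `sp` the secondary part. -/
@[ext] structure Mot where
  pp : ℂ
  sp : ℂ

namespace Mot

instance : Zero Mot := ⟨⟨0, 0⟩⟩
instance : One Mot := ⟨⟨1, 0⟩⟩
instance : Add Mot := ⟨fun a b => ⟨a.pp + b.pp, a.sp + b.sp⟩⟩
instance : Neg Mot := ⟨fun a => ⟨-a.pp, -a.sp⟩⟩
instance : Sub Mot := ⟨fun a b => ⟨a.pp - b.pp, a.sp - b.sp⟩⟩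
/-- `(z + η w)(z' + η w') = z z' + η (conj z · w' + z' · w)`. -/
instance : Mul Mot := ⟨fun a b => ⟨a.pp * b.pp, conj a.pp * b.sp + b.pp * a.sp⟩⟩

@[simp] theorem zero_pp : (0 : Mot).pp = 0 := rfl
@[simp] theorem zero_sp : (0 : Mot).sp = 0 := rfl
@[simp] theorem one_pp : (1 : Mot).pp = 1 := rfl
@[simp] theorem one_sp : (1 : Mot).sp = 0 := rfl
@[simp] theorem add_pp (a b : Mot) : (a + b).pp = a.pp + b.pp := rfl
@[simp] theorem add_sp (a b : Mot) : (a + b).sp = a.sp + b.sp := rfl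
@[simp] theorem neg_pp (a : Mot) : (-a).pp = -a.pp := rfl
@[simp] theorem neg_sp (a : Mot) : (-a).sp = -a.sp := rfl
@[simp] theorem sub_pp (a b : Mot) : (a - b).pp = a.pp - b.pp := rfl
@[simp] theorem sub_sp (a b : Mot) : (a - b).sp = a.sp - b.sp := rfl
@[simp] theorem mul_pp (a b : Mot) : (a * b).pp = a.pp * b.pp := rfl
@[simp] theorem mul_sp (a b : Mot) : (a * b).sp = conj a.pp * b.sp + b.pp * a.sp := rfl

instance : Ring Mot where
  add_assoc a b c := by ext <;> simp <;> ring
  zero_add a := by ext <;> simp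
  add_zero a := by ext <;> simp
  add_comm a b := by ext <;> simp <;> ring
  mul_assoc a b c := by ext <;> simp <;> ring
  one_mul a := by ext <;> simp
  mul_one a := by ext <;> simp
  left_distrib a b c := by ext <;> simp <;> ring
  right_distrib a b c := by ext <;> simp <;> ring
  zero_mul a := by ext <;> simp
  mul_zero a := by ext <;> simp
  neg_add_cancel a := by ext <;> simp
  sub_eq_add_neg a b := by ext <;> simp <;> ring
  nsmul := nsmulRec
  zsmul := zsmulRec

/-- The primal part as a ring homomorphism. -/
def ppHom : Mot →+* ℂ where
  toFun := pp
  map_one' := rfl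
  map_mul' _ _ := rfl
  map_zero' := rfl
  map_add' _ _ := rfl

/-- Real numbers are the central elements `r + η 0`. -/
instance : Algebra ℝ Mot where
  smul r a := ⟨r * a.pp, r * a.sp⟩
  algebraMap :=
    { toFun := fun r => ⟨(r : ℂ), 0⟩
      map_one' := by ext <;> simp
      map_mul' := fun a b => by ext <;> simp
      map_zero' := by ext <;> simp
      map_add' := fun a b => by ext <;> simp }
  commutes' r a := by
    change (⟨(r : ℂ), 0⟩ : Mot) * a = a * ⟨(r : ℂ), 0⟩
    ext <;> simp <;> ring
  smul_def' r a := by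
    change (⟨r * a.pp, r * a.sp⟩ : Mot) = ⟨(r : ℂ), 0⟩ * a
    ext <;> simp

@[simp] theorem smul_pp (r : ℝ) (a : Mot) : (r • a).pp = r * a.pp := rfl
@[simp] theorem smul_sp (r : ℝ) (a : Mot) : (r • a).sp = r * a.sp := rfl

/-- The direct isometry represented by `z + η w` with `z ≠ 0`, namely
`u ↦ (u z² + z w) / |z|²` (see `toSE2_apply`). -/
def toSE2 (k : Mot) (h : k.pp ≠ 0) : SE2 :=
  ⟨AffineIsometryEquiv.constVAdd ℝ ℂ (k.sp / conj k.pp) *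
    (rotation (Circle.ofConjDivSelf (conj k.pp)
      (by simpa using h))).toAffineIsometryEquiv, by
    have := det_rotation (Circle.ofConjDivSelf (conj k.pp) (by simpa using h))
    exact this⟩

theorem toSE2_apply (k : Mot) (h : k.pp ≠ 0) (u : ℂ) :
    (toSE2 k h).1 u = (u * k.pp ^ 2 + k.pp * k.sp) / ((‖k.pp‖ : ℂ) ^ 2) := by
  have hc : conj k.pp ≠ 0 := by simpa using h
  have : (toSE2 k h).1 u = k.sp / conj k.pp + conj (conj k.pp) / conj k.pp * u := rfl
  rw [this, Complex.conj_conj, ← Complex.mul_conj']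
  field_simp
  ring

/-- The product of `𝕂` is the group law of `SE(2)`, acting from the right. -/
theorem toSE2_mul (k m : Mot) (hk : k.pp ≠ 0) (hm : m.pp ≠ 0) :
    toSE2 (k * m) (mul_ne_zero hk hm) = toSE2 m hm * toSE2 k hk := by
  apply Subtype.ext
  ext u
  have e : (toSE2 m hm * toSE2 k hk).1 u = (toSE2 m hm).1 ((toSE2 k hk).1 u) := rfl
  have hk' : conj k.pp ≠ 0 := by simpa using hk
  have hm' : conj m.pp ≠ 0 := by simpa using hm
  rw [e]
  simp only [toSE2_apply, ← Complex.mul_conj', mul_pp, mul_sp, map_mul]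
  field_simp
  ring

/-- The centre of the rotation represented by `k = z + η w`, `z ∉ ℝ`. -/
def center (k : Mot) : ℂ := k.sp / (conj k.pp - k.pp)

end Mot

/-! ### Zariski topologies -/

/-- The four real coordinates `(x₁ : x₂ : y₁ : y₂)` of
`(x₁ + i x₂) + η (y₁ + i y₂)`. -/
def Mot.coord (k : Mot) : Fin 4 → ℝ := ![k.pp.re, k.pp.im, k.sp.re, k.sp.im]

/-- The Zariski topology of `ℙ³ = ℙ(𝕂)`: the complements of the zero sets of homogeneous
real polynomials form a basis of open sets. -/
instance zariskiP3 : TopologicalSpace (ℙ ℝ Mot) :=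
  TopologicalSpace.generateFrom
    {U | ∃ (m : ℕ) (F : MvPolynomial (Fin 4) ℝ), F.IsHomogeneous m ∧
      U = {x : ℙ ℝ Mot | MvPolynomial.eval x.rep.coord F ≠ 0}}

/-- The real projective line. -/
abbrev P1 := ℙ ℝ (Fin 2 → ℝ)

/-- The product `(ℙ¹)^ι` of real projective lines. -/
def MultiProj (ι : Type) := ι → P1

/-- The value at (the chosen homogeneous coordinates of) a point of `(ℙ¹)^ι` of a polynomial in
variables `(i, 0), (i, 1)`, `i ∈ ι`. -/
def evalAt {ι : Type} (F : MvPolynomial (ι × Fin 2) ℝ) (x : MultiProj ι) : ℝ :=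
  MvPolynomial.eval (fun v => (x v.1).rep v.2) F

open Classical in
/-- `F` is homogeneous of degree `m i` in the pair of variables `(i, 0), (i, 1)`, for every
`i`. -/
def IsMultihomogeneous {ι : Type} (F : MvPolynomial (ι × Fin 2) ℝ) (m : ι → ℕ) : Prop :=
  ∀ i, MvPolynomial.IsWeightedHomogeneous (fun v : ι × Fin 2 => if v.1 = i then 1 else 0) F (m i)

/-- The Zariski topology of `(ℙ¹)^ι`: the complements of the zero sets of multihomogeneous
real polynomials form a basis of open sets. -/
instance zariskiMulti (ι : Type) : TopologicalSpace (MultiProj ι) :=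
  TopologicalSpace.generateFrom
    {U | ∃ (m : ι → ℕ) (F : MvPolynomial (ι × Fin 2) ℝ), IsMultihomogeneous F m ∧
      U = {x : MultiProj ι | evalAt F x ≠ 0}}

/-- `C` is an irreducible component of the subset `X` (with its subspace topology). -/
def IsComponent {α : Type} [TopologicalSpace α] (C X : Set α) : Prop :=
  ∃ c ∈ irreducibleComponents X, ((↑) : X → α) '' c = C

/-- `f` restricted to `X` is a regular map: around every point of `X`, every component of `f` is
given by a pair of multihomogeneous polynomials of the same multidegree. -/
def IsRegularOn {ι κ : Type} (X : Set (MultiProj ι)) (f : MultiProj ι → MultiProj κ) : Prop :=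
  ∀ j : κ, ∀ x ∈ X, ∃ (m : ι → ℕ) (F₀ F₁ : MvPolynomial (ι × Fin 2) ℝ),
    IsMultihomogeneous F₀ m ∧ IsMultihomogeneous F₁ m ∧ ![evalAt F₀ x, evalAt F₁ x] ≠ 0 ∧
    ∀ y ∈ X, ∀ h : ![evalAt F₀ y, evalAt F₁ y] ≠ 0,
      f y j = Projectivization.mk ℝ ![evalAt F₀ y, evalAt F₁ y] h

/-- `f` restricts to an isomorphism of real varieties from `X` onto `Y`. -/
def IsIsoOn {ι κ : Type} (X : Set (MultiProj ι)) (Y : Set (MultiProj κ))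
    (f : MultiProj ι → MultiProj κ) : Prop :=
  IsRegularOn X f ∧ Set.BijOn f X Y ∧
    ∃ g : MultiProj κ → MultiProj ι, Set.InvOn g f X Y ∧ IsRegularOn Y g

/-! ### Rotations around a point form a projective line -/

/-- The element `(λ + i μ) + η (-2 i μ p)` of `𝕂`; for `(λ, μ) ≠ 0` it represents a
rotation around `p`. -/
def rotElt (p : ℂ) (v : Fin 2 → ℝ) : Mot :=
  ⟨v 0 + v 1 * Complex.I, -2 * Complex.I * v 1 * p⟩

theorem rotElt_pp_ne_zero (p : ℂ) {v : Fin 2 → ℝ} (hv : v ≠ 0) : (rotElt p v).pp ≠ 0 := by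
  intro h
  apply hv
  have h0 := congrArg Complex.re h
  have h1 := congrArg Complex.im h
  simp [rotElt] at h0 h1
  ext i
  fin_cases i <;> simp [h0, h1]

theorem toSE2_rotElt_apply (p : ℂ) {v : Fin 2 → ℝ} (hv : v ≠ 0) (u : ℂ) :
    ((rotElt p v).toSE2 (rotElt_pp_ne_zero p hv)).1 u =
      p + (v 0 + v 1 * Complex.I) / (v 0 - v 1 * Complex.I) * (u - p) := by
  have h1 : (v 0 + v 1 * Complex.I : ℂ) ≠ 0 := rotElt_pp_ne_zero p hv
  have e : conj (v 0 + v 1 * Complex.I : ℂ) = v 0 - v 1 * Complex.I := by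
    simp [sub_eq_add_neg]
  have h2 : (v 0 - v 1 * Complex.I : ℂ) ≠ 0 := by
    rw [← e]; exact (_root_.map_ne_zero _).2 h1
  rw [Mot.toSE2_apply, ← Complex.mul_conj']
  simp only [rotElt, e]
  field_simp
  ring

/-- The rotation around `p` with homogeneous parameter `x = (λ : μ)`. -/
def rotOf (p : ℂ) (x : P1) : rotationsAbout p :=
  ⟨(rotElt p x.rep).toSE2 (rotElt_pp_ne_zero p x.rep_nonzero), by
    change ((rotElt p x.rep).toSE2 _).1 p = p
    rw [toSE2_rotElt_apply p x.rep_nonzero]; simp⟩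

theorem rotOf_bijective (p : ℂ) : Function.Bijective (rotOf p) := by
  constructor
  · intro x y hxy
    have hx := rotElt_pp_ne_zero p x.rep_nonzero
    have hy := rotElt_pp_ne_zero p y.rep_nonzero
    have h : ((rotElt p x.rep).toSE2 hx).1 (p + 1) = ((rotElt p y.rep).toSE2 hy).1 (p + 1) :=
      congrArg (fun s : rotationsAbout p => s.1.1 (p + 1)) hxy
    rw [toSE2_rotElt_apply p x.rep_nonzero, toSE2_rotElt_apply p y.rep_nonzero] at h
    set a := x.rep
    set b := y.rep
    have ea : conj (a 0 + a 1 * Complex.I : ℂ) = a 0 - a 1 * Complex.I := by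
      simp [sub_eq_add_neg]
    have eb : conj (b 0 + b 1 * Complex.I : ℂ) = b 0 - b 1 * Complex.I := by
      simp [sub_eq_add_neg]
    have ha2 : (a 0 - a 1 * Complex.I : ℂ) ≠ 0 := by
      rw [← ea]; exact (_root_.map_ne_zero _).2 hx
    have hb2 : (b 0 - b 1 * Complex.I : ℂ) ≠ 0 := by
      rw [← eb]; exact (_root_.map_ne_zero _).2 hy
    simp only [add_sub_cancel_left, mul_one, add_right_inj] at h
    rw [div_eq_div_iff ha2 hb2] at h
    have h3 := congrArg Complex.im h
    simp at h3
    have h4 : a 0 * b 1 = a 1 * b 0 := by linarith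
    rw [← x.mk_rep, ← y.mk_rep, Projectivization.mk_eq_mk_iff']
    change ∃ c : ℝ, c • b = a
    by_cases hb0 : b 0 = 0
    · have hb1 : b 1 ≠ 0 := by
        intro hb1
        exact y.rep_nonzero (by
          ext i
          fin_cases i
          · exact hb0
          · exact hb1)
      refine ⟨a 1 / b 1, ?_⟩
      ext i
      fin_cases i
      · simp only [Pi.smul_apply, smul_eq_mul]
        change a 1 / b 1 * b 0 = a 0
        field_simp
        linarith
      · simp only [Pi.smul_apply, smul_eq_mul]
        change a 1 / b 1 * b 1 = a 1
        field_simp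
    · refine ⟨a 0 / b 0, ?_⟩
      ext i
      fin_cases i
      · simp only [Pi.smul_apply, smul_eq_mul]
        change a 0 / b 0 * b 0 = a 0
        field_simp
      · simp only [Pi.smul_apply, smul_eq_mul]
        change a 0 / b 0 * b 1 = a 1
        field_simp
        linarith
  · rintro ⟨⟨σ, hσ⟩, hp⟩
    have hp' : σ p = p := hp
    have hdet : LinearMap.det (σ.linearIsometryEquiv.toLinearEquiv : ℂ →ₗ[ℝ] ℂ) = 1 := hσ
    have hlin : ∀ u, σ u = p + σ.linearIsometryEquiv (u - p) := by
      intro u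
      have := σ.map_vadd p (u - p)
      simp only [vadd_eq_add, sub_add_cancel, hp'] at this
      rw [this, add_comm]
    obtain ⟨a, ha⟩ : ∃ a : Circle, σ.linearIsometryEquiv = rotation a := by
      obtain ⟨a, ha | ha⟩ := linear_isometry_complex σ.linearIsometryEquiv
      · exact ⟨a, ha⟩
      · exfalso
        rw [ha] at hdet
        have e : ((Complex.conjLIE.trans (rotation a)).toLinearEquiv : ℂ →ₗ[ℝ] ℂ)
          = ((rotation a).toLinearEquiv : ℂ →ₗ[ℝ] ℂ) ∘ₗ
            (Complex.conjLIE.toLinearEquiv : ℂ →ₗ[ℝ] ℂ) := rfl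
        have e2 : LinearMap.det (Complex.conjLIE.toLinearEquiv : ℂ →ₗ[ℝ] ℂ) = -1 :=
          Complex.det_conjAe
        rw [e, LinearMap.det_comp, det_rotation, e2] at hdet
        norm_num at hdet
    obtain ⟨z, hz⟩ := IsAlgClosed.exists_pow_nat_eq (a : ℂ) (n := 2) (by norm_num)
    have hz1 : ‖z‖ = 1 := by
      have : ‖z‖ ^ 2 = 1 := by rw [← norm_pow, hz, Circle.norm_coe]
      nlinarith [norm_nonneg z]
    have hzz : z * conj z = 1 := by rw [Complex.mul_conj', hz1]; norm_num
    set v : Fin 2 → ℝ := ![z.re, z.im] with hv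
    have hv0 : v ≠ 0 := by
      intro h0
      have e0 : z.re = 0 := congrFun h0 0
      have e1 : z.im = 0 := congrFun h0 1
      have : z = 0 := Complex.ext e0 e1
      rw [this] at hz1; simp at hz1
    refine ⟨Projectivization.mk ℝ v hv0, ?_⟩
    apply Subtype.ext
    apply Subtype.ext
    ext u
    change ((rotElt p (Projectivization.mk ℝ v hv0).rep).toSE2
      (rotElt_pp_ne_zero p (Projectivization.rep_nonzero _))).1 u = σ u
    rw [toSE2_rotElt_apply p (Projectivization.rep_nonzero _), hlin u, ha, rotation_apply, ← hz]
    obtain ⟨c, hc⟩ := Projectivization.exists_smul_eq_mk_rep ℝ v hv0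
    rw [← hc]
    have hc0 : ((c : ℝ) : ℂ) ≠ 0 := by exact_mod_cast c.ne_zero
    have f1 : (((c • v) 0 : ℝ) : ℂ) + ((c • v) 1 : ℝ) * Complex.I = ((c : ℝ) : ℂ) * z := by
      apply Complex.ext <;> simp [hv, Units.smul_def]
    have f2 : (((c • v) 0 : ℝ) : ℂ) - ((c • v) 1 : ℝ) * Complex.I = ((c : ℝ) : ℂ) * conj z := by
      apply Complex.ext <;> simp [hv, Units.smul_def]
    rw [f1, f2]
    have hcz : conj z ≠ 0 := fun h => by rw [h] at hzz; simp at hzz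
    have : ((c : ℝ) : ℂ) * z / (((c : ℝ) : ℂ) * conj z) = z ^ 2 := by
      rw [div_eq_iff (mul_ne_zero hc0 hcz)]
      linear_combination (-((c : ℝ) : ℂ) * z) * hzz
    rw [this]

/-- The identification of the group of rotations around `p` with the real projective line. -/
def rotEquiv (p : ℂ) : P1 ≃ rotationsAbout p := Equiv.ofBijective (rotOf p) (rotOf_bijective p)

/-! ### Linkages -/

/-- A planar linkage with revolute joints: a connected graph (vertices are links, edges are
joints) together with a centre of rotation for every joint. The values of `center` outside
the edge set play no role. -/
structure Linkage (V : Type) [Finite V] where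
  graph : SimpleGraph V
  connected : graph.Connected
  center : Sym2 V → ℂ

namespace Linkage

variable {V : Type} [Finite V] (L : Linkage V)

/-- Virtual relative positions of two neighbouring links: the rotations around their joint. -/
def virtualPos (d : L.graph.Dart) : Subgroup SE2 := rotationsAbout (L.center d.edge)

variable {L} in
/-- The composition `σ_{i,h₁} ∘ σ_{h₁,h₂} ∘ ⋯ ∘ σ_{hₛ,j}` along a directed path from `i` to `j`. -/
def walkProd (s : ∀ d : L.graph.Dart, L.virtualPos d) :
    ∀ {i j : V}, L.graph.Walk i j → SE2
  | _, _, SimpleGraph.Walk.nil => 1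
  | _, _, SimpleGraph.Walk.cons h w => (s ⟨(_, _), h⟩ : SE2) * walkProd s w

/-- The set of configurations: tuples of virtual relative positions, one for every ordered pair of
neighbouring links, whose composition along every directed cycle is the identity. -/
def conf : Set (∀ d : L.graph.Dart, L.virtualPos d) :=
  {s | ∀ (i : V) (w : L.graph.Walk i i), walkProd s w = 1}

/-- The configuration set as a subset of `(ℙ¹)^{2|E|}`, identifying the rotations around each
joint with `ℙ¹`. -/
def confVariety : Set (MultiProj L.graph.Dart) :=
  (fun s d => (rotEquiv (L.center d.edge)).symm (s d)) '' L.conf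

/-- The mobility: the dimension of the configuration variety. -/
def mobility : WithBot ℕ∞ := topologicalKrullDim L.confVariety

/-- The set of relative positions `σ_{i,j}`, as `σ` ranges over all configurations. Since
`σ_{i,j} = σ_i ∘ σ_j⁻¹` for absolute positions `σ_i`, `σ_j`, this describes the motion of the
link `i` seen from the link `j`. -/
def relPos (i j : V) : Set SE2 :=
  {σ | ∃ s ∈ L.conf, ∃ w : L.graph.Walk i j, σ = walkProd s w}

end Linkage

/-- The image of a subset of `SE(2)` under the embedding `SE(2) ⊆ ℙ(𝕂) = ℙ³`. -/
def inP3 (S : Set SE2) : Set (ℙ ℝ Mot) :=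
  {x | ∃ h : x.rep.pp ≠ 0, x.rep.toSE2 h ∈ S}

/-! ### Motion polynomials -/

/-- The primal part `Z` of `P = Z + η W`. -/
def primal (P : Mot[X]) : ℂ[X] := P.map Mot.ppHom

/-- The secondary part `W` of `P = Z + η W`. -/
def secondary (P : Mot[X]) : ℂ[X] := P.sum fun i a => monomial i a.sp

/-- A bounded motion polynomial: monic, and the primal part has no real roots. -/
def IsBoundedMotionPoly (P : Mot[X]) : Prop :=
  P.Monic ∧ ∀ t : ℝ, (primal P).eval (t : ℂ) ≠ 0

/-- The image in `ℙ³` of the rational motion `t ↦ P(t)`. -/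
def motionImage (P : Mot[X]) : Set (ℙ ℝ Mot) :=
  {x | ∃ (t : ℝ) (h : P.eval (algebraMap ℝ Mot t) ≠ 0), x = Projectivization.mk ℝ _ h}

/-- `L` strongly realizes the motion given by `P`, as the set of relative positions `σ_{i,j}` of
the links `i` and `j`: the image of the motion is contained in that set, and its Zariski closure
in that set is one of the irreducible components of it. -/
def Linkage.StronglyRealizes {V : Type} [Finite V] (L : Linkage V) (P : Mot[X]) (i j : V) :
    Prop :=
  motionImage P ⊆ inP3 (L.relPos i j) ∧
    IsComponent (closure (motionImage P) ∩ inP3 (L.relPos i j)) (inP3 (L.relPos i j))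

/-! ### The algorithm `FactorMotionPolynomial` -/

/-- The real polynomials, seen in `𝕂[t]`. -/
abbrev ofReal (S : ℝ[X]) : Mot[X] := S.map (algebraMap ℝ Mot)

/-- `Q_j(z) = (t - conj z₁) ⋯ (t - conj z_{j-1}) (t - z_{j+1}) ⋯ (t - z_n)`. -/
def Qpoly {n : ℕ} (z : Fin n → ℂ) (j : Fin n) : ℂ[X] :=
  (∏ i ∈ Finset.univ.filter (· < j), (X - C (conj (z i)))) *
    ∏ i ∈ Finset.univ.filter (j < ·), (X - C (z i))

/-- The part of the list of roots that belongs to the pair `α, conj α`, with multiplicities `r, s`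
in `Z` and `u, v` in `W`. -/
def rootBlock (α : ℂ) (r s u v : ℕ) : List ℂ :=
  List.replicate (s - min s v) (conj α) ++ List.replicate (r + s - min s (u + v)) α ++
    List.replicate (s - min s u) (conj α)

/-- `(R, (k₁, …, kₙ))` is a possible output of the algorithm `FactorMotionPolynomial` for the input
`P = Z + η W`: factor `Z = ∏ᵢ (t - αᵢ)^{rᵢ} (t - conj αᵢ)^{sᵢ}` with `rᵢ ≥ sᵢ` and the `αᵢ` pairwise
distinct up to conjugation, let `uᵢ, vᵢ` be the multiplicities of `αᵢ, conj αᵢ` in `W`, put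
`R = ∏ᵢ ((t - αᵢ)(t - conj αᵢ))^{sᵢ - min(sᵢ, uᵢ + vᵢ)}`, let `q = (q₁, …, qₙ)` be the concatenation
of the root blocks, write `R W = ∑ⱼ wⱼ Qⱼ(q)` with `wⱼ ∈ ℂ`, and put `kⱼ = qⱼ - η wⱼ`.
(If `W = 0` in an admissible input then all `sᵢ` vanish, and `uᵢ, vᵢ` play no role.) -/
def FactorMotionPolynomial (P : Mot[X]) (R : ℝ[X]) {n : ℕ} (k : Fin n → Mot) : Prop :=
  ∃ (h : ℕ) (α : Fin h → ℂ) (r s u v : Fin h → ℕ) (w : Fin n → ℂ),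
    (∀ i, s i ≤ r i ∧ 0 < r i) ∧
    (∀ i j, i ≠ j → α i ≠ α j ∧ α i ≠ conj (α j)) ∧
    primal P = ∏ i, ((X - C (α i)) ^ r i * (X - C (conj (α i))) ^ s i) ∧
    (∀ i, u i = (secondary P).rootMultiplicity (α i)) ∧
    (∀ i, v i = (secondary P).rootMultiplicity (conj (α i))) ∧
    R.map (algebraMap ℝ ℂ) =
      ∏ i, ((X - C (α i)) * (X - C (conj (α i)))) ^ (s i - min (s i) (u i + v i)) ∧
    List.ofFn (fun j => (k j).pp) =
      (List.finRange h).flatMap (fun i => rootBlock (α i) (r i) (s i) (u i) (v i)) ∧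
    R.map (algebraMap ℝ ℂ) * secondary P = ∑ j, C (w j) * Qpoly (fun i => (k i).pp) j ∧
    ∀ j, (k j).sp = -w j

/-! ### Flips -/

/-- `Flip(k₁, k₂) = (k₃, k₄)`. -/
def IsFlip (k₁ k₂ k₃ k₄ : Mot) : Prop :=
  k₃.pp = k₂.pp ∧ k₄.pp = k₁.pp ∧
    ((X - C k₁) * (X - C k₂) : Mot[X]) = (X - C k₃) * (X - C k₄)

/-- The flip mobility condition `FM(k₁, k₂)`. -/
def FlipMobility (k₁ k₂ : Mot) : Prop :=
  k₁.pp.im ≠ 0 ∧ k₂.pp.im ≠ 0 ∧ k₁.pp ≠ k₂.pp ∧ k₁.pp ≠ conj k₂.pp ∧ k₁.center ≠ k₂.center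

/-! ### Ladder-shaped linkages and the algorithm `ConstructStrongLinkage` -/

/-- The ladder graph on two rows of `n + 1` vertices; `(0, j)` is the `j`-th vertex of the first row
and `(1, j)` the vertex opposite to it. -/
def ladderGraph (n : ℕ) : SimpleGraph (Fin 2 × Fin (n + 1)) :=
  (SimpleGraph.pathGraph 2).boxProd (SimpleGraph.pathGraph (n + 1))

/-- Centres of rotation: `u i` and `ut i` for the `i`-th edge in the first and second row,
`v j` for the `j`-th rung (see the three lemmas below). -/
def ladderCenter {n : ℕ} (u ut : Fin n → ℂ) (v : Fin (n + 1) → ℂ) :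
    Sym2 (Fin 2 × Fin (n + 1)) → ℂ :=
  Sym2.lift ⟨fun x y =>
    if x.1 = y.1 then
      if h : (min x.2 y.2).val < n then (if min x.1 y.1 = 0 then u ⟨_, h⟩ else ut ⟨_, h⟩) else 0
    else v (min x.2 y.2), by
      intro x y
      simp only [min_comm x.2 y.2, min_comm x.1 y.1, eq_comm (a := x.1) (b := y.1)]⟩

theorem ladderCenter_first {n : ℕ} (u ut : Fin n → ℂ) (v : Fin (n + 1) → ℂ) (i : Fin n) :
    ladderCenter u ut v s((0, i.castSucc), (0, i.succ)) = u i := by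
  simp [ladderCenter]

theorem ladderCenter_second {n : ℕ} (u ut : Fin n → ℂ) (v : Fin (n + 1) → ℂ) (i : Fin n) :
    ladderCenter u ut v s((1, i.castSucc), (1, i.succ)) = ut i := by
  simp [ladderCenter]

theorem ladderCenter_rung {n : ℕ} (u ut : Fin n → ℂ) (v : Fin (n + 1) → ℂ) (j : Fin (n + 1)) :
    ladderCenter u ut v s((0, j), (1, j)) = v j := by
  simp [ladderCenter]

/-- The ladder-shaped linkage with the given centres of rotation. -/
def ladderLinkage {n : ℕ} (u ut : Fin n → ℂ) (v : Fin (n + 1) → ℂ) :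
    Linkage (Fin 2 × Fin (n + 1)) where
  graph := ladderGraph n
  connected := (SimpleGraph.pathGraph_connected 1).boxProd (SimpleGraph.pathGraph_connected n)
  center := ladderCenter u ut v

/-- `FlipLinkage(k₁, k₂)`, where `Flip(k₁, k₂) = (k₃, k₄)`: the closed chain of four links whose
joints have the centres of `k₁, k₂, k₄, k₃`, in this cyclic order. -/
def flipLinkage (k₁ k₂ k₃ k₄ : Mot) : Linkage (Fin 2 × Fin 2) :=
  ladderLinkage (n := 1) (fun _ => k₂.center) (fun _ => k₃.center) ![k₁.center, k₄.center]

/-- The ladder-shaped linkage with the centres of rotation of `kᵢ`, `k̃ᵢ` in the rows and of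
`lⱼ` in the rungs. -/
def strongLinkage {n : ℕ} (k kt : Fin n → Mot) (l : Fin (n + 1) → Mot) :
    Linkage (Fin 2 × Fin (n + 1)) :=
  ladderLinkage (fun i => (k i).center) (fun i => (kt i).center) (fun j => (l j).center)

/-- `strongLinkage k kt l` is a possible output of the algorithm `ConstructStrongLinkage`
for the input `P`: `S` is a monic real factor of `P` of maximal degree, `(R, k)` is an output of
`FactorMotionPolynomial` for `P / S`, the element `l 0` has nonreal primal part,
`(k̃ᵢ, lᵢ₊₁) = Flip(lᵢ, kᵢ)` for all `i`, and `l 0` is chosen such that the iterated flip mobility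
condition holds. -/
def ConstructStrongLinkage (P : Mot[X]) {n : ℕ} (k kt : Fin n → Mot) (l : Fin (n + 1) → Mot) :
    Prop :=
  ∃ (S R : ℝ[X]) (P' : Mot[X]),
    S.Monic ∧ P = ofReal S * P' ∧
    (∀ T : ℝ[X], T.Monic → ofReal T ∣ P → T.natDegree ≤ S.natDegree) ∧
    FactorMotionPolynomial P' R k ∧
    (l 0).pp.im ≠ 0 ∧
    (∀ i : Fin n, IsFlip (l i.castSucc) (k i) (kt i) (l i.succ)) ∧
    (∀ i : Fin n, FlipMobility (l i.castSucc) (k i))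

/-! ### The squares of the ladder -/

/-- The inclusion of the `h`-th square into the ladder. -/
def squareHom {n : ℕ} (h : Fin n) : ladderGraph 1 →g ladderGraph n where
  toFun x := (x.1, if x.2 = 0 then h.castSucc else h.succ)
  map_rel' := by
    rintro ⟨a, b⟩ ⟨c, d⟩ hadj
    simp only [ladderGraph, SimpleGraph.boxProd_adj, SimpleGraph.pathGraph_adj] at hadj ⊢
    fin_cases b <;> fin_cases d <;> simp_all

/-- The projection of the product over all joints of the ladder to the product over the joints
of its `h`-th square. -/
def squareProj {n : ℕ} (h : Fin n) (x : MultiProj (ladderGraph n).Dart) :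
    MultiProj (ladderGraph 1).Dart :=
  fun d => x ((squareHom h).mapDart d)

/-- The projection to the joint `d`. -/
def jointProj {ι : Type} (d : ι) (x : MultiProj ι) : MultiProj Unit := fun _ => x d

/-- The iterated pullback `K_B` of sets `B h` of configurations of the squares: the configurations
of the ladder whose projection to the `h`-th square lies in `B h`, for every `h`. -/
def pullback {n : ℕ} (K : Set (MultiProj (ladderGraph n).Dart))
    (B : Fin n → Set (MultiProj (ladderGraph 1).Dart)) : Set (MultiProj (ladderGraph n).Dart) :=
  {x ∈ K | ∀ h, squareProj h x ∈ B h}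

end PlanarMotion

end

open PlanarMotion

/-!
The proof rests on one computation, on one fact about curves, and on one fact about
factorizations.

*One square.* Let `(k̃, l') = Flip(l, k)` where `l`, `k` satisfy the flip mobility condition.
Write the rotation about `u` with parameter `z ∈ ℂ` (up to real factors) as
`z + η (conj z - z) u`. The closing condition of the square of `l, k, l', k̃` is then an equation in
`𝕂` up to a real factor, and the elimination of this factor leads to a product of two real
polynomials. So the solutions form two families, and in each of them the parameters of the other joints are Möbius
transformations of the parameter of the first rung (`square_closes_iff`, `exists_square_aut`). One
family is that of the factorizations `(t - l)(t - k) = (t - k̃)(t - l')`: both rungs rotate by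
`t - l`, the two rows by `t - k`.

*The ladder.* A tuple of rotations is a configuration if and only if opposite darts carry inverse
rotations and all squares close (`mem_confVariety_ladder_iff`). Hence the configuration space is
the union, over the choices `ε` of a family in each square, of curves `x ↦ (g_d x)_d` with Möbius
transformations `g_d` (`confVariety_ladder_eq_iUnion`, `ladderCurve_eq_range`). Such curves are
closed and irreducible, a selection of coordinates maps one isomorphically onto another
(`isIsoOn_range_mobiusCurve`), and none of them contains another one strictly. So they are the
components, they are the pullbacks of the components of the squares, and the dimension is one
(`isComponent_iUnion_iff`, `topologicalKrullDim_iUnion`).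

*Factorization.* Since a maximal real factor `S` has been removed, at most one of two conjugate
roots of the primal part of `P / S` is a root of its secondary part. Therefore the linear factors
of the root blocks multiply to `R` times the primal part, and `R · (P / S) = (t - k₁) ⋯ (t - kₙ)`
(`FactorMotionPolynomial.mul_eq_prod`). The `wⱼ` exist because the polynomials `Qⱼ` span the
multiples of a common divisor in the relevant degrees, which is shown block by block
(`InSpan.flatMap_threeBlock`); the first rung can be chosen because each of finitely many
conditions excludes finitely many secondary parts (`finite_bad_starts`).

*Strong realization.* If all squares are in the family of the factorizations, the position of the
last link relative to the first one is `[P(t)]` (`motionImage_subset_inP3_relPos`). The relative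
positions of the end links form a finite union of rational curves in `ℙ³`, one for each `ε`
(`inP3_relPos_ladder`). An irreducible set of relative positions that contains the motion lies in
the closure of one of these curves, and it remains to see that the motion is dense in that curve.
For this, let a polynomial curve `φ` that is not constant lie in the closure of a polynomial curve
`f`. Two of the homogeneous coordinates of `φ` are algebraically independent in the homogeneous
coordinate ring of `φ`, while any form that vanishes on `φ` but not on `f` would force an
algebraic relation between them, as the homogeneous coordinate ring of `f` has transcendence
degree at most two (`aeval_eq_zero_of_aeval_eq_zero`). If the motion is constant, `P` is real and
there are no squares.
-/

namespace PlanarMotion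

/-! ### Maps that are continuous for the cofinite topology -/

/-- The map `f` is continuous for the cofinite topology on its source: the preimage of a closed
set is finite or everything. On `ℙ¹` the cofinite topology is the Zariski topology. -/
def CofiniteContinuous {α Y : Type*} [TopologicalSpace Y] (f : α → Y) : Prop :=
  ∀ Z : Set Y, IsClosed Z → f ⁻¹' Z = Set.univ ∨ (f ⁻¹' Z).Finite

theorem CofiniteContinuous.of_continuous {α Y : Type*} [TopologicalSpace Y] {f : α → Y}
    (h : Continuous (f ∘ (CofiniteTopology.of (X := α)).symm)) : CofiniteContinuous f := by
  intro Z hZ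
  have := hZ.preimage h
  rw [CofiniteTopology.isClosed_iff] at this
  rcases this with h1 | h1
  · left
    rw [Set.eq_univ_iff_forall] at h1 ⊢
    intro x
    exact h1 (CofiniteTopology.of x)
  · right
    have := h1.preimage (f := CofiniteTopology.of (X := α)) CofiniteTopology.of.injective.injOn
    exact this

theorem CofiniteContinuous.of_generateFrom {α Y : Type*} {S : Set (Set Y)} {f : α → Y}
    (h : ∀ U ∈ S, f ⁻¹' U = ∅ ∨ (f ⁻¹' Uᶜ).Finite) :
    @CofiniteContinuous α Y (TopologicalSpace.generateFrom S) f := by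
  let _ : TopologicalSpace Y := TopologicalSpace.generateFrom S
  apply CofiniteContinuous.of_continuous
  rw [continuous_generateFrom_iff]
  intro U hU
  rw [CofiniteTopology.isOpen_iff']
  rcases h U hU with h1 | h1
  · left
    rw [Set.preimage_comp, h1, Set.preimage_empty]
  · right
    exact h1.preimage (f := (CofiniteTopology.of (X := α)).symm)
      CofiniteTopology.of.symm.injective.injOn

theorem CofiniteContinuous.isIrreducible_range {α Y : Type*} [TopologicalSpace Y] [Infinite α]
    {f : α → Y} (h : CofiniteContinuous f) : IsIrreducible (Set.range f) := by
  refine ⟨Set.range_nonempty f, ?_⟩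
  have key : ∀ U, IsOpen U → (Set.range f ∩ U).Nonempty → (f ⁻¹' Uᶜ).Finite := by
    rintro U hU ⟨_, ⟨x, rfl⟩, hx⟩
    refine (h Uᶜ hU.isClosed_compl).resolve_left fun h1 => ?_
    have : x ∈ f ⁻¹' Uᶜ := h1 ▸ Set.mem_univ x
    exact this hx
  intro U V hU hV hUn hVn
  obtain ⟨x, hx⟩ := ((key U hU hUn).union (key V hV hVn)).infinite_compl.nonempty
  simp only [Set.mem_compl_iff, Set.mem_union, Set.mem_preimage, not_or, not_not] at hx
  exact ⟨f x, ⟨x, rfl⟩, hx⟩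

/-- A closed set that contains the image of an infinite set of parameters contains all of the
curve. -/
theorem CofiniteContinuous.range_subset_closure_image {α Y : Type*} [TopologicalSpace Y]
    {f : α → Y} (h : CofiniteContinuous f) {s : Set α} (hs : s.Infinite) :
    Set.range f ⊆ closure (f '' s) := by
  rcases h _ (isClosed_closure (s := f '' s)) with h1 | h1
  · rintro _ ⟨x, rfl⟩
    have : x ∈ f ⁻¹' closure (f '' s) := h1 ▸ Set.mem_univ x
    exact this
  · exact absurd (h1.subset fun x hx => subset_closure ⟨x, hx, rfl⟩) hs

/-! ### Components and dimension of finite unions of curves -/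

theorem isIrreducible_image_coe {Y : Type*} [TopologicalSpace Y] {X : Set Y} (c : Set X) :
    IsIrreducible (((↑) : X → Y) '' c) ↔ IsIrreducible c := by
  refine ⟨fun h => ⟨Set.image_nonempty.1 h.1, ?_⟩,
    fun h => h.image _ continuous_subtype_val.continuousOn⟩
  rintro _ _ ⟨U, hU, rfl⟩ ⟨V, hV, rfl⟩ ⟨x, hx, hxU⟩ ⟨y, hy, hyV⟩
  obtain ⟨_, ⟨z, hz, rfl⟩, hzU⟩ := h.2 U V hU hV ⟨x, ⟨x, hx, rfl⟩, hxU⟩ ⟨y, ⟨y, hy, rfl⟩, hyV⟩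
  exact ⟨z, hz, hzU⟩

theorem isComponent_iff_maximal {α : Type} [TopologicalSpace α] {C X : Set α} :
    IsComponent C X ↔ Maximal (fun T => IsIrreducible T ∧ T ⊆ X) C := by
  constructor
  · rintro ⟨c, hc, rfl⟩
    have hc : Maximal IsIrreducible c := hc
    refine ⟨⟨(isIrreducible_image_coe c).2 hc.1, Subtype.coe_image_subset X c⟩, ?_⟩
    rintro T ⟨hT, hTX⟩ hcT
    have e : ((↑) : X → α) '' (((↑) : X → α) ⁻¹' T) = T := by
      rw [Subtype.image_preimage_coe, Set.inter_eq_right.2 hTX]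
    have h1 : IsIrreducible (((↑) : X → α) ⁻¹' T) := by rw [← isIrreducible_image_coe, e]; exact hT
    have h2 := hc.2 h1 (Set.image_subset_iff.1 hcT)
    rw [← e]
    exact Set.image_mono h2
  · intro h
    have e : ((↑) : X → α) '' (((↑) : X → α) ⁻¹' C) = C := by
      rw [Subtype.image_preimage_coe, Set.inter_eq_right.2 h.1.2]
    refine ⟨((↑) : X → α) ⁻¹' C, ?_, e⟩
    refine ⟨by rw [← isIrreducible_image_coe, e]; exact h.1.1, ?_⟩
    intro c hc hCc
    have h3 := h.2 ⟨(isIrreducible_image_coe c).2 hc, Subtype.coe_image_subset X c⟩ (by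
      rw [← e]; exact Set.image_mono hCc)
    exact Set.image_subset_iff.1 h3

theorem IsIrreducible.subset_of_subset_iUnion {Y ι : Type*} [TopologicalSpace Y] [Finite ι]
    {T : Set Y} (hT : IsIrreducible T) {Z : ι → Set Y} (hZ : ∀ i, IsClosed (Z i))
    (h : T ⊆ ⋃ i, Z i) : ∃ i, T ⊆ Z i := by
  classical
  have := (isIrreducible_iff_sUnion_isClosed.1 hT) (Set.finite_range Z).toFinset
    (by simpa using hZ) (by simpa using h)
  simpa using this

/-- If `X` is the union of finitely many closed curves none of which strictly contains another,
then these curves are its irreducible components. -/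
theorem isComponent_iUnion_iff {α Y : Type} {ι : Type*} [TopologicalSpace Y] [Infinite α]
    [Finite ι] {f : ι → α → Y} (hf : ∀ i, CofiniteContinuous (f i))
    (hcl : ∀ i, IsClosed (Set.range (f i)))
    (hsub : ∀ i j, Set.range (f i) ⊆ Set.range (f j) → Set.range (f i) = Set.range (f j))
    {C : Set Y} :
    IsComponent C (⋃ i, Set.range (f i)) ↔ ∃ i, C = Set.range (f i) := by
  rw [isComponent_iff_maximal]
  constructor
  · intro h
    obtain ⟨i, hi⟩ := IsIrreducible.subset_of_subset_iUnion h.1.1 hcl h.1.2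
    exact ⟨i, hi.antisymm
      (h.2 ⟨(hf i).isIrreducible_range, Set.subset_iUnion (fun i => Set.range (f i)) i⟩ hi)⟩
  · rintro ⟨i, rfl⟩
    refine ⟨⟨(hf i).isIrreducible_range, Set.subset_iUnion (fun i => Set.range (f i)) i⟩, ?_⟩
    rintro T ⟨hT, hTX⟩ hiT
    obtain ⟨j, hj⟩ := IsIrreducible.subset_of_subset_iUnion hT hcl hTX
    rw [hsub i j (Set.Subset.trans hiT hj)]
    exact hj

/-- A finite nonempty union of closed curves none of which strictly contains another has
dimension one. -/
theorem topologicalKrullDim_iUnion {α Y : Type} {ι : Type*} [TopologicalSpace Y] [T1Space Y]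
    [Infinite α] [Finite ι] [Nonempty ι] {f : ι → α → Y} (hf : ∀ i, CofiniteContinuous (f i))
    (hinj : ∀ i, Function.Injective (f i))
    (hcl : ∀ i, IsClosed (Set.range (f i)))
    (hsub : ∀ i j, Set.range (f i) ⊆ Set.range (f j) → Set.range (f i) = Set.range (f j)) :
    topologicalKrullDim ↥(⋃ i, Set.range (f i)) = 1 := by
  set X := ⋃ i, Set.range (f i) with hX
  have hYX : ∀ i, Set.range (f i) ⊆ X := Set.subset_iUnion (fun i => Set.range (f i))
  -- the closed irreducible subsets are points and whole curves
  have key : ∀ Z : TopologicalSpace.IrreducibleCloseds X, (Z : Set X).Subsingleton ∨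
      ∃ i, ((↑) : X → Y) ⁻¹' Set.range (f i) = Z := by
    intro Z
    have hZ := (isIrreducible_image_coe _).2 Z.isIrreducible
    obtain ⟨i, hi⟩ := IsIrreducible.subset_of_subset_iUnion hZ hcl
      (Subtype.coe_image_subset X _)
    obtain ⟨W, hW, hWZ⟩ := isClosed_induced_iff.1 Z.isClosed
    rcases hf i W hW with h1 | h1
    · right
      refine ⟨i, Set.Subset.antisymm ?_ (Set.image_subset_iff.1 hi)⟩
      rintro ⟨_, hy⟩ ⟨x, rfl⟩
      have : x ∈ f i ⁻¹' W := h1 ▸ Set.mem_univ x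
      rw [← hWZ]
      exact this
    · left
      have hfin : (Z : Set X).Finite := by
        refine Set.Finite.of_finite_image (f := ((↑) : X → Y)) ((h1.image (f i)).subset ?_)
          Subtype.val_injective.injOn
        rintro _ ⟨y, hy, rfl⟩
        obtain ⟨x, hx⟩ := hi ⟨y, hy, rfl⟩
        refine ⟨x, ?_, hx⟩
        change f i x ∈ W
        rw [hx]
        rw [← hWZ] at hy
        exact hy
      have : Finite (Z : Set X) := hfin
      obtain ⟨z, hz⟩ := IsIrreducible.subset_of_subset_iUnion (Z := fun z : (Z : Set X) => {z.1})
        Z.isIrreducible (fun z => isClosed_singleton) (fun z hz => Set.mem_iUnion.2 ⟨⟨z, hz⟩, rfl⟩)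
      exact Set.subsingleton_singleton.anti hz
  apply le_antisymm
  · rw [topologicalKrullDim, Order.krullDim_le_one_iff]
    intro Z
    rcases key Z with h | ⟨i, hi⟩
    · left
      intro Z' hZ' z hz
      obtain ⟨z', hz'⟩ := Z'.isIrreducible.nonempty
      rw [h hz (hZ' hz')]
      exact hz'
    · right
      intro Z' hZ'
      rcases key Z' with h | ⟨j, hj⟩
      · obtain ⟨z, hz⟩ := Z.isIrreducible.nonempty
        intro z' hz'
        rw [h hz' (hZ' hz)]
        exact hz
      · have hij : Set.range (f i) ⊆ Set.range (f j) := by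
          intro y hy
          have h1 : (⟨y, hYX i hy⟩ : X) ∈ (Z : Set X) := by rw [← hi]; exact hy
          have h2 : (⟨y, hYX i hy⟩ : X) ∈ (Z' : Set X) := hZ' h1
          rw [← hj] at h2
          exact h2
        change (Z' : Set X) ⊆ Z
        rw [← hi, ← hj, hsub i j hij]
  · rw [topologicalKrullDim, Order.one_le_krullDim_iff]
    obtain ⟨i⟩ := ‹Nonempty ι›
    obtain ⟨x, y, hxy⟩ := exists_pair_ne α
    have e : ((↑) : X → Y) '' (((↑) : X → Y) ⁻¹' Set.range (f i)) = Set.range (f i) := by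
      rw [Subtype.image_preimage_coe, Set.inter_eq_right.2 (hYX i)]
    have hx : f i x ∈ X := hYX i ⟨x, rfl⟩
    refine ⟨⟨{⟨f i x, hx⟩}, isIrreducible_singleton, isClosed_singleton⟩,
      ⟨((↑) : X → Y) ⁻¹' Set.range (f i),
        by rw [← isIrreducible_image_coe, e]; exact (hf i).isIrreducible_range,
        (hcl i).preimage continuous_subtype_val⟩, ?_, ?_⟩
    · rintro _ rfl
      exact ⟨x, rfl⟩
    · intro h
      have h1 : (⟨f i y, hYX i ⟨y, rfl⟩⟩ : X) ∈ ({⟨f i x, hx⟩} : Set X) := h ⟨y, rfl⟩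
      exact hxy (hinj i (congrArg Subtype.val h1)).symm

/-! ### Polynomial functions on the projective line -/

theorem eval_mvPolynomial_aeval {σ : Type*} (f : σ → ℝ[X]) (H : MvPolynomial σ ℝ) (t : ℝ) :
    (MvPolynomial.aeval f H).eval t = MvPolynomial.eval (fun s => (f s).eval t) H := by
  have := DFunLike.congr_fun (MvPolynomial.comp_aeval f (Polynomial.aeval (R := ℝ) t)) H
  rw [AlgHom.comp_apply, Polynomial.coe_aeval_eq_eval] at this
  rw [this, ← MvPolynomial.coe_aeval_eq_eval]
  rfl

/-- A function of a pair of real numbers that is given by a polynomial. -/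
def IsPolyFun (h : (Fin 2 → ℝ) → ℝ) : Prop :=
  ∃ H : MvPolynomial (Fin 2) ℝ, ∀ v, h v = MvPolynomial.eval v H

theorem IsPolyFun.const (c : ℝ) : IsPolyFun fun _ => c :=
  ⟨MvPolynomial.C c, fun v => by simp⟩

theorem IsPolyFun.add {h k : (Fin 2 → ℝ) → ℝ} (hh : IsPolyFun h) (hk : IsPolyFun k) :
    IsPolyFun fun v => h v + k v := by
  obtain ⟨H, hH⟩ := hh
  obtain ⟨K, hK⟩ := hk
  exact ⟨H + K, fun v => by simp [hH, hK]⟩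

theorem IsPolyFun.mul {h k : (Fin 2 → ℝ) → ℝ} (hh : IsPolyFun h) (hk : IsPolyFun k) :
    IsPolyFun fun v => h v * k v := by
  obtain ⟨H, hH⟩ := hh
  obtain ⟨K, hK⟩ := hk
  exact ⟨H * K, fun v => by simp [hH, hK]⟩

theorem IsPolyFun.sub {h k : (Fin 2 → ℝ) → ℝ} (hh : IsPolyFun h) (hk : IsPolyFun k) :
    IsPolyFun fun v => h v - k v := by
  obtain ⟨H, hH⟩ := hh
  obtain ⟨K, hK⟩ := hk
  exact ⟨H - K, fun v => by simp [hH, hK]⟩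

theorem IsPolyFun.linear (f : (Fin 2 → ℝ) →ₗ[ℝ] ℝ) : IsPolyFun f := by
  refine ⟨MvPolynomial.C (f ![1, 0]) * MvPolynomial.X 0 +
    MvPolynomial.C (f ![0, 1]) * MvPolynomial.X 1, fun v => ?_⟩
  have : v = v 0 • ![1, 0] + v 1 • ![0, 1] := by
    ext i; fin_cases i <;> simp
  conv_lhs => rw [this]
  simp only [map_add, map_smul, smul_eq_mul, MvPolynomial.eval_C, MvPolynomial.eval_X, map_mul]
  ring

theorem IsPolyFun.eval {σ : Type*} {x : (Fin 2 → ℝ) → σ → ℝ} (hx : ∀ s, IsPolyFun fun v => x v s)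
    (F : MvPolynomial σ ℝ) : IsPolyFun fun v => MvPolynomial.eval (x v) F := by
  choose H hH using hx
  refine ⟨MvPolynomial.bind₁ H F, fun v => ?_⟩
  have e : x v = fun s => MvPolynomial.eval v (H s) := funext fun s => hH s v
  beta_reduce
  rw [e, ← MvPolynomial.coe_aeval_eq_eval, ← MvPolynomial.coe_aeval_eq_eval]
  exact (MvPolynomial.aeval_bind₁ _ _ _).symm

theorem P1_eq_mk (x : P1) : (∃ (t : ℝ) (h : ![t, 1] ≠ 0), x = Projectivization.mk ℝ ![t, 1] h) ∨
    ∃ h : ![(1 : ℝ), 0] ≠ 0, x = Projectivization.mk ℝ ![1, 0] h := by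
  by_cases h1 : x.rep 1 = 0
  · right
    have h : ![(1 : ℝ), 0] ≠ 0 := fun h => by simpa using congrFun h 0
    refine ⟨h, ?_⟩
    conv_lhs => rw [← x.mk_rep]
    rw [Projectivization.mk_eq_mk_iff']
    refine ⟨x.rep 0, ?_⟩
    ext i
    fin_cases i
    · simp
    · simp [h1]
  · left
    have h : ![x.rep 0 / x.rep 1, 1] ≠ 0 := fun h => by simpa using congrFun h 1
    refine ⟨x.rep 0 / x.rep 1, h, ?_⟩
    conv_lhs => rw [← x.mk_rep]
    rw [Projectivization.mk_eq_mk_iff']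
    refine ⟨x.rep 1, ?_⟩
    ext i
    fin_cases i
    · simp; field_simp
    · simp

instance : Infinite P1 := by
  have h : ∀ t : ℝ, ![t, 1] ≠ 0 := fun t h => by simpa using congrFun h 1
  refine Infinite.of_injective (fun t : ℝ => Projectivization.mk ℝ ![t, 1] (h t)) ?_
  intro s t hst
  obtain ⟨c, hc⟩ := (Projectivization.mk_eq_mk_iff' ..).1 hst
  have h0 := congrFun hc 0
  have h1 := congrFun hc 1
  simp at h0 h1
  rw [← h0, h1, one_mul]

/-- A polynomial function on `ℝ²` whose zero set is a cone vanishes at finitely many points of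
`ℙ¹` or everywhere. -/
theorem IsPolyFun.zeros_finite_or {h : (Fin 2 → ℝ) → ℝ} (hp : IsPolyFun h)
    (hs : ∀ (c : ℝ) (v : Fin 2 → ℝ), c ≠ 0 → h v = 0 → h (c • v) = 0) :
    (∀ x : P1, h x.rep = 0) ∨ {x : P1 | h x.rep = 0}.Finite := by
  obtain ⟨H, hH⟩ := hp
  have hpoint : ∀ (v : Fin 2 → ℝ) (hv : v ≠ 0), h (Projectivization.mk ℝ v hv).rep = 0 ↔
      h v = 0 := by
    intro v hv
    obtain ⟨c, hc⟩ := Projectivization.exists_smul_eq_mk_rep ℝ v hv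
    rw [← hc]
    refine ⟨fun h1 => ?_, fun h1 => hs c v c.ne_zero h1⟩
    have := hs (c⁻¹ : ℝˣ) _ (c⁻¹).ne_zero h1
    rw [Units.smul_def, smul_smul] at this
    simpa using this
  -- the restrictions to the two affine charts
  set p : ℝ[X] := MvPolynomial.aeval ![X, C 1] H with hpdef
  have hpe : ∀ t, p.eval t = h ![t, 1] := by
    intro t
    rw [hH, hpdef, eval_mvPolynomial_aeval]
    congr 2
    ext i; fin_cases i <;> simp
  set q : ℝ[X] := MvPolynomial.aeval ![C 1, X] H with hqdef
  have hqe : ∀ t, q.eval t = h ![1, t] := by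
    intro t
    rw [hH, hqdef, eval_mvPolynomial_aeval]
    congr 2
    ext i; fin_cases i <;> simp
  by_cases hp0 : p = 0
  · left
    have hp1 : ∀ t, h ![t, 1] = 0 := fun t => by rw [← hpe, hp0, eval_zero]
    have hq0 : q = 0 := by
      refine Polynomial.eq_zero_of_infinite_isRoot q
        ((Set.finite_singleton (0 : ℝ)).infinite_compl.mono fun s hs0 => ?_)
      have hs0 : s ≠ 0 := hs0
      have := hs s _ hs0 (hp1 s⁻¹)
      change q.eval s = 0
      rw [hqe, ← this]
      congr 1
      ext i; fin_cases i <;> simp [hs0]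
    intro x
    rcases P1_eq_mk x with ⟨t, ht, rfl⟩ | ⟨ht, rfl⟩
    · rw [hpoint, hp1]
    · rw [hpoint, ← hqe, hq0, eval_zero]
  · right
    have hne : ∀ t : ℝ, ![t, 1] ≠ 0 := fun t h => by simpa using congrFun h 1
    have hne' : ![(1 : ℝ), 0] ≠ 0 := fun h => by simpa using congrFun h 0
    refine (((p.roots.toFinset.finite_toSet).image
      (fun t => Projectivization.mk ℝ ![t, 1] (hne t))).union
      (Set.finite_singleton (Projectivization.mk ℝ ![1, 0] hne'))).subset ?_
    intro x hx
    rcases P1_eq_mk x with ⟨t, ht, rfl⟩ | ⟨ht, rfl⟩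
    · left
      refine ⟨t, ?_, rfl⟩
      have : h ![t, 1] = 0 := (hpoint _ ht).1 hx
      simpa [hp0, hpe] using this
    · right
      rfl

/-! ### Curves of Möbius transformations in products of projective lines -/

/-- Linear automorphisms of the real plane, which act on `ℙ¹` as Möbius transformations. -/
noncomputable abbrev PlaneAut := (Fin 2 → ℝ) ≃ₗ[ℝ] (Fin 2 → ℝ)

/-- The parametrized curve `x ↦ (g_d x)_d` in a product of projective lines, for a family of
Möbius transformations `g`. -/
noncomputable def mobiusCurve {ι : Type} (g : ι → PlaneAut) (x : P1) : MultiProj ι :=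
  fun d => g d • x

theorem IsPolyFun.aut (g : PlaneAut) (i : Fin 2) : IsPolyFun fun v => g v i :=
  IsPolyFun.linear (LinearMap.proj i ∘ₗ g.toLinearMap)

theorem rep_smul_eq (g : PlaneAut) (x : P1) : ∃ c : ℝ, c ≠ 0 ∧ (g • x).rep = c • g x.rep := by
  have hv : g x.rep ≠ 0 := by simpa using x.rep_nonzero
  have e : g • x = Projectivization.mk ℝ (g x.rep) hv := by
    conv_lhs => rw [← x.mk_rep]
    rw [Projectivization.smul_mk]
    rfl
  obtain ⟨c, hc⟩ := Projectivization.exists_smul_eq_mk_rep ℝ (g x.rep) hv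
  exact ⟨c, c.ne_zero, by rw [e, ← hc]; rfl⟩

/-- Two points of `ℙ¹` agree if and only if their coordinate vectors are linearly dependent. -/
theorem P1_eq_iff_det (x y : P1) : x = y ↔ x.rep 0 * y.rep 1 - x.rep 1 * y.rep 0 = 0 := by
  constructor
  · rintro rfl; ring
  · intro h
    conv_lhs => rw [← x.mk_rep]
    conv_rhs => rw [← y.mk_rep]
    rw [Projectivization.mk_eq_mk_iff']
    by_cases hb0 : y.rep 0 = 0
    · have hb1 : y.rep 1 ≠ 0 := by
        intro hb1
        exact y.rep_nonzero (by
          ext i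
          fin_cases i
          · exact hb0
          · exact hb1)
      refine ⟨x.rep 1 / y.rep 1, ?_⟩
      ext i
      fin_cases i
      · simp only [Pi.smul_apply, smul_eq_mul]
        change x.rep 1 / y.rep 1 * y.rep 0 = x.rep 0
        field_simp
        linarith
      · simp only [Pi.smul_apply, smul_eq_mul]
        change x.rep 1 / y.rep 1 * y.rep 1 = x.rep 1
        field_simp
    · refine ⟨x.rep 0 / y.rep 0, ?_⟩
      ext i
      fin_cases i
      · simp only [Pi.smul_apply, smul_eq_mul]
        change x.rep 0 / y.rep 0 * y.rep 0 = x.rep 0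
        field_simp
      · simp only [Pi.smul_apply, smul_eq_mul]
        change x.rep 0 / y.rep 0 * y.rep 1 = x.rep 1
        field_simp
        linarith

open Classical in
theorem IsMultihomogeneous.eval_smul {ι : Type} [Finite ι] {F : MvPolynomial (ι × Fin 2) ℝ}
    {m : ι → ℕ} (hF : IsMultihomogeneous F m) (c : ι → ℝ) (v : ι × Fin 2 → ℝ) :
    ∃ k : ℝ, ((∀ i, c i ≠ 0) → k ≠ 0) ∧
      MvPolynomial.eval (fun p => c p.1 * v p) F = k * MvPolynomial.eval v F := by
  have := Fintype.ofFinite ι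
  refine ⟨∏ i, c i ^ m i, fun h => Finset.prod_ne_zero_iff.2 fun i _ => pow_ne_zero _ (h i), ?_⟩
  rw [MvPolynomial.eval_eq', MvPolynomial.eval_eq', Finset.mul_sum]
  refine Finset.sum_congr rfl fun e he => ?_
  have h1 : ∏ p : ι × Fin 2, (c p.1 * v p) ^ e p
      = (∏ i, c i ^ m i) * ∏ p : ι × Fin 2, v p ^ e p := by
    simp only [mul_pow, Finset.prod_mul_distrib]
    congr 1
    rw [Fintype.prod_prod_type]
    refine Finset.prod_congr rfl fun i _ => ?_
    have h2 := hF i (MvPolynomial.mem_support_iff.1 he)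
    rw [Finsupp.weight_apply, Finsupp.sum_fintype _ _ (by simp), Fintype.sum_prod_type,
      Finset.sum_eq_single i (fun j _ hj => by simp [hj]) (by simp)] at h2
    simp at h2
    rw [Fin.prod_univ_two, ← pow_add, h2]
  rw [h1]; ring

open Classical in
theorem isMultihomogeneous_X {ι : Type} (i : ι) (j : Fin 2) :
    IsMultihomogeneous (MvPolynomial.X (i, j) : MvPolynomial (ι × Fin 2) ℝ)
      (fun k => if i = k then 1 else 0) := by
  intro k
  exact MvPolynomial.isWeightedHomogeneous_X _ _ _

theorem IsMultihomogeneous.mul {ι : Type} {F G : MvPolynomial (ι × Fin 2) ℝ} {m n : ι → ℕ}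
    (hF : IsMultihomogeneous F m) (hG : IsMultihomogeneous G n) :
    IsMultihomogeneous (F * G) (m + n) :=
  fun k => MvPolynomial.IsWeightedHomogeneous.mul (hF k) (hG k)

theorem IsMultihomogeneous.sub {ι : Type} {F G : MvPolynomial (ι × Fin 2) ℝ} {m : ι → ℕ}
    (hF : IsMultihomogeneous F m) (hG : IsMultihomogeneous G m) :
    IsMultihomogeneous (F - G) m :=
  fun k => (MvPolynomial.weightedHomogeneousSubmodule ℝ _ _).sub_mem (hF k) (hG k)

open Classical in
/-- Linear forms in the two coordinates of one factor. -/
theorem isMultihomogeneous_linear {ι : Type} (i : ι) (a b : ℝ) :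
    IsMultihomogeneous (MvPolynomial.C a * MvPolynomial.X (i, 0) +
      MvPolynomial.C b * MvPolynomial.X (i, 1) : MvPolynomial (ι × Fin 2) ℝ)
      (fun k => if i = k then 1 else 0) := by
  intro k
  refine (MvPolynomial.weightedHomogeneousSubmodule ℝ _ _).add_mem ?_ ?_
  · rw [← MvPolynomial.smul_eq_C_mul]
    exact Submodule.smul_mem _ a (isMultihomogeneous_X i 0 k)
  · rw [← MvPolynomial.smul_eq_C_mul]
    exact Submodule.smul_mem _ b (isMultihomogeneous_X i 1 k)

theorem isClosed_evalAt_eq_zero {ι : Type} {F : MvPolynomial (ι × Fin 2) ℝ} {m : ι → ℕ}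
    (hF : IsMultihomogeneous F m) : IsClosed {x : MultiProj ι | evalAt F x = 0} :=
  ⟨TopologicalSpace.isOpen_generateFrom_of_mem ⟨m, F, hF, rfl⟩⟩

theorem PlaneAut.apply_eq (g : PlaneAut) (v : Fin 2 → ℝ) (i : Fin 2) :
    g v i = g ![1, 0] i * v 0 + g ![0, 1] i * v 1 := by
  have : v = v 0 • ![1, 0] + v 1 • ![0, 1] := by
    ext i; fin_cases i <;> simp
  conv_lhs => rw [this]
  simp only [map_add, map_smul, Pi.add_apply, Pi.smul_apply, smul_eq_mul]
  ring

/-- The linear form that gives the `j`-th coordinate of `g xᵢ`, for a point `x` of `(ℙ¹)^ι`. -/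
noncomputable def coordForm {ι : Type} (i : ι) (g : PlaneAut) (j : Fin 2) :
    MvPolynomial (ι × Fin 2) ℝ :=
  MvPolynomial.C (g ![1, 0] j) * MvPolynomial.X (i, 0) +
    MvPolynomial.C (g ![0, 1] j) * MvPolynomial.X (i, 1)

theorem evalAt_coordForm {ι : Type} (i : ι) (g : PlaneAut) (j : Fin 2) (x : MultiProj ι) :
    evalAt (coordForm i g j) x = g (x i).rep j := by
  rw [PlaneAut.apply_eq]
  simp [evalAt, coordForm]

theorem isClosed_smul_eq {ι : Type} (d e : ι) (g : PlaneAut) :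
    IsClosed {x : MultiProj ι | x e = g • x d} := by
  classical
  have h : IsMultihomogeneous
      (coordForm e 1 0 * coordForm d g 1 - coordForm e 1 1 * coordForm d g 0) _ :=
    ((isMultihomogeneous_linear e _ _).mul (isMultihomogeneous_linear d _ _)).sub
      ((isMultihomogeneous_linear e _ _).mul (isMultihomogeneous_linear d _ _))
  convert isClosed_evalAt_eq_zero h using 1
  ext x
  simp only [Set.mem_ofPred_eq]
  have e1 : evalAt (coordForm e 1 0 * coordForm d g 1 - coordForm e 1 1 * coordForm d g 0) x
      = (x e).rep 0 * g (x d).rep 1 - (x e).rep 1 * g (x d).rep 0 := by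
    have : ∀ F G : MvPolynomial (ι × Fin 2) ℝ, evalAt (F * G) x = evalAt F x * evalAt G x :=
      fun F G => by simp [evalAt]
    have h2 : ∀ F G : MvPolynomial (ι × Fin 2) ℝ, evalAt (F - G) x = evalAt F x - evalAt G x :=
      fun F G => by simp [evalAt]
    rw [h2, this, this]
    simp only [evalAt_coordForm]
    rfl
  rw [e1, P1_eq_iff_det]
  obtain ⟨c, hc, hrep⟩ := rep_smul_eq g (x d)
  rw [hrep]
  simp only [Pi.smul_apply, smul_eq_mul]
  constructor
  · intro h
    apply mul_left_cancel₀ hc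
    linear_combination h
  · intro h
    linear_combination c * h

theorem mobiusCurve_injective {ι : Type} [Nonempty ι] (g : ι → PlaneAut) :
    Function.Injective (mobiusCurve g) := by
  intro x y h
  obtain ⟨d⟩ := ‹Nonempty ι›
  exact MulAction.injective (g d) (congrFun h d)

theorem mem_range_mobiusCurve_iff {ι : Type} (g : ι → PlaneAut) (d : ι) (x : MultiProj ι) :
    x ∈ Set.range (mobiusCurve g) ↔ x = mobiusCurve g ((g d)⁻¹ • x d) := by
  constructor
  · rintro ⟨y, rfl⟩
    simp [mobiusCurve]
  · intro h
    exact ⟨_, h.symm⟩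

theorem isClosed_range_mobiusCurve {ι : Type} [Nonempty ι] (g : ι → PlaneAut) :
    IsClosed (Set.range (mobiusCurve g)) := by
  obtain ⟨d⟩ := ‹Nonempty ι›
  have : Set.range (mobiusCurve g) = ⋂ e, {x | x e = (g e * (g d)⁻¹) • x d} := by
    ext x
    rw [mem_range_mobiusCurve_iff g d]
    simp only [Set.mem_iInter, Set.mem_ofPred_eq, mul_smul]
    exact ⟨fun h e => congrFun h e, fun h => funext h⟩
  rw [this]
  exact isClosed_iInter fun e => isClosed_smul_eq d e _

theorem range_mobiusCurve_eq_of_subset {ι : Type} [Nonempty ι] {g h : ι → PlaneAut}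
    (hgh : Set.range (mobiusCurve g) ⊆ Set.range (mobiusCurve h)) :
    Set.range (mobiusCurve g) = Set.range (mobiusCurve h) := by
  refine hgh.antisymm ?_
  rintro _ ⟨x, rfl⟩
  obtain ⟨d⟩ := ‹Nonempty ι›
  have h1 := (mem_range_mobiusCurve_iff h d _).1 (hgh ⟨(g d)⁻¹ • h d • x, rfl⟩)
  simp only [mobiusCurve, smul_inv_smul, inv_smul_smul] at h1
  exact ⟨_, h1⟩

instance {ι : Type} : T1Space (MultiProj ι) := by
  classical
  refine ⟨fun y => ?_⟩
  have : ({y} : Set (MultiProj ι)) = ⋂ e, {x | x e = y e} := by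
    ext x
    simp only [Set.mem_singleton_iff, Set.mem_iInter, Set.mem_ofPred_eq]
    exact ⟨fun h e => congrFun h e, fun h => funext h⟩
  rw [this]
  refine isClosed_iInter fun e => ?_
  convert isClosed_evalAt_eq_zero
    (isMultihomogeneous_linear e ((y e).rep 1) (-(y e).rep 0)) using 1
  ext x
  simp only [Set.mem_ofPred_eq]
  rw [P1_eq_iff_det]
  simp only [evalAt, map_add, map_mul, MvPolynomial.eval_C, MvPolynomial.eval_X]
  constructor <;> intro h <;> linear_combination h

theorem cofiniteContinuous_mobiusCurve {ι : Type} [Finite ι] (g : ι → PlaneAut) :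
    CofiniteContinuous (mobiusCurve g) := by
  refine CofiniteContinuous.of_generateFrom ?_
  rintro U ⟨m, F, hF, hU⟩
  obtain ⟨h, hh⟩ : ∃ h : (Fin 2 → ℝ) → ℝ,
      h = fun v => MvPolynomial.eval (fun p : ι × Fin 2 => g p.1 v p.2) F := ⟨_, rfl⟩
  have hp : IsPolyFun h := hh ▸ IsPolyFun.eval (x := fun v (p : ι × Fin 2) => g p.1 v p.2)
    (fun p => IsPolyFun.aut (g p.1) p.2) F
  have hs : ∀ (c : ℝ) (v : Fin 2 → ℝ), c ≠ 0 → h v = 0 → h (c • v) = 0 := by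
    intro c v _ h0
    obtain ⟨k, -, hk⟩ := hF.eval_smul (fun _ => c) (fun p => g p.1 v p.2)
    simp only [hh, map_smul, Pi.smul_apply, smul_eq_mul] at h0 ⊢
    rw [hk, h0, mul_zero]
  have hz : ∀ x : P1, evalAt F (mobiusCurve g x) = 0 ↔ h x.rep = 0 := by
    intro x
    choose c hc0 hc using fun d => rep_smul_eq (g d) x
    obtain ⟨k, hk0, hk⟩ := hF.eval_smul c (fun p => g p.1 x.rep p.2)
    have e : (fun v : ι × Fin 2 => (mobiusCurve g x v.1).rep v.2)
        = fun p => c p.1 * g p.1 x.rep p.2 := by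
      funext p
      rw [mobiusCurve, hc, Pi.smul_apply, smul_eq_mul]
    rw [evalAt, e, hk, hh, mul_eq_zero, or_iff_right (hk0 hc0)]
  rw [hU]
  rcases hp.zeros_finite_or hs with h1 | h1
  · left
    rw [Set.eq_empty_iff_forall_notMem]
    intro x hx
    exact hx ((hz x).2 (h1 x))
  · right
    refine h1.subset fun x hx => (hz x).1 ?_
    exact not_not.1 hx

/-- A selection of coordinates is an isomorphism between Möbius curves: the inverse is given by
the Möbius transformations in terms of any one of the selected coordinates. -/
theorem isIsoOn_range_mobiusCurve {ι κ : Type} [Nonempty κ] (g : ι → PlaneAut) (m : κ → ι) :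
    IsIsoOn (Set.range (mobiusCurve g)) (Set.range (mobiusCurve (g ∘ m)))
      (fun x j => x (m j)) := by
  classical
  obtain ⟨j₀⟩ := ‹Nonempty κ›
  have hne : ∀ x : P1, ![x.rep 0, x.rep 1] ≠ 0 := fun x h => x.rep_nonzero (by
    ext i
    fin_cases i
    · exact congrFun h 0
    · exact congrFun h 1)
  have hmk : ∀ (x : P1) h, x = Projectivization.mk ℝ ![x.rep 0, x.rep 1] h := by
    intro x h
    conv_lhs => rw [← x.mk_rep]
    congr 1
    ext i; fin_cases i <;> rfl
  refine ⟨?_, ⟨?_, ?_, ?_⟩, fun y => mobiusCurve g ((g (m j₀))⁻¹ • y j₀), ⟨?_, ?_⟩, ?_⟩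
  · intro j x _
    refine ⟨_, _, _, isMultihomogeneous_X (m j) 0, isMultihomogeneous_X (m j) 1, ?_, ?_⟩
    · simpa [evalAt] using hne (x (m j))
    · intro y _ h
      simp only [evalAt, MvPolynomial.eval_X] at h ⊢
      exact hmk _ _
  · rintro _ ⟨x, rfl⟩
    exact ⟨x, rfl⟩
  · rintro _ ⟨x, rfl⟩ _ ⟨y, rfl⟩ h
    have h1 := congrFun h j₀
    rw [MulAction.injective (g (m j₀)) h1]
  · rintro _ ⟨x, rfl⟩
    exact ⟨_, ⟨x, rfl⟩, rfl⟩
  · rintro _ ⟨x, rfl⟩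
    simp [mobiusCurve]
  · rintro _ ⟨x, rfl⟩
    funext j
    simp [mobiusCurve]
  · intro i x _
    have key : ∀ (y : MultiProj κ), ![evalAt (coordForm j₀ (g i * (g (m j₀))⁻¹) 0) y,
        evalAt (coordForm j₀ (g i * (g (m j₀))⁻¹) 1) y]
        = (g i * (g (m j₀))⁻¹) (y j₀).rep := by
      intro y
      simp only [evalAt_coordForm]
      ext i; fin_cases i <;> rfl
    refine ⟨_, coordForm j₀ (g i * (g (m j₀))⁻¹) 0, coordForm j₀ (g i * (g (m j₀))⁻¹) 1,
      isMultihomogeneous_linear j₀ _ _, isMultihomogeneous_linear j₀ _ _, ?_, ?_⟩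
    · rw [key]
      simpa using (x j₀).rep_nonzero
    · intro y _ h
      simp only [key, mobiusCurve]
      rw [← mul_smul]
      conv_lhs => rw [← (y j₀).mk_rep, Projectivization.smul_mk]
      rfl

/-! ### Parametrized curves and their Zariski closures -/

/-- The homogeneous coordinate ring of a parametrized curve, embedded in a polynomial ring in two
variables: the `i`-th coordinate is sent to `fᵢ(t) x`, where `x` records the degree. -/
noncomputable def coneHom {σ : Type} (f : σ → ℝ[X]) : MvPolynomial σ ℝ →ₐ[ℝ] ℝ[X][X] :=
  MvPolynomial.aeval fun i => C (f i) * X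

theorem coneHom_of_isHomogeneous {σ : Type} (f : σ → ℝ[X]) {m : ℕ} {G : MvPolynomial σ ℝ}
    (hG : G.IsHomogeneous m) : coneHom f G = C (MvPolynomial.aeval f G) * X ^ m := by
  rw [coneHom, MvPolynomial.aeval_def, MvPolynomial.aeval_def, MvPolynomial.eval₂_eq,
    MvPolynomial.eval₂_eq, map_sum, Finset.sum_mul]
  refine Finset.sum_congr rfl fun d hd => ?_
  have h1 : d.degree = m := by
    rw [Finsupp.degree_eq_weight_one]
    exact hG (MvPolynomial.mem_support_iff.1 hd)
  simp only [mul_pow, Finset.prod_mul_distrib, Finset.prod_pow_eq_pow_sum, map_mul, map_prod,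
    map_pow]
  rw [← h1, Finsupp.degree_apply, mul_assoc]
  rfl

theorem coeff_coneHom {σ : Type} (f : σ → ℝ[X]) (p : MvPolynomial σ ℝ) (m : ℕ) :
    (coneHom f p).coeff m = MvPolynomial.aeval f (MvPolynomial.homogeneousComponent m p) := by
  conv_lhs => rw [← MvPolynomial.sum_homogeneousComponent p, map_sum, finsetSum_coeff]
  have h1 : ∀ i, (coneHom f (MvPolynomial.homogeneousComponent i p)).coeff m =
      if i = m then MvPolynomial.aeval f (MvPolynomial.homogeneousComponent m p) else 0 := by
    intro i
    rw [coneHom_of_isHomogeneous f (MvPolynomial.homogeneousComponent_isHomogeneous i p),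
      coeff_C_mul_X_pow]
    split_ifs with h1 h2 h3
    · rw [h1]
    · exact absurd h1.symm h2
    · exact absurd h3.symm h1
    · rfl
  simp only [h1]
  rw [Finset.sum_ite_eq']
  split_ifs with h2
  · rfl
  · rw [MvPolynomial.homogeneousComponent_eq_zero, map_zero]
    simpa using h2

theorem trdeg_polynomial_polynomial : Algebra.trdeg ℝ ℝ[X][X] = 2 := by
  rw [← trdeg_add_eq ℝ ℝ[X] (A := ℝ[X][X]), Polynomial.trdeg_of_isDomain,
    Polynomial.trdeg_of_isDomain, one_add_one_eq_two]

/-- On a curve that is not constant, two of the homogeneous coordinates are algebraically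
independent in the homogeneous coordinate ring. -/
theorem aeval_coneHom_ne_zero {a b : ℝ[X]} (ha : a ≠ 0) (hb : ∀ r : ℝ, b ≠ C r * a)
    {q : MvPolynomial (Fin 2) ℝ} (hq : q ≠ 0) :
    MvPolynomial.aeval (R := ℝ) ![(C a * X : ℝ[X][X]), C b * X] q ≠ 0 := by
  intro h0
  apply hq
  -- the form vanishes on all lines through the origin with slopes `b(t) / a(t)`
  have h1 : ∀ t x : ℝ, MvPolynomial.eval ![a.eval t * x, b.eval t * x] q = 0 := by
    intro t x
    have h2 := congrArg (fun p : ℝ[X][X] => (p.eval (C x)).eval t) h0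
    have h3 := DFunLike.congr_fun (MvPolynomial.comp_aeval (R := ℝ)
      ![(C a * X : ℝ[X][X]), C b * X]
      ((Polynomial.aeval (R := ℝ) t).comp ((Polynomial.aeval (R := ℝ[X]) (C x)).restrictScalars ℝ)))
      q
    rw [AlgHom.comp_apply, h0, map_zero] at h3
    rw [← MvPolynomial.coe_aeval_eq_eval]
    refine Eq.trans ?_ h3.symm
    change MvPolynomial.aeval _ q = MvPolynomial.aeval _ q
    congr 2
    ext i
    fin_cases i <;> simp
  have hinf : (Set.range fun t : {t : ℝ // a.eval t ≠ 0} => b.eval t.1 / a.eval t.1).Infinite := by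
    intro hfin
    have h2 : (⋃ r ∈ (Set.range fun t : {t : ℝ // a.eval t ≠ 0} => b.eval t.1 / a.eval t.1),
        {t : ℝ | (b - C r * a).IsRoot t}).Finite := by
      refine hfin.biUnion fun r _ => ?_
      exact Polynomial.finite_setOfPred_isRoot (sub_ne_zero.2 (hb r))
    have h3 : {t : ℝ | a.IsRoot t}.Finite := Polynomial.finite_setOfPred_isRoot ha
    obtain ⟨t, ht⟩ := (h2.union h3).infinite_compl.nonempty
    simp only [Set.mem_compl_iff, Set.mem_union, not_or] at ht
    have h4 : a.eval t ≠ 0 := ht.2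
    refine ht.1 (Set.mem_biUnion ⟨⟨t, h4⟩, rfl⟩ ?_)
    change (b - C (b.eval t / a.eval t) * a).eval t = 0
    simp
    field_simp
    ring
  have h4 : ∀ x y : ℝ, x ≠ 0 → MvPolynomial.eval ![x, y] q = 0 := by
    intro x y hx
    set p : ℝ[X] := MvPolynomial.aeval ![C x, X] q with hp
    have hpe : ∀ y, p.eval y = MvPolynomial.eval ![x, y] q := by
      intro y
      rw [hp, eval_mvPolynomial_aeval]
      congr 2
      ext i
      fin_cases i <;> simp
    have : p = 0 := by
      refine Polynomial.eq_zero_of_infinite_isRoot p ((hinf.image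
        (f := fun r => x * r) (mul_right_injective₀ hx).injOn).mono ?_)
      rintro _ ⟨_, ⟨⟨t, ht⟩, rfl⟩, rfl⟩
      change p.eval _ = 0
      rw [hpe]
      refine Eq.trans ?_ (h1 t (x / a.eval t))
      congr 2
      ext i
      fin_cases i
      · simp; field_simp
      · simp; field_simp
    rw [← hpe, this, eval_zero]
  refine MvPolynomial.funext_set (fun i => ![{0}ᶜ, Set.univ] i) ?_ ?_
  · intro i
    fin_cases i
    · exact (Set.finite_singleton (0 : ℝ)).infinite_compl
    · exact Set.infinite_univ
  · intro x hx
    rw [map_zero, ← h4 (x 0) (x 1) (by simpa using hx 0 (Set.mem_univ _))]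
    congr 2
    ext i
    fin_cases i <;> rfl

/-- If the Zariski closure of one parametrized curve contains another curve that is not constant,
then the two closures agree: a form that vanishes on the second curve vanishes on the first. The
reason is that the homogeneous coordinate ring of the first curve has transcendence degree at most
two, and the one of the second curve has transcendence degree two. -/
theorem aeval_eq_zero_of_aeval_eq_zero {σ : Type} {f φ : σ → ℝ[X]}
    (hsub : ∀ (m : ℕ) (G : MvPolynomial σ ℝ), G.IsHomogeneous m → MvPolynomial.aeval f G = 0 →
      MvPolynomial.aeval φ G = 0)
    (hφ : ∃ i j, φ i ≠ 0 ∧ ∀ r : ℝ, φ j ≠ C r * φ i)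
    {m : ℕ} {F : MvPolynomial σ ℝ} (hF : F.IsHomogeneous m) (h0 : MvPolynomial.aeval φ F = 0) :
    MvPolynomial.aeval f F = 0 := by
  by_contra hne
  obtain ⟨i, j, hi, hj⟩ := hφ
  have hker : ∀ p, coneHom f p = 0 → coneHom φ p = 0 := by
    intro p hp
    ext1 k
    rw [coeff_coneHom, coeff_zero]
    refine hsub k _ (MvPolynomial.homogeneousComponent_isHomogeneous k p) ?_
    rw [← coeff_coneHom, hp, coeff_zero]
  have hF0 : coneHom φ F = 0 := by rw [coneHom_of_isHomogeneous φ hF, h0, map_zero, zero_mul]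
  have hF1 : coneHom f F ≠ 0 := by
    rw [coneHom_of_isHomogeneous f hF]
    exact mul_ne_zero (C_ne_zero.2 hne) (pow_ne_zero _ X_ne_zero)
  -- a relation between `F` and the two coordinates on the first curve
  set y : Fin 3 → MvPolynomial σ ℝ :=
    Fin.cons F ![MvPolynomial.X i, MvPolynomial.X j] with hy
  have hdep : ¬ AlgebraicIndependent ℝ (fun k => coneHom f (y k)) := by
    intro h
    have h1 := h.cardinalMk_le_trdeg
    rw [trdeg_polynomial_polynomial, Cardinal.mk_fin] at h1
    norm_num at h1
  rw [algebraicIndependent_iff] at hdep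
  push Not at hdep
  obtain ⟨p, hp, hp0⟩ := hdep
  set P := MvPolynomial.finSuccEquiv ℝ 2 p with hP
  have hP0 : P ≠ 0 := by
    rw [hP]
    exact (map_ne_zero_iff _ (MvPolynomial.finSuccEquiv ℝ 2).injective).2 hp0
  obtain ⟨Q, hQ, hQ0⟩ := Polynomial.exists_eq_pow_rootMultiplicity_mul_and_not_dvd P hP0 0
  rw [C_0, sub_zero] at hQ hQ0
  rw [Polynomial.X_dvd_iff] at hQ0
  -- cancel the factors `F`
  set E : MvPolynomial (Fin 2) ℝ →ₐ[ℝ] MvPolynomial σ ℝ :=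
    MvPolynomial.aeval ![MvPolynomial.X i, MvPolynomial.X j] with hE
  have hev : MvPolynomial.aeval y p = P.eval₂ (E : MvPolynomial (Fin 2) ℝ →+* _) F := by
    have h1 : MvPolynomial.aeval y = (Polynomial.eval₂AlgHom E F fun _ => Commute.all _ _).comp
        ((MvPolynomial.finSuccEquiv ℝ 2 : _ ≃ₐ[ℝ] _) : _ →ₐ[ℝ] _) := by
      ext k
      refine Fin.cases ?_ (fun k => ?_) k
      · simp [hy, MvPolynomial.finSuccEquiv_X_zero]
      · simp [hy, hE, MvPolynomial.finSuccEquiv_X_succ]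
    rw [h1]
    rfl
  have h2 : coneHom f (Q.eval₂ (E : MvPolynomial (Fin 2) ℝ →+* _) F) = 0 := by
    have h3 : coneHom f (MvPolynomial.aeval y p) = 0 := by
      rw [← hp, ← AlgHom.comp_apply, MvPolynomial.comp_aeval]
    rw [hev, hQ, eval₂_mul, eval₂_pow, eval₂_X, map_mul, map_pow, mul_eq_zero] at h3
    exact h3.resolve_left (pow_ne_zero _ hF1)
  have h4 := hker _ h2
  -- on the second curve only the constant coefficient of the relation survives
  have h5 : coneHom φ (E (Q.coeff 0)) = 0 := by
    have h6 : Q.eval₂ (E : MvPolynomial (Fin 2) ℝ →+* _) F = E (Q.coeff 0) +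
        F * Q.divX.eval₂ (E : MvPolynomial (Fin 2) ℝ →+* _) F := by
      conv_lhs => rw [← Q.divX_mul_X_add]
      rw [eval₂_add, eval₂_mul, eval₂_X, eval₂_C]
      simp
      ring
    rw [h6, map_add, map_mul, hF0, zero_mul, add_zero] at h4
    exact h4
  refine aeval_coneHom_ne_zero hi hj hQ0 ?_
  rw [← h5, hE, ← AlgHom.comp_apply, MvPolynomial.comp_aeval]
  congr 2
  ext1 k
  fin_cases k <;> simp [coneHom]

/-! ### The Zariski topology of `ℙ³` -/

theorem mem_closure_iff_forall_form {A : Set (ℙ ℝ Mot)} {y : ℙ ℝ Mot} :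
    y ∈ closure A ↔ ∀ (m : ℕ) (F : MvPolynomial (Fin 4) ℝ), F.IsHomogeneous m →
      (∀ x ∈ A, MvPolynomial.eval x.rep.coord F = 0) → MvPolynomial.eval y.rep.coord F = 0 := by
  have hb : TopologicalSpace.IsTopologicalBasis {U | ∃ (m : ℕ) (F : MvPolynomial (Fin 4) ℝ),
      F.IsHomogeneous m ∧ U = {x : ℙ ℝ Mot | MvPolynomial.eval x.rep.coord F ≠ 0}} := by
    have h := TopologicalSpace.isTopologicalBasis_of_subbasis_of_inter
      (r := {U | ∃ (m : ℕ) (F : MvPolynomial (Fin 4) ℝ), F.IsHomogeneous m ∧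
        U = {x : ℙ ℝ Mot | MvPolynomial.eval x.rep.coord F ≠ 0}}) rfl (by
        rintro _ ⟨m, F, hF, rfl⟩ _ ⟨n, G, hG, rfl⟩
        refine ⟨m + n, F * G, hF.mul hG, ?_⟩
        ext x
        simp)
    rwa [Set.insert_eq_of_mem] at h
    exact ⟨0, 1, MvPolynomial.isHomogeneous_one _ _, by simp⟩
  rw [hb.mem_closure_iff]
  constructor
  · intro h m F hF hA
    by_contra hne
    obtain ⟨x, hx, hxA⟩ := h _ ⟨m, F, hF, rfl⟩ hne
    exact hx (hA x hxA)
  · rintro h _ ⟨m, F, hF, rfl⟩ hy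
    by_contra hne
    refine hy (h m F hF fun x hx => ?_)
    by_contra hxF
    exact hne ⟨x, hxF, hx⟩

theorem Mot.coord_smul (c : ℝ) (k : Mot) : (c • k).coord = c • k.coord := by
  ext i
  fin_cases i <;> simp [Mot.coord]

theorem IsHomogeneous.eval_smul {σ : Type} {F : MvPolynomial σ ℝ} {m : ℕ} (hF : F.IsHomogeneous m)
    (c : ℝ) (v : σ → ℝ) : MvPolynomial.eval (c • v) F = c ^ m * MvPolynomial.eval v F := by
  rw [MvPolynomial.eval_eq, MvPolynomial.eval_eq, Finset.mul_sum]
  refine Finset.sum_congr rfl fun d hd => ?_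
  have h1 : d.degree = m := by
    rw [Finsupp.degree_eq_weight_one]
    exact hF (MvPolynomial.mem_support_iff.1 hd)
  simp only [Pi.smul_apply, smul_eq_mul, mul_pow, Finset.prod_mul_distrib,
    Finset.prod_pow_eq_pow_sum]
  rw [← h1, Finsupp.degree_apply]
  ring

theorem eval_rep_mk_eq_zero_iff {F : MvPolynomial (Fin 4) ℝ} {m : ℕ} (hF : F.IsHomogeneous m)
    (k : Mot) (hk : k ≠ 0) :
    MvPolynomial.eval (Projectivization.mk ℝ k hk).rep.coord F = 0 ↔
      MvPolynomial.eval k.coord F = 0 := by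
  obtain ⟨c, hc⟩ := Projectivization.exists_smul_eq_mk_rep ℝ k hk
  rw [← hc, Units.smul_def, Mot.coord_smul, IsHomogeneous.eval_smul hF, mul_eq_zero,
    or_iff_right (pow_ne_zero _ c.ne_zero)]

/-! ### Elements of `𝕂` representing direct isometries -/

theorem Mot.smul_pp_ne_zero {c : ℝ} (hc : c ≠ 0) {k : Mot} (hk : k.pp ≠ 0) : (c • k).pp ≠ 0 := by
  rw [Mot.smul_pp]
  exact mul_ne_zero (by exact_mod_cast hc) hk

theorem Mot.toSE2_eq_iff {k m : Mot} (hk : k.pp ≠ 0) (hm : m.pp ≠ 0) :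
    k.toSE2 hk = m.toSE2 hm ↔ ∃ c : ℝ, c ≠ 0 ∧ k = c • m := by
  have hk' : conj k.pp ≠ 0 := by simpa using hk
  have hm' : conj m.pp ≠ 0 := by simpa using hm
  constructor
  · intro h
    have h0 := congrArg (fun s : SE2 => s.1 0) h
    have h1 := congrArg (fun s : SE2 => s.1 1) h
    simp only [Mot.toSE2_apply, ← Complex.mul_conj', zero_mul, zero_add, one_mul] at h0 h1
    rw [div_eq_div_iff (mul_ne_zero hk hk') (mul_ne_zero hm hm')] at h0 h1
    have e0 : k.sp * conj m.pp = m.sp * conj k.pp := by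
      apply mul_left_cancel₀ (mul_ne_zero hk hm)
      linear_combination h0
    have e1 : k.pp * conj m.pp = m.pp * conj k.pp := by
      apply mul_left_cancel₀ (mul_ne_zero hk hm)
      linear_combination h1 - h0
    have hreal : conj (k.pp / m.pp) = k.pp / m.pp := by
      rw [map_div₀, div_eq_div_iff hm' hm]
      linear_combination -e1
    obtain ⟨c, hc⟩ := Complex.conj_eq_iff_real.1 hreal
    have hkc : k.pp = c * m.pp := by rw [← hc, div_mul_cancel₀ _ hm]
    refine ⟨c, ?_, ?_⟩
    · rintro rfl
      exact hk (by simpa using hkc)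
    · ext1
      · exact hkc
      · apply mul_right_cancel₀ hm'
        rw [e0, hkc, Mot.smul_sp, map_mul, Complex.conj_ofReal]
        ring
  · rintro ⟨c, hc, rfl⟩
    apply Subtype.ext
    ext u
    have hc' : (c : ℂ) ≠ 0 := by exact_mod_cast hc
    simp only [Mot.toSE2_apply, ← Complex.mul_conj', Mot.smul_pp, Mot.smul_sp, map_mul,
      Complex.conj_ofReal]
    field_simp

theorem Mot.toSE2_one (h : (1 : Mot).pp ≠ 0) : (1 : Mot).toSE2 h = 1 := by
  apply Subtype.ext
  ext u
  rw [Mot.toSE2_apply]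
  simp

theorem Mot.toSE2_congr {k m : Mot} (h : k = m) (hk : k.pp ≠ 0) :
    k.toSE2 hk = m.toSE2 (h ▸ hk) := by
  subst h; rfl

theorem Mot.list_prod_pp_ne_zero {l : List Mot} (h : ∀ k ∈ l, k.pp ≠ 0) : l.prod.pp ≠ 0 := by
  change Mot.ppHom l.prod ≠ 0
  rw [map_list_prod]
  refine List.prod_ne_zero ?_
  simpa [Mot.ppHom] using h

/-! ### Rotations about a point -/

/-- The rotation about `p` with parameter `x`, as an element of `SE(2)`. -/
noncomputable def rot (p : ℂ) (x : P1) : SE2 := (rotOf p x).1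

theorem rot_eq_toSE2 (p : ℂ) (x : P1) :
    rot p x = (rotElt p x.rep).toSE2 (rotElt_pp_ne_zero p x.rep_nonzero) := rfl

theorem rot_injective (p : ℂ) : Function.Injective (rot p) := fun _ _ h =>
  (rotOf_bijective p).1 (Subtype.ext h)

theorem rotElt_smul (p : ℂ) (c : ℝ) (v : Fin 2 → ℝ) : rotElt p (c • v) = c • rotElt p v := by
  ext1
  · simp [rotElt]; ring
  · simp [rotElt]; ring

theorem rot_mk (p : ℂ) (v : Fin 2 → ℝ) (hv : v ≠ 0) :
    rot p (Projectivization.mk ℝ v hv) = (rotElt p v).toSE2 (rotElt_pp_ne_zero p hv) := by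
  rw [rot_eq_toSE2, Mot.toSE2_eq_iff]
  obtain ⟨c, hc⟩ := Projectivization.exists_smul_eq_mk_rep ℝ v hv
  exact ⟨c, c.ne_zero, by rw [← hc, Units.smul_def, rotElt_smul]⟩

/-- The reflection of the parameter of a rotation that corresponds to passing to the inverse. -/
noncomputable def invAut : PlaneAut :=
  LinearEquiv.ofInvolutive
    { toFun := fun v => ![v 0, -v 1]
      map_add' := fun v w => by ext i; fin_cases i <;> simp; ring
      map_smul' := fun c v => by ext i; fin_cases i <;> simp }
    (fun v => by ext i; fin_cases i <;> simp)

theorem invAut_apply (v : Fin 2 → ℝ) : invAut v = ![v 0, -v 1] := rfl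

theorem invAut_smul_invAut_smul (x : P1) : invAut • invAut • x = x := by
  rw [← mul_smul]
  have : invAut * invAut = 1 := by
    ext1 v
    change invAut (invAut v) = v
    ext i; fin_cases i <;> simp [invAut_apply]
  rw [this, one_smul]

theorem rot_invAut (p : ℂ) (x : P1) : rot p (invAut • x) = (rot p x)⁻¹ := by
  have hv : invAut x.rep ≠ 0 := by simpa using x.rep_nonzero
  have e : invAut • x = Projectivization.mk ℝ (invAut x.rep) hv := by
    conv_lhs => rw [← x.mk_rep]
    rw [Projectivization.smul_mk]
    rfl
  rw [e, rot_mk, rot_eq_toSE2, eq_inv_iff_mul_eq_one, ← Mot.toSE2_mul,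
    ← Mot.toSE2_one (by simp), Mot.toSE2_eq_iff]
  refine ⟨(x.rep 0) ^ 2 + (x.rep 1) ^ 2, ?_, ?_⟩
  · intro h
    apply x.rep_nonzero
    ext i
    fin_cases i
    · change x.rep 0 = 0
      nlinarith [sq_nonneg (x.rep 0), sq_nonneg (x.rep 1)]
    · change x.rep 1 = 0
      nlinarith [sq_nonneg (x.rep 0), sq_nonneg (x.rep 1)]
  · ext1
    · simp [rotElt, invAut_apply]
      linear_combination -(x.rep 1 : ℂ) ^ 2 * Complex.I_sq
    · simp [rotElt, invAut_apply]

/-! ### Configurations and absolute positions -/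

theorem walkProd_append {V : Type} [Finite V] {L : Linkage V}
    (s : ∀ d : L.graph.Dart, L.virtualPos d) {i j k : V} (w : L.graph.Walk i j)
    (w' : L.graph.Walk j k) :
    Linkage.walkProd s (w.append w') = Linkage.walkProd s w * Linkage.walkProd s w' := by
  induction w with
  | nil => simp [Linkage.walkProd]
  | cons h w ih =>
    rw [SimpleGraph.Walk.cons_append]
    simp only [Linkage.walkProd]
    rw [ih, mul_assoc]

theorem walkProd_eq_of_potential {V : Type} [Finite V] {L : Linkage V}
    {s : ∀ d : L.graph.Dart, L.virtualPos d} {ρ : V → SE2}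
    (h : ∀ d, (s d : SE2) = ρ d.fst * (ρ d.snd)⁻¹) {i j : V} (w : L.graph.Walk i j) :
    Linkage.walkProd s w = ρ i * (ρ j)⁻¹ := by
  induction w with
  | nil => simp [Linkage.walkProd]
  | cons hadj w ih =>
    simp only [Linkage.walkProd]
    rw [ih, h]
    simp

/-- The configurations are the tuples of relative positions that come from absolute positions of
the links. -/
theorem mem_conf_iff_exists_potential {V : Type} [Finite V] {L : Linkage V}
    {s : ∀ d : L.graph.Dart, L.virtualPos d} :
    s ∈ L.conf ↔ ∃ ρ : V → SE2, ∀ d, (s d : SE2) = ρ d.fst * (ρ d.snd)⁻¹ := by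
  constructor
  · intro hs
    obtain ⟨v₀⟩ := L.connected.nonempty
    have w : ∀ v, L.graph.Walk v v₀ := fun v => (L.connected.preconnected v v₀).some
    refine ⟨fun v => Linkage.walkProd s (w v), fun d => ?_⟩
    have h1 := hs _ ((SimpleGraph.Walk.cons d.adj (w d.snd)).append (w d.fst).reverse)
    have h2 := hs _ ((w d.fst).append (w d.fst).reverse)
    rw [walkProd_append] at h1 h2
    have h3 := mul_right_cancel (h1.trans h2.symm)
    beta_reduce
    rw [← h3]
    simp [Linkage.walkProd]
  · rintro ⟨ρ, hρ⟩ i w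
    rw [walkProd_eq_of_potential hρ]
    simp

theorem mem_confVariety_iff {V : Type} [Finite V] {L : Linkage V} {x : MultiProj L.graph.Dart} :
    x ∈ L.confVariety ↔
      ∃ ρ : V → SE2, ∀ d, rot (L.center d.edge) (x d) = ρ d.fst * (ρ d.snd)⁻¹ := by
  constructor
  · rintro ⟨s, hs, rfl⟩
    obtain ⟨ρ, hρ⟩ := mem_conf_iff_exists_potential.1 hs
    refine ⟨ρ, fun d => ?_⟩
    rw [← hρ d]
    exact congrArg Subtype.val ((rotEquiv (L.center d.edge)).apply_symm_apply (s d))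
  · rintro ⟨ρ, hρ⟩
    refine ⟨fun d => rotEquiv (L.center d.edge) (x d), mem_conf_iff_exists_potential.2 ⟨ρ, hρ⟩, ?_⟩
    funext d
    exact (rotEquiv (L.center d.edge)).symm_apply_apply (x d)

theorem mem_relPos_iff {V : Type} [Finite V] {L : Linkage V} {i j : V} {σ : SE2} :
    σ ∈ L.relPos i j ↔ ∃ x ∈ L.confVariety, ∃ ρ : V → SE2,
      (∀ d, rot (L.center d.edge) (x d) = ρ d.fst * (ρ d.snd)⁻¹) ∧ σ = ρ i * (ρ j)⁻¹ := by
  constructor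
  · rintro ⟨s, hs, w, rfl⟩
    obtain ⟨ρ, hρ⟩ := mem_conf_iff_exists_potential.1 hs
    refine ⟨_, ⟨s, hs, rfl⟩, ρ, fun d => ?_, walkProd_eq_of_potential hρ w⟩
    rw [← hρ d]
    exact congrArg Subtype.val ((rotEquiv (L.center d.edge)).apply_symm_apply (s d))
  · rintro ⟨x, hx, ρ, hρ, rfl⟩
    have hρ' : ∀ d, ((rotEquiv (L.center d.edge) (x d) : rotationsAbout _) : SE2)
      = ρ d.fst * (ρ d.snd)⁻¹ := hρ
    obtain ⟨w⟩ := L.connected.preconnected i j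
    refine ⟨fun d => rotEquiv (L.center d.edge) (x d), mem_conf_iff_exists_potential.2 ⟨ρ, hρ'⟩,
      w, ?_⟩
    exact (walkProd_eq_of_potential (s := fun d => rotEquiv (L.center d.edge) (x d)) hρ' w).symm

/-! ### Configurations of ladders -/

/-- The joint between the links `i` and `i + 1` of the first row, for the position of `i + 1`
relative to `i`. -/
def dartFirst {n : ℕ} (i : Fin n) : (ladderGraph n).Dart :=
  ⟨((0, i.succ), (0, i.castSucc)), by
    simp [ladderGraph, SimpleGraph.boxProd_adj, SimpleGraph.pathGraph_adj]⟩

/-- The joint between the links `i` and `i + 1` of the second row, for the position of `i + 1`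
relative to `i`. -/
def dartSecond {n : ℕ} (i : Fin n) : (ladderGraph n).Dart :=
  ⟨((1, i.succ), (1, i.castSucc)), by
    simp [ladderGraph, SimpleGraph.boxProd_adj, SimpleGraph.pathGraph_adj]⟩

/-- The `j`-th rung, for the position of the link of the first row relative to the link of the
second row. -/
def dartRung {n : ℕ} (j : Fin (n + 1)) : (ladderGraph n).Dart :=
  ⟨((0, j), (1, j)), by
    simp [ladderGraph, SimpleGraph.boxProd_adj, SimpleGraph.pathGraph_adj]⟩

theorem ladder_dart_induction {n : ℕ} {motive : (ladderGraph n).Dart → Prop}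
    (first : ∀ i, motive (dartFirst i)) (second : ∀ i, motive (dartSecond i))
    (rung : ∀ j, motive (dartRung j)) (symm : ∀ d, motive d → motive d.symm)
    (d : (ladderGraph n).Dart) : motive d := by
  have key : ∀ (a : Fin 2) (i : Fin n), motive ⟨((a, i.succ), (a, i.castSucc)), by
      simp [ladderGraph, SimpleGraph.boxProd_adj, SimpleGraph.pathGraph_adj]⟩ := by
    intro a i
    fin_cases a
    · exact first i
    · exact second i
  have hsucc : ∀ i j : Fin (n + 1), i.val + 1 = j.val →
      ∃ k : Fin n, i = k.castSucc ∧ j = k.succ := by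
    intro i j hij
    refine ⟨⟨i.val, by omega⟩, ?_, ?_⟩
    · ext; simp
    · ext; simp [← hij]
  obtain ⟨⟨⟨a, i⟩, ⟨b, j⟩⟩, hadj⟩ := d
  have hadj' := hadj
  simp only [ladderGraph, SimpleGraph.boxProd_adj, SimpleGraph.pathGraph_adj] at hadj'
  rcases hadj' with ⟨hab, rfl⟩ | ⟨hij, rfl⟩
  · fin_cases a <;> fin_cases b
    · simp at hab
    · exact rung i
    · exact symm _ (rung i)
    · simp at hab
  · rcases hij with hij | hij
    · obtain ⟨k, rfl, rfl⟩ := hsucc i j hij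
      exact symm _ (key a k)
    · obtain ⟨k, rfl, rfl⟩ := hsucc j i hij
      exact key a k

theorem ladderCenter_dartFirst {n : ℕ} (u ut : Fin n → ℂ) (v : Fin (n + 1) → ℂ) (i : Fin n) :
    ladderCenter u ut v (dartFirst i).edge = u i := by
  rw [← ladderCenter_first u ut v i]
  exact congrArg _ Sym2.eq_swap

theorem ladderCenter_dartSecond {n : ℕ} (u ut : Fin n → ℂ) (v : Fin (n + 1) → ℂ) (i : Fin n) :
    ladderCenter u ut v (dartSecond i).edge = ut i := by
  rw [← ladderCenter_second u ut v i]
  exact congrArg _ Sym2.eq_swap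

theorem ladderCenter_dartRung {n : ℕ} (u ut : Fin n → ℂ) (v : Fin (n + 1) → ℂ) (j : Fin (n + 1)) :
    ladderCenter u ut v (dartRung j).edge = v j :=
  ladderCenter_rung u ut v j

/-- A point of the product of the projective lines of all joints is a configuration of the ladder
if and only if the two relative positions at each joint are inverse to each other and each square
closes. -/
theorem mem_confVariety_ladder_iff {n : ℕ} (u ut : Fin n → ℂ) (v : Fin (n + 1) → ℂ)
    (x : MultiProj (ladderGraph n).Dart) :
    x ∈ (ladderLinkage u ut v).confVariety ↔
      (∀ d : (ladderGraph n).Dart, x d.symm = invAut • x d) ∧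
      ∀ i, rot (u i) (x (dartFirst i)) * rot (v i.castSucc) (x (dartRung i.castSucc)) =
        rot (v i.succ) (x (dartRung i.succ)) * rot (ut i) (x (dartSecond i)) := by
  refine (mem_confVariety_iff (L := ladderLinkage u ut v)).trans ?_
  constructor
  · rintro ⟨ρ, hρ⟩
    have hρ' : ∀ d : (ladderGraph n).Dart,
        rot (ladderCenter u ut v d.edge) (x d) = ρ d.fst * (ρ d.snd)⁻¹ := hρ
    refine ⟨fun d => rot_injective (ladderCenter u ut v d.edge) ?_, fun i => ?_⟩
    · have h1 := hρ' d.symm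
      rw [SimpleGraph.Dart.edge_symm] at h1
      rw [rot_invAut, h1, hρ']
      simp
    · have h1 := hρ' (dartFirst i)
      have h2 := hρ' (dartRung i.castSucc)
      have h3 := hρ' (dartRung i.succ)
      have h4 := hρ' (dartSecond i)
      rw [ladderCenter_dartFirst] at h1
      rw [ladderCenter_dartRung] at h2 h3
      rw [ladderCenter_dartSecond] at h4
      rw [h1, h2, h3, h4]
      simp [dartFirst, dartSecond, dartRung]
  · rintro ⟨hsymm, hsq⟩
    let ρ₀ : Fin (n + 1) → SE2 :=
      Fin.induction 1 fun i r => rot (u i) (x (dartFirst i)) * r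
    have hρ₀ : ∀ i : Fin n, ρ₀ i.succ = rot (u i) (x (dartFirst i)) * ρ₀ i.castSucc := fun i => by
      simp [ρ₀]
    let ρ : Fin 2 × Fin (n + 1) → SE2 := fun a =>
      if a.1 = 0 then ρ₀ a.2 else (rot (v a.2) (x (dartRung a.2)))⁻¹ * ρ₀ a.2
    have e0 : ∀ j, ρ (0, j) = ρ₀ j := fun j => rfl
    have e1 : ∀ j, ρ (1, j) = (rot (v j) (x (dartRung j)))⁻¹ * ρ₀ j := fun j => rfl
    refine ⟨ρ, ?_⟩
    change ∀ d : (ladderGraph n).Dart,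
        rot (ladderCenter u ut v d.edge) (x d) = ρ d.fst * (ρ d.snd)⁻¹
    apply ladder_dart_induction
    · intro i
      rw [ladderCenter_dartFirst]
      change _ = ρ (0, i.succ) * (ρ (0, i.castSucc))⁻¹
      rw [e0, e0, hρ₀, mul_inv_cancel_right]
    · intro i
      rw [ladderCenter_dartSecond]
      change _ = ρ (1, i.succ) * (ρ (1, i.castSucc))⁻¹
      rw [e1, e1, hρ₀, eq_mul_inv_iff_mul_eq, eq_inv_mul_iff_mul_eq, ← mul_assoc, ← mul_assoc,
        ← hsq, mul_assoc _ _ (rot (v i.castSucc) _)⁻¹]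
      simp
    · intro j
      rw [ladderCenter_dartRung]
      change _ = ρ (0, j) * (ρ (1, j))⁻¹
      rw [e0, e1]
      simp
    · intro d hd
      rw [SimpleGraph.Dart.edge_symm, hsymm, rot_invAut, hd]
      simp

/-- The element of `𝕂` representing the position of the last link of the first row relative to the
first one. -/
noncomputable def firstRowElt {n : ℕ} (u : Fin n → ℂ) (v : Fin n → Fin 2 → ℝ) : Mot :=
  (List.ofFn fun i => rotElt (u i) (v i)).prod

theorem firstRowElt_pp_ne_zero {n : ℕ} (u : Fin n → ℂ) {v : Fin n → Fin 2 → ℝ}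
    (hv : ∀ i, v i ≠ 0) : (firstRowElt u v).pp ≠ 0 := by
  apply Mot.list_prod_pp_ne_zero
  intro k hk
  obtain ⟨i, rfl⟩ := (List.mem_ofFn' _ _).1 hk
  exact rotElt_pp_ne_zero _ (hv i)

/-- The algebra acts from the right, so that the factors of the product in `𝕂` appear in the
opposite order in the composition of the rotations. -/
theorem toSE2_firstRowElt {n : ℕ} (u : Fin n → ℂ) (x : Fin n → P1) (ρ : Fin (n + 1) → SE2)
    (hρ : ∀ i : Fin n, ρ i.succ = rot (u i) (x i) * ρ i.castSucc) :
    ρ (Fin.last n) * (ρ 0)⁻¹ = (firstRowElt u fun i => (x i).rep).toSE2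
      (firstRowElt_pp_ne_zero u fun i => (x i).rep_nonzero) := by
  induction n with
  | zero =>
    have e : (firstRowElt u fun i => (x i).rep) = 1 := by simp [firstRowElt]
    rw [Mot.toSE2_congr e, Mot.toSE2_one]
    simp
  | succ n ih =>
    have e : (firstRowElt u fun i => (x i).rep) =
        (firstRowElt (u ∘ Fin.castSucc) fun i => (x i.castSucc).rep) *
          rotElt (u (Fin.last n)) (x (Fin.last n)).rep := by
      rw [firstRowElt, List.ofFn_succ', List.concat_eq_append, List.prod_append,
        List.prod_singleton]
      rfl
    have h1 : ρ (Fin.last n).castSucc * (ρ 0)⁻¹ =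
        (firstRowElt (u ∘ Fin.castSucc) fun i => (x i.castSucc).rep).toSE2
          (firstRowElt_pp_ne_zero _ fun i => (x i.castSucc).rep_nonzero) :=
      ih (u ∘ Fin.castSucc) (x ∘ Fin.castSucc) (ρ ∘ Fin.castSucc) fun i => hρ i.castSucc
    rw [Mot.toSE2_congr e, Mot.toSE2_mul _ _
      (firstRowElt_pp_ne_zero _ fun i => (x i.castSucc).rep_nonzero)
      (rotElt_pp_ne_zero _ (x _).rep_nonzero), ← h1, ← rot_eq_toSE2, ← mul_assoc, ← hρ,
      Fin.succ_last]

theorem mem_relPos_ladder_iff {n : ℕ} (u ut : Fin n → ℂ) (v : Fin (n + 1) → ℂ) (σ : SE2) :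
    σ ∈ (ladderLinkage u ut v).relPos (0, Fin.last n) (0, 0) ↔
      ∃ x ∈ (ladderLinkage u ut v).confVariety,
        σ = (firstRowElt u fun i => (x (dartFirst i)).rep).toSE2
          (firstRowElt_pp_ne_zero u fun i => (x (dartFirst i)).rep_nonzero) := by
  have key : ∀ (x : MultiProj (ladderGraph n).Dart) (ρ : Fin 2 × Fin (n + 1) → SE2),
      (∀ d : (ladderGraph n).Dart, rot (ladderCenter u ut v d.edge) (x d)
        = ρ d.fst * (ρ d.snd)⁻¹) → ρ (0, Fin.last n) * (ρ (0, 0))⁻¹ =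
        (firstRowElt u fun i => (x (dartFirst i)).rep).toSE2
          (firstRowElt_pp_ne_zero u fun i => (x (dartFirst i)).rep_nonzero) := by
    intro x ρ hρ
    refine toSE2_firstRowElt u (fun i => x (dartFirst i)) (fun j => ρ (0, j)) fun i => ?_
    have h := hρ (dartFirst i)
    rw [ladderCenter_dartFirst] at h
    rw [h]
    simp [dartFirst]
  rw [mem_relPos_iff]
  constructor
  · rintro ⟨x, hx, ρ, hρ, rfl⟩
    exact ⟨x, hx, key x ρ hρ⟩
  · rintro ⟨x, hx, rfl⟩
    obtain ⟨ρ, hρ⟩ := mem_confVariety_iff.1 hx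
    exact ⟨x, hx, ρ, hρ, (key x ρ hρ).symm⟩

/-! ### Flips and their centres of rotation -/

theorem isFlip_iff {k₁ k₂ k₃ k₄ : Mot} : IsFlip k₁ k₂ k₃ k₄ ↔
    k₃.pp = k₂.pp ∧ k₄.pp = k₁.pp ∧ k₁.sp + k₂.sp = k₃.sp + k₄.sp ∧
      conj k₁.pp * k₂.sp + k₂.pp * k₁.sp = conj k₂.pp * k₄.sp + k₁.pp * k₃.sp := by
  have hexp : ∀ a b : Mot,
      ((X - C a) * (X - C b) : Mot[X]) = X * X - C (a + b) * X + C (a * b) := by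
    intro a b
    rw [sub_mul, mul_sub, mul_sub, X_mul_C, C_add, C_mul, add_mul]
    abel
  constructor
  · rintro ⟨h1, h2, h⟩
    rw [hexp, hexp] at h
    have e0 := congrArg (fun p => p.coeff 0) h
    have e1 := congrArg (fun p => p.coeff 1) h
    simp [coeff_X, coeff_C] at e0 e1
    have e2 := congrArg Mot.sp e0
    have e3 := congrArg Mot.sp e1
    simp only [Mot.mul_sp, Mot.neg_sp, Mot.add_sp, h1, h2] at e2 e3
    refine ⟨h1, h2, ?_, e2⟩
    linear_combination -e3
  · rintro ⟨h1, h2, h3, h4⟩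
    refine ⟨h1, h2, ?_⟩
    have e1 : k₁ + k₂ = k₃ + k₄ := by
      ext1
      · simp [h1, h2, add_comm]
      · simpa using h3
    have e2 : k₁ * k₂ = k₃ * k₄ := by
      ext1
      · simp [h1, h2, mul_comm]
      · simpa [h1, h2] using h4
    rw [hexp, hexp, e1, e2]

theorem conj_sub_self_ne_zero {z : ℂ} (hz : z.im ≠ 0) : conj z - z ≠ 0 := by
  intro h
  have := congrArg Complex.im h
  simp at this
  exact hz (by linarith)

theorem Mot.sp_eq_center_mul {k : Mot} (hk : k.pp.im ≠ 0) :
    k.sp = k.center * (conj k.pp - k.pp) := by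
  rw [Mot.center, div_mul_cancel₀ _ (conj_sub_self_ne_zero hk)]

theorem IsFlip.center_eqs {l k kt l' : Mot} (h : IsFlip l k kt l') (hl : l.pp.im ≠ 0)
    (hk : k.pp.im ≠ 0) :
    (conj k.pp - l.pp) * (l'.center - k.center) = (l.center - k.center) * (k.pp - l.pp) ∧
    (conj k.pp - l.pp) * (kt.center - k.center) =
      (l.center - k.center) * (conj l.pp - l.pp) := by
  obtain ⟨h1, h2, h3, h4⟩ := isFlip_iff.1 h
  rw [Mot.sp_eq_center_mul hl, Mot.sp_eq_center_mul hk,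
    Mot.sp_eq_center_mul (k := kt) (by rw [h1]; exact hk),
    Mot.sp_eq_center_mul (k := l') (by rw [h2]; exact hl), h1, h2] at h3 h4
  have hl0 := conj_sub_self_ne_zero hl
  have hk0 := conj_sub_self_ne_zero hk
  constructor
  · apply mul_left_cancel₀ hl0
    linear_combination l.pp * h3 - h4
  · apply mul_left_cancel₀ hk0
    linear_combination h4 - conj k.pp * h3

/-! ### The configurations of a square -/

/-- The closing condition of a square, once the rotation parts match. All variables with a prime
stand for complex conjugates. -/
theorem square_closing_identity {p p' q q' r r' s s' c κ κ' lam lam' uk ul ut vl : ℂ}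
    (h1 : (κ' - lam) * (vl - uk) = (ul - uk) * (κ - lam))
    (h2 : (κ' - lam) * (ut - uk) = (ul - uk) * (lam' - lam))
    (E : q * p = c * (s * r)) (E' : q' * p' = c * (s' * r'))
    (hu : ul - uk ≠ 0) (hθ : κ' - lam ≠ 0) :
    q' * (p' - p) * uk + p * (q' - q) * ul = c * (s' * (r' - r) * vl + r * (s' - s) * ut) ↔
    c * r * s' * (κ - lam') =
      p' * q' * (κ - lam) + p * q * (κ' - lam') - p * q' * (κ' - lam) := by
  constructor
  · intro h
    apply mul_left_cancel₀ hu
    linear_combination (κ' - lam) * h + c * s' * (r' - r) * h1 + c * r * (s' - s) * h2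
      - (κ' - lam) * uk * (E' - E) - (ul - uk) * ((κ - lam) * E' - (lam' - lam) * E)
  · intro h
    apply mul_left_cancel₀ hθ
    linear_combination (ul - uk) * h - c * s' * (r' - r) * h1 - c * r * (s' - s) * h2
      + (κ' - lam) * uk * (E' - E) + (ul - uk) * ((κ - lam) * E' - (lam' - lam) * E)

theorem exists_real_mul_of_mul_conj_eq {z w : ℂ} (hz : z ≠ 0) (hw : w ≠ 0)
    (h : z * conj w = conj z * w) : ∃ c : ℝ, c ≠ 0 ∧ z = c * w := by
  have hw' : conj w ≠ 0 := by simpa using hw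
  have hreal : conj (z / w) = z / w := by
    rw [map_div₀, div_eq_div_iff hw' hw]
    exact h.symm
  obtain ⟨c, hc⟩ := Complex.conj_eq_iff_real.1 hreal
  have hzc : z = c * w := by rw [← hc, div_mul_cancel₀ _ hw]
  refine ⟨c, ?_, hzc⟩
  rintro rfl
  exact hz (by simpa using hzc)

/-- The real linear map of the complex plane that sends `t - λ` to `t - κ` for all real `t`. -/
noncomputable def shift (lam κ z : ℂ) : ℂ := z + (z.im / lam.im : ℝ) * (κ - lam)

theorem shift_shift {lam κ : ℂ} (hl : lam.im ≠ 0) (hk : κ.im ≠ 0) (z : ℂ) :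
    shift κ lam (shift lam κ z) = z := by
  have h : (shift lam κ z).im = z.im / lam.im * κ.im := by
    simp [shift]
    field_simp
    ring
  rw [shift, h, mul_div_cancel_right₀ _ hk, shift]
  ring

theorem shift_ofReal_sub {lam κ : ℂ} (hl : lam.im ≠ 0) (t : ℝ) : shift lam κ (t - lam) = t - κ := by
  have h : ((t - lam : ℂ).im / lam.im : ℝ) = -1 := by
    simp
    field_simp
  rw [shift, h]
  push_cast
  ring

theorem shift_spec {lam : ℂ} (κ : ℂ) (hl : lam.im ≠ 0) (z : ℂ) : (lam - conj lam) * shift lam κ z =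
    (lam - conj lam) * z + (z - conj z) * (κ - lam) := by
  have h : ((z.im / lam.im : ℝ) : ℂ) * (lam - conj lam) = z - conj z := by
    rw [Complex.sub_conj, Complex.sub_conj]
    have : (lam.im : ℂ) ≠ 0 := by exact_mod_cast hl
    push_cast
    field_simp
  rw [shift]
  linear_combination (κ - lam) * h

/-- The closed positions of the square of a flip, in terms of the complex numbers `p, q, r, s`
(up to real factors) that represent the rotation angles at the four joints. Elimination of the
scaling factor leads to an equation with two real factors. One of them says that the rotation
parameters agree, up to the common real parameter `t` in `(t - l)(t - k) = (t - k̃)(t - l')`.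
The other one describes the motion in which the sum of the rotation angles at opposite joints is
constant. -/
theorem square_closes_iff {p q r s κ lam uk ul ut vl : ℂ}
    (hp : p ≠ 0) (hq : q ≠ 0) (hr : r ≠ 0) (hs : s ≠ 0)
    (hl : lam.im ≠ 0) (hk : κ.im ≠ 0) (hne : lam ≠ κ) (hne' : lam ≠ conj κ) (hu : ul ≠ uk)
    (h1 : (conj κ - lam) * (vl - uk) = (ul - uk) * (κ - lam))
    (h2 : (conj κ - lam) * (ut - uk) = (ul - uk) * (conj lam - lam)) :
    (∃ c : ℝ, c ≠ 0 ∧ q * p = c * (s * r) ∧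
      conj q * (conj p - p) * uk + p * (conj q - q) * ul =
        c * (conj s * (conj r - r) * vl + r * (conj s - s) * ut)) ↔
    ((∃ c : ℝ, c ≠ 0 ∧ p = c * shift lam κ q) ∧ (∃ c : ℝ, c ≠ 0 ∧ s = c * shift lam κ q) ∧
      ∃ c : ℝ, c ≠ 0 ∧ r = c * q) ∨
    ((∃ c : ℝ, c ≠ 0 ∧ p = c * (Complex.I * (κ - lam) * conj q)) ∧
      (∃ c : ℝ, c ≠ 0 ∧ s = c * (Complex.I * (κ - conj lam) * q)) ∧
      ∃ c : ℝ, c ≠ 0 ∧ r = c * ((κ - lam) * (conj κ - lam) * conj q)) := by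
  have hp' : conj p ≠ 0 := by simpa using hp
  have hq' : conj q ≠ 0 := by simpa using hq
  have hr' : conj r ≠ 0 := by simpa using hr
  have hs' : conj s ≠ 0 := by simpa using hs
  have hu0 : ul - uk ≠ 0 := sub_ne_zero.2 hu
  have hδ : κ - lam ≠ 0 := sub_ne_zero.2 hne.symm
  have hθ' : conj κ - lam ≠ 0 := sub_ne_zero.2 hne'.symm
  have hθ : κ - conj lam ≠ 0 := by
    intro h
    apply hθ'
    have := congrArg (starRingEnd ℂ) h
    simpa using this
  have hll : lam - conj lam ≠ 0 := by
    rw [← neg_sub]; exact neg_ne_zero.2 (conj_sub_self_ne_zero hl)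
  have hsh : shift lam κ q ≠ 0 := by
    intro h
    apply hq
    rw [← shift_shift hl hk q, h]
    simp [shift]
  have hshs := shift_spec κ hl q
  have hshs' := congrArg (starRingEnd ℂ) hshs
  simp only [map_mul, map_sub, map_add, Complex.conj_conj] at hshs'
  constructor
  · rintro ⟨c, hc, E, F⟩
    have hc' : (c : ℂ) ≠ 0 := by exact_mod_cast hc
    have E' := congrArg (starRingEnd ℂ) E
    simp only [map_mul, Complex.conj_ofReal] at E'
    rw [square_closing_identity h1 h2 E E' hu0 hθ'] at F
    have F' := congrArg (starRingEnd ℂ) F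
    simp only [map_mul, map_sub, map_add, Complex.conj_conj, Complex.conj_ofReal] at F'
    set N := conj p * conj q * (κ - lam) + p * q * (conj κ - conj lam) with hN
    have hprod : N * (N - p * conj q * (conj κ - lam) - conj p * q * (κ - conj lam)) = 0 := by
      have e1 : (c * r * conj s * (κ - conj lam)) * (c * conj r * s * (conj κ - lam)) =
          (q * p) * (conj q * conj p) * ((κ - conj lam) * (conj κ - lam)) := by
        rw [E, E']; ring
      rw [F, F'] at e1
      rw [hN]
      linear_combination e1
    rcases mul_eq_zero.1 hprod with h0 | h0
    · right
      rw [h0] at F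
      have hs2 : q * conj s * (κ - conj lam) + s * conj q * (conj κ - lam) = 0 := by
        apply mul_left_cancel₀ hp
        linear_combination s * F + conj s * (κ - conj lam) * E
      refine ⟨exists_real_mul_of_mul_conj_eq hp ?_ ?_, exists_real_mul_of_mul_conj_eq hs ?_ ?_,
        exists_real_mul_of_mul_conj_eq hr ?_ ?_⟩
      · exact mul_ne_zero (mul_ne_zero Complex.I_ne_zero hδ) hq'
      · simp only [map_mul, map_sub, Complex.conj_conj, Complex.conj_I]
        linear_combination -Complex.I * h0
      · exact mul_ne_zero (mul_ne_zero Complex.I_ne_zero hθ) hq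
      · simp only [map_mul, map_sub, Complex.conj_conj, Complex.conj_I]
        linear_combination -Complex.I * hs2
      · exact mul_ne_zero (mul_ne_zero hδ hθ') hq'
      · simp only [map_mul, map_sub, Complex.conj_conj]
        apply mul_left_cancel₀ (mul_ne_zero hc' (mul_ne_zero hs hs'))
        linear_combination (-q * (conj κ - conj lam) * (κ - conj lam) * conj s) * E
          + (conj q * (κ - lam) * (conj κ - lam) * s) * E'
          + (q * conj s * (κ - conj lam)) * h0 - conj p * conj q * (κ - lam) * hs2
    · left
      have hF : c * r * conj s = conj p * q := by
        apply mul_right_cancel₀ hθ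
        linear_combination F + h0
      have hF' := congrArg (starRingEnd ℂ) hF
      simp only [map_mul, Complex.conj_conj, Complex.conj_ofReal] at hF'
      have hpA : p * conj (shift lam κ q) = conj p * shift lam κ q := by
        apply mul_left_cancel₀ hll
        rw [hN] at h0
        linear_combination h0 - conj p * hshs - p * hshs'
      have hsp : s * conj p = conj s * p := by
        apply mul_left_cancel₀ (mul_ne_zero hc' hr)
        linear_combination -conj p * E - p * hF
      have hrq : r * conj q = conj r * q := by
        apply mul_left_cancel₀ (mul_ne_zero hc' hs)
        linear_combination -conj q * E - q * hF'
      refine ⟨exists_real_mul_of_mul_conj_eq hp hsh hpA, exists_real_mul_of_mul_conj_eq hs hsh ?_,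
        exists_real_mul_of_mul_conj_eq hr hq hrq⟩
      apply mul_left_cancel₀ (mul_ne_zero hp hp')
      linear_combination s * conj p * hpA + shift lam κ q * conj p * hsp
  · rintro (⟨⟨a, ha, ea⟩, ⟨b, hb, eb⟩, ⟨d, hd, ed⟩⟩ | ⟨⟨a, ha, ea⟩, ⟨b, hb, eb⟩, ⟨d, hd, ed⟩⟩)
    · have hb' : (b : ℂ) ≠ 0 := by exact_mod_cast hb
      have hd' : (d : ℂ) ≠ 0 := by exact_mod_cast hd
      have E : q * p = ((a / (b * d) : ℝ) : ℂ) * (s * r) := by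
        rw [ea, eb, ed]
        push_cast
        field_simp
      have E' := congrArg (starRingEnd ℂ) E
      simp only [map_mul, Complex.conj_ofReal] at E'
      refine ⟨a / (b * d), div_ne_zero ha (mul_ne_zero hb hd), E, ?_⟩
      rw [square_closing_identity h1 h2 E E' hu0 hθ', ea, eb, ed]
      simp only [map_mul, Complex.conj_ofReal]
      push_cast
      have : (a : ℂ) / (b * d) * (d * q) * (b * conj (shift lam κ q)) * (κ - conj lam) =
          a * (q * conj (shift lam κ q) * (κ - conj lam)) := by
        field_simp
      rw [this]
      apply mul_left_cancel₀ hll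
      linear_combination (a * (q * (conj κ - conj lam) - conj q * (conj κ - lam))) * (-hshs)
        + a * (q * (κ - conj lam) - conj q * (κ - lam)) * (-hshs')
    · have hb' : (b : ℂ) ≠ 0 := by exact_mod_cast hb
      have hd' : (d : ℂ) ≠ 0 := by exact_mod_cast hd
      have hn : Complex.normSq (κ - conj lam) ≠ 0 := by simpa using hθ
      have hn' : (Complex.normSq (κ - conj lam) : ℂ) = (κ - conj lam) * (conj κ - lam) := by
        rw [Complex.normSq_eq_conj_mul_self]
        simp [mul_comm]
      have E : q * p = ((a / (b * d * Complex.normSq (κ - conj lam)) : ℝ) : ℂ) * (s * r) := by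
        rw [ea, eb, ed]
        push_cast
        rw [hn']
        field_simp
      have E' := congrArg (starRingEnd ℂ) E
      simp only [map_mul, Complex.conj_ofReal] at E'
      refine ⟨a / (b * d * Complex.normSq (κ - conj lam)),
        div_ne_zero ha (mul_ne_zero (mul_ne_zero hb hd) hn), E, ?_⟩
      rw [square_closing_identity h1 h2 E E' hu0 hθ', ea, eb, ed]
      simp only [map_mul, map_sub, Complex.conj_conj, Complex.conj_I, Complex.conj_ofReal]
      push_cast
      rw [hn']
      field_simp
      ring

/-! ### Möbius transformations of rotation parameters -/

/-- The chosen homogeneous coordinates `(λ : μ)` of a point of `ℙ¹`, as the complex number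
`λ + i μ`. -/
noncomputable def angleRep (x : P1) : ℂ := x.rep 0 + x.rep 1 * Complex.I

theorem angleRep_ne_zero (x : P1) : angleRep x ≠ 0 := rotElt_pp_ne_zero 0 x.rep_nonzero

/-- The point of `ℙ¹` given by a nonzero complex number up to real factors. -/
noncomputable def pointOf (z : ℂ) (hz : z ≠ 0) : P1 :=
  Projectivization.mk ℝ ![z.re, z.im] fun h =>
    hz (Complex.ext (by simpa using congrFun h 0) (by simpa using congrFun h 1))

theorem angleRep_pointOf (z : ℂ) (hz : z ≠ 0) :
    ∃ c : ℝ, c ≠ 0 ∧ angleRep (pointOf z hz) = c * z := by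
  obtain ⟨c, hc⟩ := Projectivization.exists_smul_eq_mk_rep ℝ ![z.re, z.im] fun h =>
    hz (Complex.ext (by simpa using congrFun h 0) (by simpa using congrFun h 1))
  refine ⟨c, c.ne_zero, ?_⟩
  rw [angleRep, pointOf, ← hc]
  apply Complex.ext <;> simp [Units.smul_def]

theorem rotElt_rep (p : ℂ) (x : P1) :
    rotElt p x.rep = ⟨angleRep x, (conj (angleRep x) - angleRep x) * p⟩ := by
  ext1
  · rfl
  · simp [rotElt, angleRep]
    ring

/-- A real linear automorphism of `ℂ` acts on `ℙ¹`. -/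
theorem exists_planeAut (f : ℂ →ₗ[ℝ] ℂ) (hf : ∀ z, f z = 0 → z = 0) :
    ∃ g : PlaneAut, ∀ x y : P1, y = g • x ↔ ∃ c : ℝ, c ≠ 0 ∧ angleRep y = c * f (angleRep x) := by
  let e : ℂ ≃ₗ[ℝ] (Fin 2 → ℝ) := Complex.basisOneI.equivFun
  have he : ∀ v : Fin 2 → ℝ, e.symm v = v 0 + v 1 * Complex.I := fun v => by
    rw [Module.Basis.equivFun_symm_apply]
    simp
  have hinj : Function.Injective f := (injective_iff_map_eq_zero f).2 hf
  let A : ℂ ≃ₗ[ℝ] ℂ := LinearEquiv.ofInjectiveEndo f hinj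
  have hA : ∀ z, A z = f z := fun z => rfl
  refine ⟨e.symm.trans (A.trans e), fun x y => ?_⟩
  have h1 : y = (e.symm.trans (A.trans e)) • x ↔
      ∃ c : ℝ, c • (e.symm.trans (A.trans e)) x.rep = y.rep := by
    conv_lhs => rw [← x.mk_rep, ← y.mk_rep, Projectivization.smul_mk]
    rw [Projectivization.mk_eq_mk_iff']
    rfl
  rw [h1]
  have h2 : ∀ c : ℝ, c • (e.symm.trans (A.trans e)) x.rep = y.rep ↔
      angleRep y = c * f (angleRep x) := by
    intro c
    rw [← e.symm.injective.eq_iff, map_smul]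
    have : e.symm ((e.symm.trans (A.trans e)) x.rep) = f (e.symm x.rep) := by
      simp [hA]
    rw [this, he, he, Complex.real_smul]
    exact eq_comm
  simp only [h2]
  constructor
  · rintro ⟨c, hc⟩
    refine ⟨c, ?_, hc⟩
    rintro rfl
    exact angleRep_ne_zero y (by simpa using hc)
  · rintro ⟨c, -, hc⟩
    exact ⟨c, hc⟩

theorem shift_ofReal_mul (lam κ : ℂ) (c : ℝ) (z : ℂ) :
    shift lam κ (c * z) = c * shift lam κ z := by
  rw [shift, shift, Complex.im_ofReal_mul, mul_div_assoc]
  push_cast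
  ring

/-- The configurations of the square of a flip form two families (indexed by a Boolean), in which
the parameters of the other joints are Möbius transformations of the parameter of the first rung.
The family with index `true` is the one that comes from the factorizations
`(t - l)(t - k) = (t - k̃)(t - l')`. -/
theorem exists_square_aut {l k kt l' : Mot} (hf : IsFlip l k kt l') (hm : FlipMobility l k) :
    ∃ A B D : Bool → PlaneAut, D true = 1 ∧
      (∀ (t : ℝ) (h : (t - l.pp : ℂ) ≠ 0) (h' : (t - k.pp : ℂ) ≠ 0),
        pointOf (t - k.pp) h' = A true • pointOf (t - l.pp) h) ∧
      ∀ p q r s : P1, rot k.center p * rot l.center q = rot l'.center r * rot kt.center s ↔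
        ∃ b, p = A b • q ∧ s = B b • q ∧ r = D b • q := by
  obtain ⟨hl, hk, hne, hne', hu⟩ := hm
  obtain ⟨h1, h2⟩ := hf.center_eqs hl hk
  have hδ : k.pp - l.pp ≠ 0 := sub_ne_zero.2 hne.symm
  have hθ' : conj k.pp - l.pp ≠ 0 := sub_ne_zero.2 hne'.symm
  have hθ : k.pp - conj l.pp ≠ 0 := by
    intro h
    apply hθ'
    have := congrArg (starRingEnd ℂ) h
    simpa using this
  -- the real linear maps that give the parameters of the other joints
  obtain ⟨A₁, hA₁⟩ := exists_planeAut
    { toFun := shift l.pp k.pp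
      map_add' := fun z w => by simp [shift]; ring
      map_smul' := fun c z => by simp [shift]; ring }
    (fun z hz => by
      have hz' : shift l.pp k.pp z = 0 := hz
      rw [← shift_shift hl hk z, hz']
      simp [shift])
  obtain ⟨A₂, hA₂⟩ := exists_planeAut
    { toFun := fun z => Complex.I * (k.pp - l.pp) * conj z
      map_add' := fun z w => by rw [map_add]; ring
      map_smul' := fun c z => by simp; ring }
    (fun z hz => by
      have hz' : Complex.I * (k.pp - l.pp) * conj z = 0 := hz
      simpa [hδ] using hz')
  obtain ⟨B₂, hB₂⟩ := exists_planeAut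
    { toFun := fun z => Complex.I * (k.pp - conj l.pp) * z
      map_add' := fun z w => by ring
      map_smul' := fun c z => by simp; ring }
    (fun z hz => by
      have hz' : Complex.I * (k.pp - conj l.pp) * z = 0 := hz
      simpa [hθ] using hz')
  obtain ⟨D₂, hD₂⟩ := exists_planeAut
    { toFun := fun z => (k.pp - l.pp) * (conj k.pp - l.pp) * conj z
      map_add' := fun z w => by rw [map_add]; ring
      map_smul' := fun c z => by simp; ring }
    (fun z hz => by
      have hz' : (k.pp - l.pp) * (conj k.pp - l.pp) * conj z = 0 := hz
      simpa [hδ, hθ'] using hz')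
  obtain ⟨D₁, hD₁⟩ := exists_planeAut LinearMap.id (fun z hz => hz)
  have hD₁' : ∀ x y : P1, y = (1 : PlaneAut) • x ↔
      ∃ c : ℝ, c ≠ 0 ∧ angleRep y = c * angleRep x := by
    have e : ∀ x : P1, x = D₁ • x := fun x => (hD₁ x x).2 ⟨1, one_ne_zero, by simp⟩
    intro x y
    have := hD₁ x y
    rw [← e x] at this
    rw [one_smul]
    exact this
  refine ⟨fun b => cond b A₁ A₂, fun b => cond b A₁ B₂, fun b => cond b 1 D₂, rfl, ?_, ?_⟩
  · intro t h h'
    change _ = A₁ • _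
    rw [hA₁]
    obtain ⟨c, hc, ec⟩ := angleRep_pointOf _ h
    obtain ⟨d, hd, ed⟩ := angleRep_pointOf _ h'
    refine ⟨d / c, div_ne_zero hd hc, ?_⟩
    have h3 : shift l.pp k.pp (c * (t - l.pp)) = c * (t - k.pp) := by
      rw [shift_ofReal_mul, shift_ofReal_sub hl t]
    have hc' : (c : ℂ) ≠ 0 := by exact_mod_cast hc
    rw [ed, ec]
    change _ = _ * shift l.pp k.pp _
    rw [h3]
    push_cast
    field_simp
  · intro p q r s
    have key := square_closes_iff (angleRep_ne_zero p) (angleRep_ne_zero q) (angleRep_ne_zero r)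
      (angleRep_ne_zero s) hl hk hne hne' hu h1 h2
    simp only [Bool.exists_bool, cond_true, cond_false]
    rw [hA₁, hA₁, hA₂, hB₂, hD₁', hD₂, or_comm]
    refine Iff.trans ?_ key
    rw [rot_eq_toSE2, rot_eq_toSE2, rot_eq_toSE2, rot_eq_toSE2, ← Mot.toSE2_mul, ← Mot.toSE2_mul,
      Mot.toSE2_eq_iff]
    refine exists_congr fun c => and_congr_right fun _ => ?_
    simp only [rotElt_rep]
    rw [Mot.ext_iff]
    simp only [Mot.mul_pp, Mot.mul_sp, Mot.smul_pp, Mot.smul_sp, ← mul_assoc]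

/-! ### Curves of configurations of ladders -/

/-- The points of the product of the projective lines of all joints of a ladder for which, in each
square, the parameters of the other joints are prescribed Möbius transformations of the parameter
of the first rung. -/
def ladderCurve {n : ℕ} (A B D : Fin n → PlaneAut) : Set (MultiProj (ladderGraph n).Dart) :=
  {x | (∀ d : (ladderGraph n).Dart, x d.symm = invAut • x d) ∧
    ∀ i, x (dartFirst i) = A i • x (dartRung i.castSucc) ∧
      x (dartSecond i) = B i • x (dartRung i.castSucc) ∧
      x (dartRung i.succ) = D i • x (dartRung i.castSucc)}

theorem exists_ladder_point {n : ℕ} (zF zS : Fin n → P1) (zR : Fin (n + 1) → P1) :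
    ∃ x : MultiProj (ladderGraph n).Dart, (∀ d : (ladderGraph n).Dart, x d.symm = invAut • x d) ∧
      (∀ i, x (dartFirst i) = zF i) ∧ (∀ i, x (dartSecond i) = zS i) ∧
      ∀ j, x (dartRung j) = zR j := by
  let x : MultiProj (ladderGraph n).Dart := fun d =>
    if d.fst.1 = d.snd.1 then
      if h : (min d.fst.2 d.snd.2).val < n then
        if d.snd.2 < d.fst.2 then (if d.fst.1 = 0 then zF ⟨_, h⟩ else zS ⟨_, h⟩)
        else invAut • (if d.fst.1 = 0 then zF ⟨_, h⟩ else zS ⟨_, h⟩)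
      else zR 0
    else if d.fst.1 = 0 then zR d.fst.2 else invAut • zR d.fst.2
  have h1 : ∀ i, x (dartFirst i) = zF i := fun i => by simp [x, dartFirst]
  have h1' : ∀ i, x (dartFirst i).symm = invAut • zF i := fun i => by
    simp [x, dartFirst, (Fin.castSucc_lt_succ (i := i)).not_gt]
  have h2 : ∀ i, x (dartSecond i) = zS i := fun i => by simp [x, dartSecond]
  have h2' : ∀ i, x (dartSecond i).symm = invAut • zS i := fun i => by
    simp [x, dartSecond, (Fin.castSucc_lt_succ (i := i)).not_gt]
  have h3 : ∀ j, x (dartRung j) = zR j := fun j => by simp [x, dartRung]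
  have h3' : ∀ j, x (dartRung j).symm = invAut • zR j := fun j => by simp [x, dartRung]
  refine ⟨x, ?_, h1, h2, h3⟩
  apply ladder_dart_induction
  · intro i
    rw [h1, h1']
  · intro i
    rw [h2, h2']
  · intro j
    rw [h3, h3']
  · intro d hd
    rw [hd, SimpleGraph.Dart.symm_symm, invAut_smul_invAut_smul]

theorem exists_mem_ladderCurve {n : ℕ} (A B D : Fin n → PlaneAut) (y : P1) :
    ∃ x ∈ ladderCurve A B D, x (dartRung 0) = y := by
  let zR : Fin (n + 1) → P1 := Fin.induction y fun i z => D i • z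
  have hz : ∀ i : Fin n, zR i.succ = D i • zR i.castSucc := fun i => by simp [zR]
  obtain ⟨x, h0, h1, h2, h3⟩ := exists_ladder_point (fun i => A i • zR i.castSucc)
    (fun i => B i • zR i.castSucc) zR
  refine ⟨x, ⟨h0, fun i => ⟨?_, ?_, ?_⟩⟩, ?_⟩
  · rw [h1, h3]
  · rw [h2, h3]
  · rw [h3, h3, hz]
  · rw [h3]
    simp [zR]

instance (n : ℕ) : Nonempty (ladderGraph n).Dart := ⟨dartRung 0⟩

instance (n : ℕ) : Finite (ladderGraph n).Dart :=
  Finite.of_injective (fun d => d.toProd) SimpleGraph.Dart.toProd_injective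

theorem ladderCurve_eq_range {n : ℕ} (A B D : Fin n → PlaneAut) :
    ∃ g, ladderCurve A B D = Set.range (mobiusCurve g) := by
  have h1 : ∀ j : Fin (n + 1), ∃ g : PlaneAut, ∀ x ∈ ladderCurve A B D,
      x (dartRung j) = g • x (dartRung 0) := by
    intro j
    induction j using Fin.induction with
    | zero => exact ⟨1, fun x _ => (one_smul _ _).symm⟩
    | succ i ih =>
      obtain ⟨g, hg⟩ := ih
      refine ⟨D i * g, fun x hx => ?_⟩
      rw [(hx.2 i).2.2, hg x hx, mul_smul]
  have h2 : ∀ d : (ladderGraph n).Dart, ∃ g : PlaneAut, ∀ x ∈ ladderCurve A B D,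
      x d = g • x (dartRung 0) := by
    apply ladder_dart_induction
    · intro i
      obtain ⟨g, hg⟩ := h1 i.castSucc
      refine ⟨A i * g, fun x hx => ?_⟩
      rw [(hx.2 i).1, hg x hx, mul_smul]
    · intro i
      obtain ⟨g, hg⟩ := h1 i.castSucc
      refine ⟨B i * g, fun x hx => ?_⟩
      rw [(hx.2 i).2.1, hg x hx, mul_smul]
    · exact h1
    · rintro d ⟨g, hg⟩
      refine ⟨invAut * g, fun x hx => ?_⟩
      rw [hx.1, hg x hx, mul_smul]
  choose g hg using h2
  refine ⟨g, Set.Subset.antisymm ?_ ?_⟩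
  · intro x hx
    exact ⟨x (dartRung 0), funext fun d => (hg d x hx).symm⟩
  · rintro _ ⟨y, rfl⟩
    obtain ⟨x, hx, rfl⟩ := exists_mem_ladderCurve A B D y
    have : mobiusCurve g (x (dartRung 0)) = x := funext fun d => (hg d x hx).symm
    rw [this]
    exact hx

/-- If the closing condition of every square has two families of solutions, then the configuration
space of the ladder is a union of curves, one for each choice of a family for every square. -/
theorem confVariety_ladder_eq_iUnion {n : ℕ} {u ut : Fin n → ℂ} {v : Fin (n + 1) → ℂ}
    {A B D : Fin n → Bool → PlaneAut}
    (hsq : ∀ i (p q r s : P1),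
      rot (u i) p * rot (v i.castSucc) q = rot (v i.succ) r * rot (ut i) s ↔
        ∃ b, p = A i b • q ∧ s = B i b • q ∧ r = D i b • q) :
    (ladderLinkage u ut v).confVariety = ⋃ ε : Fin n → Bool,
      ladderCurve (fun i => A i (ε i)) (fun i => B i (ε i)) (fun i => D i (ε i)) := by
  refine Set.ext fun (x : MultiProj (ladderGraph n).Dart) =>
    (mem_confVariety_ladder_iff u ut v x).trans (Iff.trans ?_ Set.mem_iUnion.symm)
  simp only [hsq, Classical.skolem]
  constructor
  · rintro ⟨h, ε, hε⟩
    exact ⟨ε, h, hε⟩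
  · rintro ⟨ε, h, hε⟩
    exact ⟨h, ε, hε⟩

/-! ### Restriction to the squares of a ladder -/

theorem mapDart_dartFirst {n : ℕ} (h : Fin n) :
    (squareHom h).mapDart (dartFirst 0) = dartFirst h := by
  apply SimpleGraph.Dart.ext
  simp [squareHom, dartFirst]

theorem mapDart_dartSecond {n : ℕ} (h : Fin n) :
    (squareHom h).mapDart (dartSecond 0) = dartSecond h := by
  apply SimpleGraph.Dart.ext
  simp [squareHom, dartSecond]

theorem mapDart_dartRung_zero {n : ℕ} (h : Fin n) :
    (squareHom h).mapDart (dartRung (Fin.castSucc 0)) = dartRung h.castSucc := by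
  apply SimpleGraph.Dart.ext
  simp [squareHom, dartRung]

theorem mapDart_dartRung_one {n : ℕ} (h : Fin n) :
    (squareHom h).mapDart (dartRung (Fin.succ 0)) = dartRung h.succ := by
  apply SimpleGraph.Dart.ext
  simp [squareHom, dartRung]

theorem mem_ladderCurve_iff_squareProj {n : ℕ} {A B D : Fin n → PlaneAut}
    {x : MultiProj (ladderGraph n).Dart}
    (hx : ∀ d : (ladderGraph n).Dart, x d.symm = invAut • x d) :
    x ∈ ladderCurve A B D ↔
      ∀ h, squareProj h x ∈ ladderCurve (fun _ : Fin 1 => A h) (fun _ => B h) (fun _ => D h) := by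
  have key : ∀ h, squareProj h x ∈ ladderCurve (fun _ : Fin 1 => A h) (fun _ => B h)
      (fun _ => D h) ↔ (x (dartFirst h) = A h • x (dartRung h.castSucc) ∧
        x (dartSecond h) = B h • x (dartRung h.castSucc) ∧
        x (dartRung h.succ) = D h • x (dartRung h.castSucc)) := by
    intro h
    have e0 : ∀ d : (ladderGraph 1).Dart, squareProj h x d.symm = invAut • squareProj h x d :=
      fun d => hx ((squareHom h).mapDart d)
    have e1 : squareProj h x (dartFirst 0) = x (dartFirst h) :=
      congrArg x (mapDart_dartFirst h)
    have e2 : squareProj h x (dartSecond 0) = x (dartSecond h) :=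
      congrArg x (mapDart_dartSecond h)
    have e3 : squareProj h x (dartRung (Fin.castSucc 0)) = x (dartRung h.castSucc) :=
      congrArg x (mapDart_dartRung_zero h)
    have e4 : squareProj h x (dartRung (Fin.succ 0)) = x (dartRung h.succ) :=
      congrArg x (mapDart_dartRung_one h)
    constructor
    · rintro ⟨-, h1⟩
      have h2 := h1 0
      rw [e1, e2, e3, e4] at h2
      exact h2
    · intro h1
      refine ⟨e0, fun i => ?_⟩
      obtain rfl := Subsingleton.elim i 0
      rw [e1, e2, e3, e4]
      exact h1
  simp only [key]
  exact and_iff_right hx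

/-! ### Primal and secondary parts of motion polynomials -/

theorem coeff_primal (P : Mot[X]) (m : ℕ) : (primal P).coeff m = (P.coeff m).pp := by
  rw [primal, coeff_map]
  rfl

theorem coeff_secondary (P : Mot[X]) (m : ℕ) : (secondary P).coeff m = (P.coeff m).sp := by
  rw [secondary, Polynomial.sum, finsetSum_coeff]
  simp only [coeff_monomial]
  rw [Finset.sum_ite_eq']
  split_ifs with h
  · rfl
  · rw [notMem_support_iff.1 h]
    rfl

theorem motPoly_ext {P Q : Mot[X]} (h1 : primal P = primal Q) (h2 : secondary P = secondary Q) :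
    P = Q := by
  ext m : 1
  ext1
  · rw [← coeff_primal, h1, coeff_primal]
  · rw [← coeff_secondary, h2, coeff_secondary]

theorem primal_mul (P Q : Mot[X]) : primal (P * Q) = primal P * primal Q := Polynomial.map_mul _

/-- The secondary part as an additive homomorphism. -/
def Mot.spHom : Mot →+ ℂ where
  toFun := Mot.sp
  map_zero' := rfl
  map_add' _ _ := rfl

theorem secondary_mul (P Q : Mot[X]) : secondary (P * Q) =
    (primal P).map (starRingEnd ℂ) * secondary Q + primal Q * secondary P := by
  ext m
  rw [coeff_secondary, coeff_add, coeff_mul, coeff_mul, coeff_mul,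
    ← Finset.Nat.sum_antidiagonal_swap
      (f := fun x => (primal Q).coeff x.1 * (secondary P).coeff x.2),
    ← Finset.sum_add_distrib]
  change Mot.spHom _ = _
  rw [map_sum]
  refine Finset.sum_congr rfl fun x _ => ?_
  change (P.coeff x.1 * Q.coeff x.2).sp = _
  simp only [Mot.mul_sp, coeff_map, coeff_primal, coeff_secondary, Prod.fst_swap, Prod.snd_swap]

theorem primal_ofReal (S : ℝ[X]) : primal (ofReal S) = S.map (algebraMap ℝ ℂ) := by
  ext m
  rw [coeff_primal, coeff_map, coeff_map]
  rfl

theorem secondary_ofReal (S : ℝ[X]) : secondary (ofReal S) = 0 := by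
  ext m
  rw [coeff_secondary, coeff_map]
  rfl

theorem map_conj_map_ofReal (S : ℝ[X]) :
    (S.map (algebraMap ℝ ℂ)).map (starRingEnd ℂ) = S.map (algebraMap ℝ ℂ) := by
  ext m
  simp

theorem secondary_ofReal_mul (S : ℝ[X]) (P : Mot[X]) :
    secondary (ofReal S * P) = S.map (algebraMap ℝ ℂ) * secondary P := by
  rw [secondary_mul, secondary_ofReal, primal_ofReal, map_conj_map_ofReal, mul_zero, add_zero]

theorem primal_X_sub_C (k : Mot) : primal (X - C k) = X - C k.pp := by
  rw [primal, Polynomial.map_sub, map_X, map_C]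
  rfl

theorem secondary_X_sub_C (k : Mot) : secondary (X - C k) = -C k.sp := by
  ext m
  rw [coeff_secondary, coeff_sub, coeff_X, coeff_C, coeff_neg, coeff_C]
  split_ifs <;> simp

/-- The motion polynomial with the given primal and secondary parts. -/
theorem exists_motPoly (Z W : ℂ[X]) : ∃ P : Mot[X], primal P = Z ∧ secondary P = W := by
  refine ⟨∑ m ∈ Z.support ∪ W.support, monomial m ⟨Z.coeff m, W.coeff m⟩, ?_, ?_⟩
  · ext m
    rw [coeff_primal, finsetSum_coeff]
    simp only [coeff_monomial]
    rw [Finset.sum_ite_eq']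
    split_ifs with h
    · rfl
    · simp only [Finset.mem_union, not_or, notMem_support_iff] at h
      simp [h.1]
  · ext m
    rw [coeff_secondary, finsetSum_coeff]
    simp only [coeff_monomial]
    rw [Finset.sum_ite_eq']
    split_ifs with h
    · rfl
    · simp only [Finset.mem_union, not_or, notMem_support_iff] at h
      simp [h.2]

theorem Qpoly_zero {n : ℕ} (z : Fin (n + 1) → ℂ) : Qpoly z 0 = ∏ i : Fin n, (X - C (z i.succ)) := by
  rw [Qpoly, Finset.prod_filter, Finset.prod_filter, Fin.prod_univ_succ, Fin.prod_univ_succ]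
  simp

theorem Qpoly_succ {n : ℕ} (z : Fin (n + 1) → ℂ) (j : Fin n) :
    Qpoly z j.succ = (X - C (conj (z 0))) * Qpoly (fun i => z i.succ) j := by
  rw [Qpoly, Qpoly, Finset.prod_filter, Finset.prod_filter, Finset.prod_filter,
    Finset.prod_filter, Fin.prod_univ_succ, Fin.prod_univ_succ]
  simp [mul_assoc]

theorem primal_prod_ofFn {n : ℕ} (k : Fin n → Mot) :
    primal (List.ofFn fun i => (X - C (k i) : Mot[X])).prod = ∏ i, (X - C (k i).pp) := by
  induction n with
  | zero => simp [primal]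
  | succ n ih =>
    rw [List.ofFn_succ, List.prod_cons, primal_mul, primal_X_sub_C, ih, Fin.prod_univ_succ]

theorem secondary_prod_ofFn {n : ℕ} (k : Fin n → Mot) :
    secondary (List.ofFn fun i => (X - C (k i) : Mot[X])).prod =
      ∑ j, C (-(k j).sp) * Qpoly (fun i => (k i).pp) j := by
  induction n with
  | zero =>
    ext m
    rw [List.ofFn_zero, List.prod_nil, coeff_secondary, coeff_one, Finset.univ_eq_empty,
      Finset.sum_empty, coeff_zero]
    split_ifs <;> rfl
  | succ n ih =>
    rw [List.ofFn_succ, List.prod_cons, secondary_mul, ih, primal_X_sub_C, secondary_X_sub_C,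
      primal_prod_ofFn, Fin.sum_univ_succ, Qpoly_zero, Finset.mul_sum, add_comm,
      Polynomial.map_sub, map_X, map_C, C_neg, mul_neg, neg_mul, mul_comm (C (k 0).sp)]
    refine congrArg₂ (· + ·) rfl (Finset.sum_congr rfl fun j _ => ?_)
    rw [Qpoly_succ, mul_left_comm]

/-! ### Correctness of the factorization -/

/-- The only monic real polynomial dividing `P` is `1`. -/
def NoRealFactor (P : Mot[X]) : Prop :=
  ∀ T : ℝ[X], T.Monic → ofReal T ∣ P → T.natDegree = 0

/-- The real polynomial `(t - α)(t - conj α)`. -/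
noncomputable def realQuadratic (α : ℂ) : ℝ[X] := X ^ 2 - C (2 * α.re) * X + C (Complex.normSq α)

theorem map_realQuadratic (α : ℂ) :
    (realQuadratic α).map (algebraMap ℝ ℂ) = (X - C α) * (X - C (conj α)) := by
  have h1 : (C ((2 * α.re : ℝ) : ℂ) : ℂ[X]) = C α + C (conj α) := by
    rw [← C_add, Complex.add_conj]
  have h2 : (C ((Complex.normSq α : ℝ) : ℂ) : ℂ[X]) = C α * C (conj α) := by
    rw [← C_mul, Complex.mul_conj]
  simp only [realQuadratic, Polynomial.map_add, Polynomial.map_sub, Polynomial.map_mul,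
    Polynomial.map_pow, map_X, map_C, Complex.coe_algebraMap]
  rw [h1, h2]
  ring

theorem realQuadratic_monic (α : ℂ) : (realQuadratic α).Monic := by
  rw [← Polynomial.monic_map_iff (f := algebraMap ℝ ℂ), map_realQuadratic]
  exact (monic_X_sub_C _).mul (monic_X_sub_C _)

theorem natDegree_realQuadratic (α : ℂ) : (realQuadratic α).natDegree = 2 := by
  rw [← Polynomial.natDegree_map (algebraMap ℝ ℂ), map_realQuadratic,
    (monic_X_sub_C _).natDegree_mul (monic_X_sub_C _)]
  simp

theorem ne_conj_of_im_ne_zero {α : ℂ} (h : α.im ≠ 0) : α ≠ conj α := fun h' =>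
  h (Complex.conj_eq_iff_im.1 h'.symm)

theorem isCoprime_X_sub_C {a b : ℂ} (h : a ≠ b) : IsCoprime (X - C a : ℂ[X]) (X - C b) :=
  isCoprime_X_sub_C_of_isUnit_sub (sub_ne_zero.2 h).isUnit

/-- A motion polynomial without real factors has no pair of conjugate roots common to its primal
and secondary parts. -/
theorem NoRealFactor.not_common_roots {P : Mot[X]} (hP : NoRealFactor P) {α : ℂ} (hα : α.im ≠ 0)
    (h1 : (primal P).IsRoot α) (h2 : (primal P).IsRoot (conj α))
    (h3 : (secondary P).IsRoot α) (h4 : (secondary P).IsRoot (conj α)) : False := by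
  have hdvd : ∀ Z : ℂ[X], Z.IsRoot α → Z.IsRoot (conj α) →
      (realQuadratic α).map (algebraMap ℝ ℂ) ∣ Z := by
    intro Z ha hb
    rw [map_realQuadratic]
    exact (isCoprime_X_sub_C (ne_conj_of_im_ne_zero hα)).mul_dvd (dvd_iff_isRoot.2 ha)
      (dvd_iff_isRoot.2 hb)
  obtain ⟨Z, hZ⟩ := hdvd _ h1 h2
  obtain ⟨W, hW⟩ := hdvd _ h3 h4
  obtain ⟨Q, hQ1, hQ2⟩ := exists_motPoly Z W
  have h5 := hP (realQuadratic α) (realQuadratic_monic α) ⟨Q, motPoly_ext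
    (by rw [primal_mul, primal_ofReal, hQ1, hZ]) (by rw [secondary_ofReal_mul, hQ2, hW])⟩
  rw [natDegree_realQuadratic] at h5
  omega

theorem prod_map_rootBlock (α : ℂ) (r s u v : ℕ) :
    ((rootBlock α r s u v).map fun q => (X - C q : ℂ[X])).prod =
      (X - C (conj α)) ^ (s - min s v) * (X - C α) ^ (r + s - min s (u + v)) *
        (X - C (conj α)) ^ (s - min s u) := by
  simp [rootBlock, mul_assoc]

theorem prod_ofFn_flatMap {h n : ℕ} {z : Fin n → ℂ} {L : Fin h → List ℂ}
    (hz : List.ofFn z = (List.finRange h).flatMap L) :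
    ∏ j, (X - C (z j) : ℂ[X]) = ∏ i, ((L i).map fun q => (X - C q : ℂ[X])).prod := by
  have h1 : ∏ j, (X - C (z j) : ℂ[X]) = ((List.ofFn z).map fun q => (X - C q : ℂ[X])).prod := by
    rw [List.map_ofFn, List.prod_ofFn]
    rfl
  rw [h1, hz, List.map_flatMap, List.flatMap_def, List.prod_flatten, List.map_map,
    Fin.prod_univ_def]
  rfl

/-- The exponent of `t - conj α` in the product of the linear factors of a root block is the
expected one if `α` and `conj α` are not both roots of the secondary part. -/
theorem rootBlock_exponent {s u v : ℕ} (h : s = 0 ∨ u = 0 ∨ v = 0) :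
    (s - min s v) + (s - min s u) = (s - min s (u + v)) + s := by
  omega

/-- The product of the linear factors of all root blocks is the primal part times the real
polynomial `R` of the algorithm. -/
theorem prod_rootBlock_eq {h : ℕ} (α : Fin h → ℂ) (r s u v : Fin h → ℕ)
    (hcond : ∀ i, s i = 0 ∨ u i = 0 ∨ v i = 0) :
    (∏ i, ((X - C (α i)) * (X - C (conj (α i)))) ^ (s i - min (s i) (u i + v i)) : ℂ[X]) *
      ∏ i, ((X - C (α i)) ^ r i * (X - C (conj (α i))) ^ s i) =
      ∏ i, ((rootBlock (α i) (r i) (s i) (u i) (v i)).map fun q => (X - C q : ℂ[X])).prod := by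
  rw [← Finset.prod_mul_distrib]
  refine Finset.prod_congr rfl fun i _ => ?_
  rw [prod_map_rootBlock]
  have e1 := rootBlock_exponent (hcond i)
  have e2 : r i + s i - min (s i) (u i + v i) = r i + (s i - min (s i) (u i + v i)) :=
    Nat.add_sub_assoc (min_le_left _ _) _
  calc _ = (X - C (α i)) ^ (r i + (s i - min (s i) (u i + v i))) *
        (X - C (conj (α i))) ^ ((s i - min (s i) (u i + v i)) + s i) := by
        rw [mul_pow, pow_add, pow_add]; ring
    _ = _ := by rw [← e1, e2, pow_add]; ring

theorem im_ne_zero_of_isRoot {Z : ℂ[X]} (hroot : ∀ t : ℝ, Z.eval (t : ℂ) ≠ 0) {α : ℂ}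
    (hα : Z.IsRoot α) : α.im ≠ 0 := by
  intro h0
  refine hroot α.re ?_
  have : ((α.re : ℝ) : ℂ) = α := Complex.ext (by simp) (by simp [h0])
  rw [this]
  exact hα

theorem isRoot_of_eq_prod {Z : ℂ[X]} {h : ℕ} {α : Fin h → ℂ} {r s : Fin h → ℕ}
    (hr : ∀ i, 0 < r i)
    (hZ : Z = ∏ i, ((X - C (α i)) ^ r i * (X - C (conj (α i))) ^ s i)) (i : Fin h) :
    Z.IsRoot (α i) := by
  rw [← dvd_iff_isRoot, hZ]
  exact ((dvd_pow_self _ (hr i).ne').mul_right _).trans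
    (Finset.dvd_prod_of_mem (fun i => (X - C (α i)) ^ r i * (X - C (conj (α i))) ^ s i)
      (Finset.mem_univ i))

/-- For a motion polynomial without real factors, at most one of two conjugate roots of the primal
part is a root of the secondary part. -/
theorem NoRealFactor.multiplicity_eq_zero {P : Mot[X]} (hP : NoRealFactor P)
    (hroot : ∀ t : ℝ, (primal P).eval (t : ℂ) ≠ 0) {h : ℕ} {α : Fin h → ℂ} {r s : Fin h → ℕ}
    (hr : ∀ i, 0 < r i)
    (hZ : primal P = ∏ i, ((X - C (α i)) ^ r i * (X - C (conj (α i))) ^ s i)) (i : Fin h) :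
    s i = 0 ∨ (secondary P).rootMultiplicity (α i) = 0 ∨
      (secondary P).rootMultiplicity (conj (α i)) = 0 := by
  have hα := isRoot_of_eq_prod hr hZ i
  by_contra hne
  push Not at hne
  obtain ⟨h1, h2, h3⟩ := hne
  refine hP.not_common_roots (im_ne_zero_of_isRoot hroot hα) hα ?_
    (rootMultiplicity_pos'.1 (Nat.pos_of_ne_zero h2)).2
    (rootMultiplicity_pos'.1 (Nat.pos_of_ne_zero h3)).2
  rw [← dvd_iff_isRoot, hZ]
  exact ((dvd_pow_self _ h1).mul_left _).trans
    (Finset.dvd_prod_of_mem (fun i => (X - C (α i)) ^ r i * (X - C (conj (α i))) ^ s i)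
      (Finset.mem_univ i))

/-- A bounded motion polynomial without real factors is, up to the real polynomial `R`, the product
of the linear factors computed by the algorithm. -/
theorem FactorMotionPolynomial.mul_eq_prod {P : Mot[X]} {R : ℝ[X]} {n : ℕ} {k : Fin n → Mot}
    (hF : FactorMotionPolynomial P R k) (hP : NoRealFactor P)
    (hroot : ∀ t : ℝ, (primal P).eval (t : ℂ) ≠ 0) :
    ofReal R * P = (List.ofFn fun i => (X - C (k i) : Mot[X])).prod := by
  obtain ⟨h, α, r, s, u, v, w, hsr, hα, hZ, hu, hv, hR, hq, hW, hk⟩ := hF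
  apply motPoly_ext
  · rw [primal_mul, primal_ofReal, primal_prod_ofFn, hR, prod_ofFn_flatMap hq, hZ]
    refine prod_rootBlock_eq α r s u v fun i => ?_
    rw [hu, hv]
    exact hP.multiplicity_eq_zero hroot (fun i => (hsr i).2) hZ i
  · rw [secondary_ofReal_mul, secondary_prod_ofFn, hW]
    refine Finset.sum_congr rfl fun j _ => ?_
    rw [hk, neg_neg]

/-! ### Spanning properties of the polynomials `Q_j` -/

/-- `V` is a combination `∑ⱼ wⱼ Qⱼ` of the polynomials `Qⱼ` that belong to a list of roots, defined
by recursion on the list: the first `Qⱼ` is the product of the linear factors of the tail, and the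
other ones arise from those of the tail by multiplication by `t - conj q`. -/
def InSpan : List ℂ → ℂ[X] → Prop
  | [], V => V = 0
  | q :: l, V => ∃ w V', V = C w * (l.map fun z => (X - C z : ℂ[X])).prod + (X - C (conj q)) * V' ∧
      InSpan l V'

theorem InSpan.exists_sum {n : ℕ} {z : Fin n → ℂ} {V : ℂ[X]} (h : InSpan (List.ofFn z) V) :
    ∃ w : Fin n → ℂ, V = ∑ j, C (w j) * Qpoly z j := by
  induction n generalizing V with
  | zero =>
    rw [List.ofFn_zero] at h
    exact ⟨0, by simpa [InSpan] using h⟩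
  | succ n ih =>
    rw [List.ofFn_succ] at h
    obtain ⟨w₀, V', rfl, h'⟩ := h
    obtain ⟨w, rfl⟩ := ih h'
    refine ⟨Fin.cons w₀ w, ?_⟩
    rw [Fin.sum_univ_succ, Qpoly_zero, List.map_ofFn, List.prod_ofFn, Finset.mul_sum]
    refine congrArg₂ (· + ·) rfl (Finset.sum_congr rfl fun j _ => ?_)
    rw [Qpoly_succ, mul_left_comm]
    rfl

theorem InSpan.zero (l : List ℂ) : InSpan l 0 := by
  induction l with
  | nil => rfl
  | cons q l ih => exact ⟨0, 0, by simp, ih⟩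

theorem InSpan.append {l₁ l₂ : List ℂ} {V₁ V₂ : ℂ[X]} (h₁ : InSpan l₁ V₁) (h₂ : InSpan l₂ V₂) :
    InSpan (l₁ ++ l₂) (V₁ * (l₂.map fun z => (X - C z : ℂ[X])).prod +
      (l₁.map fun z => (X - C (conj z) : ℂ[X])).prod * V₂) := by
  induction l₁ generalizing V₁ with
  | nil =>
    have : V₁ = 0 := h₁
    simpa [this] using h₂
  | cons q l ih =>
    obtain ⟨w, V', rfl, h'⟩ := h₁
    refine ⟨w, _, ?_, ih h'⟩
    change _ = C w * ((l ++ l₂).map fun z => (X - C z : ℂ[X])).prod + _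
    rw [List.map_append, List.prod_append, List.map_cons, List.prod_cons]
    ring

/-- For a nonreal number `α`, the products of powers of `t - conj α` and `t - α` of total degree
`b - 1` span the polynomials of degree less than `b`. -/
theorem InSpan.replicate {α : ℂ} (hα : α ≠ conj α) (b : ℕ) {V : ℂ[X]} (hV : V.degree < b) :
    InSpan (List.replicate b α) V := by
  induction b generalizing V with
  | zero =>
    by_contra h
    have h : V ≠ 0 := h
    rw [degree_eq_natDegree h] at hV
    exact absurd hV (by simp)
  | succ b ih =>
    rw [List.replicate_succ]
    set w := V.eval (conj α) / (conj α - α) ^ b with hw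
    have h0 : (conj α - α) ^ b ≠ 0 := pow_ne_zero _ (sub_ne_zero.2 hα.symm)
    have hroot : (V - C w * (X - C α) ^ b).IsRoot (conj α) := by
      simp only [IsRoot.def, eval_sub, eval_mul, eval_C, eval_pow, eval_X, hw]
      field_simp
      ring
    obtain ⟨V', hV'⟩ := dvd_iff_isRoot.2 hroot
    refine ⟨w, V', ?_, ih ?_⟩
    · rw [← hV']
      simp
    · have h1 : (V - C w * (X - C α) ^ b).degree < ((b + 1 : ℕ) : WithBot ℕ) := by
        refine (degree_sub_le _ _).trans_lt (max_lt hV ?_)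
        refine (degree_mul_le _ _).trans_lt ?_
        rw [degree_pow, degree_X_sub_C, nsmul_eq_mul, mul_one]
        refine (add_le_add_left degree_C_le _).trans_lt ?_
        rw [zero_add]
        exact_mod_cast Nat.lt_succ_self b
      rw [hV', degree_mul, degree_X_sub_C] at h1
      by_cases hV0 : V' = 0
      · rw [hV0, degree_zero]
        exact WithBot.bot_lt_coe b
      · rw [degree_eq_natDegree hV0] at h1 ⊢
        have h2 : (1 + V'.natDegree : ℕ) < b + 1 := by exact_mod_cast h1
        exact_mod_cast (by omega : V'.natDegree < b)

/-- Division with respect to two coprime polynomials. -/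
theorem exists_decomposition_of_isCoprime {G E U : ℂ[X]} (hG : G.Monic) (hE : E.Monic)
    (hcop : IsCoprime G E) (hU : U.degree < ((G.natDegree + E.natDegree : ℕ) : WithBot ℕ)) :
    ∃ A B : ℂ[X], U = A * E + G * B ∧ A.degree < (G.natDegree : WithBot ℕ) ∧
      B.degree < (E.natDegree : WithBot ℕ) := by
  obtain ⟨u, v, huv⟩ := hcop
  have hdeg : ((U * v) %ₘ G).degree < (G.natDegree : WithBot ℕ) := by
    rw [← degree_eq_natDegree hG.ne_zero]
    exact degree_modByMonic_lt _ hG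
  have heq : U = ((U * v) %ₘ G) * E + G * (U * u + ((U * v) /ₘ G) * E) := by
    have h1 := modByMonic_add_div (U * v) G
    calc U = U * (u * G + v * E) := by rw [huv, mul_one]
      _ = U * u * G + (U * v) * E := by ring
      _ = U * u * G + ((U * v) %ₘ G + G * ((U * v) /ₘ G)) * E := by rw [h1]
      _ = _ := by ring
  refine ⟨(U * v) %ₘ G, U * u + ((U * v) /ₘ G) * E, heq, hdeg, ?_⟩
  set A := (U * v) %ₘ G with hA
  set B := U * u + ((U * v) /ₘ G) * E with hB
  have h2 : (G * B).degree < ((G.natDegree + E.natDegree : ℕ) : WithBot ℕ) := by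
    have : G * B = U - A * E := by rw [eq_sub_iff_add_eq, add_comm]; exact heq.symm
    rw [this]
    refine (degree_sub_le _ _).trans_lt (max_lt hU ?_)
    by_cases hA0 : A = 0
    · rw [hA0, zero_mul, degree_zero]
      exact WithBot.bot_lt_coe _
    · rw [degree_eq_natDegree hA0] at hdeg
      have h3 : A.natDegree < G.natDegree := by exact_mod_cast hdeg
      rw [degree_mul, degree_eq_natDegree hA0, degree_eq_natDegree hE.ne_zero]
      exact_mod_cast Nat.add_lt_add_right h3 _
  by_cases hB0 : B = 0
  · rw [hB0, degree_zero]
    exact WithBot.bot_lt_coe _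
  · rw [degree_mul, degree_eq_natDegree hB0, degree_eq_natDegree hG.ne_zero] at h2
    rw [degree_eq_natDegree hB0]
    have h3 : G.natDegree + B.natDegree < G.natDegree + E.natDegree := by exact_mod_cast h2
    exact_mod_cast (by omega : B.natDegree < E.natDegree)

/-- The list consisting of `a` copies of `conj α`, then `b` copies of `α`, then `c` copies of
`conj α`. -/
def threeBlock (α : ℂ) (a b c : ℕ) : List ℂ :=
  List.replicate a (conj α) ++ List.replicate b α ++ List.replicate c (conj α)

theorem InSpan.threeBlock {α : ℂ} (hα : α ≠ conj α) (a b c : ℕ) {V : ℂ[X]} (hV : V.degree < b) :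
    InSpan (threeBlock α a b c) ((X - C α) ^ a * (X - C (conj α)) ^ c * V) := by
  have h := ((InSpan.zero (List.replicate a (conj α))).append (InSpan.replicate hα b hV)).append
    (InSpan.zero (List.replicate c (conj α)))
  rw [zero_mul, zero_add, mul_zero, add_zero, List.map_replicate, List.map_replicate,
    List.prod_replicate, List.prod_replicate, Complex.conj_conj, mul_right_comm] at h
  exact h

theorem prod_map_threeBlock (α : ℂ) (a b c : ℕ) :
    ((threeBlock α a b c).map fun z => (X - C z : ℂ[X])).prod =
      (X - C (conj α)) ^ a * (X - C α) ^ b * (X - C (conj α)) ^ c := by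
  simp [threeBlock, mul_assoc]

theorem prod_map_conj_threeBlock (α : ℂ) (a b c : ℕ) :
    ((threeBlock α a b c).map fun z => (X - C (conj z) : ℂ[X])).prod =
      (X - C α) ^ a * (X - C (conj α)) ^ b * (X - C α) ^ c := by
  simp [threeBlock, mul_assoc]

/-- The product `∏ᵢ (t - αᵢ)^{aᵢ} (t - conj αᵢ)^{cᵢ}` is a common divisor of the polynomials `Qⱼ`,
and its multiples by polynomials of degree less than `∑ᵢ bᵢ` are combinations of the `Qⱼ`. The
blocks are separated one after the other by division with respect to coprime polynomials. -/
theorem InSpan.flatMap_threeBlock {ι : Type*} (I : List ι) (hI : I.Nodup) {α : ι → ℂ}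
    {a b c : ι → ℕ} (hα : ∀ i, α i ≠ conj (α i))
    (hne : ∀ i j, i ≠ j → α i ≠ α j ∧ α i ≠ conj (α j))
    (hab : ∀ i, a i ≤ b i) (hcb : ∀ i, c i ≤ b i) {U : ℂ[X]}
    (hU : U.degree < (((I.map b).sum : ℕ) : WithBot ℕ)) :
    InSpan (I.flatMap fun i => PlanarMotion.threeBlock (α i) (a i) (b i) (c i))
      ((I.map fun i => (X - C (α i)) ^ a i * (X - C (conj (α i))) ^ c i).prod * U) := by
  induction I generalizing U with
  | nil =>
    have : U = 0 := by
      by_contra h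
      rw [degree_eq_natDegree h] at hU
      exact absurd hU (by simp)
    rw [this, mul_zero]
    exact InSpan.zero _
  | cons i I ih =>
    rw [List.nodup_cons] at hI
    set G : ℂ[X] := (X - C (α i)) ^ c i * (X - C (conj (α i))) ^ (b i - c i) with hG
    set E : ℂ[X] := (I.map fun j => (X - C (conj (α j))) ^ a j * (X - C (α j)) ^ (b j - a j)).prod
      with hE
    have hmon : ∀ I : List ι, (I.map fun j => ((X - C (conj (α j))) ^ a j *
        (X - C (α j)) ^ (b j - a j) : ℂ[X])).prod.Monic := by
      intro I
      refine List.prod_induction Monic (fun _ _ => Monic.mul) monic_one ?_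
      intro p hp
      obtain ⟨j, -, rfl⟩ := List.mem_map.1 hp
      exact ((monic_X_sub_C _).pow _).mul ((monic_X_sub_C _).pow _)
    have hGm : G.Monic := ((monic_X_sub_C _).pow _).mul ((monic_X_sub_C _).pow _)
    have hEm : E.Monic := hmon I
    have hGd : G.natDegree = b i := by
      rw [hG, ((monic_X_sub_C _).pow _).natDegree_mul ((monic_X_sub_C _).pow _),
        natDegree_pow, natDegree_pow, natDegree_X_sub_C, natDegree_X_sub_C]
      have := hcb i
      omega
    have hEd : E.natDegree = (I.map b).sum := by
      have h1 : ∀ j, ((X - C (conj (α j)) : ℂ[X]) ^ a j * (X - C (α j)) ^ (b j - a j)).natDegree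
          = b j := by
        intro j
        rw [((monic_X_sub_C _).pow _).natDegree_mul ((monic_X_sub_C _).pow _),
          natDegree_pow, natDegree_pow, natDegree_X_sub_C, natDegree_X_sub_C]
        have := hab j
        omega
      clear_value G
      rw [hE]
      clear hE hEm E ih hU hI
      induction I with
      | nil => simp
      | cons j I ih' =>
        rw [List.map_cons, List.prod_cons, List.map_cons, List.sum_cons,
          Monic.natDegree_mul (((monic_X_sub_C _).pow _).mul ((monic_X_sub_C _).pow _))
            (hmon I), h1, ih']
    have hcop : IsCoprime G E := by
      rw [hE]
      refine List.prod_induction (IsCoprime G) (fun _ _ => IsCoprime.mul_right)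
        isCoprime_one_right ?_
      intro p hp
      obtain ⟨j, hj, rfl⟩ := List.mem_map.1 hp
      have hij : i ≠ j := fun h => hI.1 (h ▸ hj)
      obtain ⟨h1, h2⟩ := hne i j hij
      have h3 : conj (α i) ≠ conj (α j) := fun h => h1 (star_injective h)
      have h4 : conj (α i) ≠ α j := fun h => h2 (by rw [← h, Complex.conj_conj])
      exact IsCoprime.mul_left
        (IsCoprime.mul_right (isCoprime_X_sub_C h2).pow (isCoprime_X_sub_C h1).pow)
        (IsCoprime.mul_right (isCoprime_X_sub_C h3).pow (isCoprime_X_sub_C h4).pow)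
    obtain ⟨A, B, hAB, hA, hB⟩ := exists_decomposition_of_isCoprime hGm hEm hcop (U := U) (by
      rw [hGd, hEd]
      simpa using hU)
    rw [hGd] at hA
    rw [hEd] at hB
    have h := (InSpan.threeBlock (hα i) (a i) (b i) (c i) hA).append (ih hI.2 hB)
    rw [List.flatMap_cons]
    convert h using 1
    have e1 : ((I.flatMap fun i => PlanarMotion.threeBlock (α i) (a i) (b i) (c i)).map
        fun z => (X - C z : ℂ[X])).prod
        = (I.map fun i => (X - C (α i)) ^ a i * (X - C (conj (α i))) ^ c i).prod * E := by
      rw [hE, ← List.prod_map_mul, List.map_flatMap, List.flatMap_def, List.prod_flatten,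
        List.map_map]
      congr 1
      refine List.map_congr_left fun j _ => ?_
      rw [Function.comp_apply, prod_map_threeBlock]
      have : (X - C (α j) : ℂ[X]) ^ b j = (X - C (α j)) ^ a j * (X - C (α j)) ^ (b j - a j) := by
        rw [← pow_add, Nat.add_sub_cancel' (hab j)]
      rw [this]
      ring
    have e2 : (X - C (conj (α i)) : ℂ[X]) ^ b i =
        (X - C (conj (α i))) ^ c i * (X - C (conj (α i))) ^ (b i - c i) := by
      rw [← pow_add, Nat.add_sub_cancel' (hcb i)]
    rw [e1, prod_map_conj_threeBlock, e2, List.map_cons, List.prod_cons, hAB, hG]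
    ring

/-! ### Existence of an output of the algorithms -/

/-- The factors of a monic complex polynomial without real roots can be grouped into pairs of
conjugate roots, one pair for each `τ` in a finite subset of the upper half plane. -/
theorem exists_eq_prod_upperHalfPlane {Z : ℂ[X]} (hZ : Z.Monic)
    (hroot : ∀ t : ℝ, Z.eval (t : ℂ) ≠ 0) :
    ∃ T : Finset ℂ,
      (∀ τ ∈ T, 0 < τ.im ∧ (0 < Z.rootMultiplicity τ ∨ 0 < Z.rootMultiplicity (conj τ))) ∧
      Z = ∏ τ ∈ T, ((X - C τ) ^ Z.rootMultiplicity τ *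
        (X - C (conj τ)) ^ Z.rootMultiplicity (conj τ)) := by
  classical
  obtain ⟨T, hT⟩ : ∃ T : Finset ℂ, ∀ z, z ∈ T ↔
      (z ∈ Z.roots.toFinset ∨ conj z ∈ Z.roots.toFinset) ∧ 0 < z.im := by
    refine ⟨(Z.roots.toFinset ∪ Z.roots.toFinset.image conj).filter fun z => 0 < z.im, fun z => ?_⟩
    rw [Finset.mem_filter, Finset.mem_union, Finset.mem_image]
    refine and_congr_left fun _ => or_congr_right ⟨?_, fun h => ⟨_, h, Complex.conj_conj z⟩⟩
    rintro ⟨y, hy, rfl⟩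
    rwa [Complex.conj_conj]
  have hpos : ∀ z ∈ Z.roots.toFinset, 0 < Z.rootMultiplicity z := fun z hz =>
    (rootMultiplicity_pos hZ.ne_zero).2 (mem_roots'.1 (Multiset.mem_toFinset.1 hz)).2
  refine ⟨T, fun τ hτ => ⟨((hT τ).1 hτ).2, ((hT τ).1 hτ).1.imp (hpos _) (hpos _)⟩, ?_⟩
  have h1 : Z = ∏ z ∈ Z.roots.toFinset, (X - C z) ^ Z.rootMultiplicity z := by
    rw [← prod_multiset_root_eq_finset_root]
    exact (IsAlgClosed.splits Z).eq_prod_roots_of_monic hZ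
  have hinj : Set.InjOn (starRingEnd ℂ) (T : Set ℂ) := star_injective.injOn
  have hdisj : Disjoint T (T.image (starRingEnd ℂ)) := by
    rw [Finset.disjoint_left]
    intro z hz hz'
    obtain ⟨y, hy, rfl⟩ := Finset.mem_image.1 hz'
    have h2 := ((hT _).1 hz).2
    have h3 := ((hT _).1 hy).2
    rw [Complex.conj_im] at h2
    linarith
  have h4 : ∏ z ∈ T.image (starRingEnd ℂ), (X - C z : ℂ[X]) ^ Z.rootMultiplicity z =
      ∏ τ ∈ T, (X - C (conj τ)) ^ Z.rootMultiplicity (conj τ) := Finset.prod_image hinj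
  rw [Finset.prod_mul_distrib, ← h4, ← Finset.prod_union hdisj]
  refine h1.trans (Finset.prod_subset ?_ ?_)
  · intro z hz
    have hz' : Z.IsRoot z := (mem_roots'.1 (Multiset.mem_toFinset.1 hz)).2
    rcases lt_or_gt_of_ne (im_ne_zero_of_isRoot hroot hz') with h5 | h5
    · refine Finset.mem_union_right _ (Finset.mem_image.2 ⟨conj z, ?_, Complex.conj_conj z⟩)
      rw [hT, Complex.conj_conj, Complex.conj_im]
      exact ⟨Or.inr hz, by linarith⟩
    · exact Finset.mem_union_left _ ((hT z).2 ⟨Or.inl hz, h5⟩)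
  · intro z _ hz
    have h5 : Z.rootMultiplicity z = 0 := by
      rw [rootMultiplicity_eq_zero_iff]
      intro hz'
      exact absurd (Multiset.mem_toFinset.2 ((mem_roots hZ.ne_zero).2 hz')) hz
    rw [h5, pow_zero]

/-- A monic complex polynomial without real roots is a product over pairs of conjugate numbers, in
each of which the root of higher multiplicity comes first. -/
theorem exists_conj_factorization {Z : ℂ[X]} (hZ : Z.Monic)
    (hroot : ∀ t : ℝ, Z.eval (t : ℂ) ≠ 0) :
    ∃ (h : ℕ) (α : Fin h → ℂ) (r s : Fin h → ℕ), (∀ i, s i ≤ r i ∧ 0 < r i) ∧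
      (∀ i j, i ≠ j → α i ≠ α j ∧ α i ≠ conj (α j)) ∧
      Z = ∏ i, ((X - C (α i)) ^ r i * (X - C (conj (α i))) ^ s i) := by
  obtain ⟨T, hT, hprod⟩ := exists_eq_prod_upperHalfPlane hZ hroot
  obtain ⟨m, hm⟩ : ∃ m : ℂ → ℕ, ∀ z, Z.rootMultiplicity z = m z := ⟨_, fun _ => rfl⟩
  simp only [hm] at hT hprod
  -- in each pair, the root of higher multiplicity
  have hex : ∀ τ : ℂ, ∃ σ : ℂ, (σ = τ ∨ σ = conj τ) ∧ m (conj σ) ≤ m σ := by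
    intro τ
    rcases le_total (m (conj τ)) (m τ) with h | h
    · exact ⟨τ, Or.inl rfl, h⟩
    · exact ⟨conj τ, Or.inr rfl, by rwa [Complex.conj_conj]⟩
  choose f hf hle using hex
  obtain ⟨τ, hτ⟩ : ∃ τ : Fin T.card → ℂ, τ = fun i => (T.equivFin.symm i : ℂ) := ⟨_, rfl⟩
  have hτT : ∀ i, τ i ∈ T := fun i => by rw [hτ]; exact (T.equivFin.symm i).2
  have hτinj : Function.Injective τ := by
    rw [hτ]; exact Subtype.val_injective.comp T.equivFin.symm.injective
  have hτprod : ∀ F : ℂ → ℂ[X], ∏ z ∈ T, F z = ∏ i, F (τ i) := fun F => by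
    rw [← Finset.prod_coe_sort, hτ]
    exact (Equiv.prod_comp T.equivFin.symm fun z : T => F z).symm
  refine ⟨T.card, fun i => f (τ i), fun i => m (f (τ i)), fun i => m (conj (f (τ i))),
    fun i => ⟨hle _, ?_⟩, fun i j hij => ?_, ?_⟩
  · change 0 < m (f (τ i))
    have h2 := (hT _ (hτT i)).2
    have h3 := hle (τ i)
    rcases hf (τ i) with h4 | h4
    · rw [h4] at h3 ⊢
      omega
    · rw [h4, Complex.conj_conj] at h3
      rw [h4]
      omega
  · have key : ∀ x y : ℂ, 0 < x.im → 0 < y.im → x ≠ conj y := fun x y hx hy h => by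
      have := congrArg Complex.im h
      rw [Complex.conj_im] at this
      linarith
    have hx := (hT _ (hτT i)).1
    have hy := (hT _ (hτT j)).1
    have h0 : τ i ≠ τ j := fun h => hij (hτinj h)
    have h1 := key _ _ hx hy
    have h2 : conj (τ i) ≠ τ j := (key _ _ hy hx).symm
    have h3 : conj (τ i) ≠ conj (τ j) := fun h => h0 (star_injective h)
    rcases hf (τ i) with h4 | h4 <;> rcases hf (τ j) with h5 | h5 <;>
      simp only [h4, h5, Complex.conj_conj] <;> constructor <;> assumption
  · refine (hprod.trans (hτprod _)).trans (Finset.prod_congr rfl fun i _ => ?_)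
    rcases hf (τ i) with h | h <;> simp only [h]
    rw [Complex.conj_conj, mul_comm]

/-- The algorithm `FactorMotionPolynomial` has an output, and its factors represent rotations. -/
theorem exists_factorMotionPolynomial {P : Mot[X]} (hP : P.Monic)
    (hroot : ∀ t : ℝ, (primal P).eval (t : ℂ) ≠ 0) (hreal : NoRealFactor P) :
    ∃ (R : ℝ[X]) (n : ℕ) (k : Fin n → Mot), FactorMotionPolynomial P R k ∧
      ∀ i, (k i).pp.im ≠ 0 := by
  have hZm : (primal P).Monic := hP.map _
  obtain ⟨h, α, r, s, hsr, hα, hZ⟩ := exists_conj_factorization hZm hroot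
  set u : Fin h → ℕ := fun i => (secondary P).rootMultiplicity (α i) with hu
  set v : Fin h → ℕ := fun i => (secondary P).rootMultiplicity (conj (α i)) with hv
  have hcond : ∀ i, s i = 0 ∨ u i = 0 ∨ v i = 0 :=
    hreal.multiplicity_eq_zero hroot (fun i => (hsr i).2) hZ
  have him : ∀ i, (α i).im ≠ 0 := fun i =>
    im_ne_zero_of_isRoot hroot (isRoot_of_eq_prod (fun i => (hsr i).2) hZ i)
  set a : Fin h → ℕ := fun i => s i - min (s i) (v i) with ha
  set b : Fin h → ℕ := fun i => r i + s i - min (s i) (u i + v i) with hb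
  set c : Fin h → ℕ := fun i => s i - min (s i) (u i) with hc
  set R : ℝ[X] := ∏ i, realQuadratic (α i) ^ (s i - min (s i) (u i + v i)) with hR
  have hRmap : R.map (algebraMap ℝ ℂ) =
      ∏ i, ((X - C (α i)) * (X - C (conj (α i)))) ^ (s i - min (s i) (u i + v i)) := by
    rw [hR, Polynomial.map_prod]
    refine Finset.prod_congr rfl fun i _ => ?_
    rw [Polynomial.map_pow, map_realQuadratic]
  have hRm : (R.map (algebraMap ℝ ℂ)).Monic := by
    rw [hRmap]
    exact monic_prod_of_monic _ _ fun i _ => ((monic_X_sub_C _).mul (monic_X_sub_C _)).pow _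
  set W := R.map (algebraMap ℝ ℂ) * secondary P with hW
  -- the common divisor of the polynomials `Q_j`
  set D : ℂ[X] := ((List.finRange h).map fun i =>
    (X - C (α i)) ^ a i * (X - C (conj (α i))) ^ c i).prod with hD
  have hD' : D = ∏ i, ((X - C (α i)) ^ a i * (X - C (conj (α i))) ^ c i) := by
    rw [hD, Fin.prod_univ_def]
  have hDm : D.Monic := by
    rw [hD']
    exact monic_prod_of_monic _ _ fun i _ => ((monic_X_sub_C _).pow _).mul ((monic_X_sub_C _).pow _)
  have hab : ∀ i, a i ≤ b i ∧ c i ≤ b i := by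
    intro i
    have h1 := (hsr i).1
    have h2 := hcond i
    simp only [ha, hb, hc]
    omega
  have hDW : D ∣ W := by
    rw [hD']
    refine Fintype.prod_dvd_of_coprime ?_ ?_
    · intro i j hij
      obtain ⟨h1, h2⟩ := hα i j hij
      have h3 : conj (α i) ≠ conj (α j) := fun h => h1 (star_injective h)
      have h4 : conj (α i) ≠ α j := fun h => h2 (by rw [← h, Complex.conj_conj])
      exact IsCoprime.mul_left
        (IsCoprime.mul_right (isCoprime_X_sub_C h1).pow (isCoprime_X_sub_C h2).pow)
        (IsCoprime.mul_right (isCoprime_X_sub_C h4).pow (isCoprime_X_sub_C h3).pow)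
    · intro i
      have h1 : ((X - C (α i)) * (X - C (conj (α i)))) ^ (s i - min (s i) (u i + v i)) ∣
          R.map (algebraMap ℝ ℂ) := by
        rw [hRmap]
        exact Finset.dvd_prod_of_mem
          (fun i => ((X - C (α i)) * (X - C (conj (α i)))) ^ (s i - min (s i) (u i + v i)))
          (Finset.mem_univ i)
      rw [mul_pow] at h1
      have h2 := hcond i
      refine IsCoprime.mul_dvd (isCoprime_X_sub_C (ne_conj_of_im_ne_zero (him i))).pow ?_ ?_
      · refine dvd_trans ?_ (mul_dvd_mul ((dvd_mul_right _ _).trans h1)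
          (pow_rootMultiplicity_dvd (secondary P) (α i)))
        rw [← pow_add]
        refine pow_dvd_pow _ ?_
        change a i ≤ _ + u i
        simp only [ha]
        omega
      · refine dvd_trans ?_ (mul_dvd_mul ((dvd_mul_left _ _).trans h1)
          (pow_rootMultiplicity_dvd (secondary P) (conj (α i))))
        rw [← pow_add]
        refine pow_dvd_pow _ ?_
        change c i ≤ _ + v i
        simp only [hc]
        omega
  obtain ⟨U, hU⟩ := hDW
  -- the degree of the quotient
  have hdegZ : (R.map (algebraMap ℝ ℂ) * primal P).natDegree = D.natDegree +
      ((List.finRange h).map b).sum := by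
    have h1 : ∀ i, ((rootBlock (α i) (r i) (s i) (u i) (v i)).map
        fun q => (X - C q : ℂ[X])).prod = ((X - C (α i)) ^ a i * (X - C (conj (α i))) ^ c i) *
          ((X - C (conj (α i))) ^ a i * (X - C (α i)) ^ (b i - a i)) := by
      intro i
      have h2 : (X - C (α i) : ℂ[X]) ^ b i = (X - C (α i)) ^ a i * (X - C (α i)) ^ (b i - a i) := by
        rw [← pow_add, Nat.add_sub_cancel' (hab i).1]
      rw [prod_map_rootBlock]
      change (X - C (conj (α i))) ^ a i * (X - C (α i)) ^ b i * (X - C (conj (α i))) ^ c i = _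
      rw [h2]
      ring
    have h3 : R.map (algebraMap ℝ ℂ) * primal P = D *
        ∏ i, ((X - C (conj (α i))) ^ a i * (X - C (α i)) ^ (b i - a i)) := by
      rw [hRmap, hZ, prod_rootBlock_eq α r s u v hcond, hD', ← Finset.prod_mul_distrib]
      exact Finset.prod_congr rfl fun i _ => h1 i
    have h4 : ∀ i ∈ Finset.univ,
        ((X - C (conj (α i))) ^ a i * (X - C (α i)) ^ (b i - a i) : ℂ[X]).Monic := fun i _ =>
      ((monic_X_sub_C _).pow _).mul ((monic_X_sub_C _).pow _)
    rw [h3, hDm.natDegree_mul (monic_prod_of_monic _ _ h4), natDegree_prod_of_monic _ _ h4,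
      ← Fin.sum_univ_def]
    congr 1
    refine Finset.sum_congr rfl fun i _ => ?_
    rw [((monic_X_sub_C _).pow _).natDegree_mul ((monic_X_sub_C _).pow _),
      natDegree_pow, natDegree_pow, natDegree_X_sub_C, natDegree_X_sub_C]
    have := (hab i).1
    omega
  have hdegU : U.degree < (((List.finRange h).map b).sum : WithBot ℕ) := by
    by_cases hU0 : U = 0
    · rw [hU0, degree_zero]
      exact WithBot.bot_lt_coe _
    have h1 : (secondary P).degree < (primal P).degree := by
      rw [degree_eq_natDegree hZm.ne_zero, degree_lt_iff_coeff_zero]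
      intro m hm
      rw [coeff_secondary]
      rcases hm.lt_or_eq with h2 | h2
      · have h3 : P.natDegree < m := by
          rwa [primal, hP.natDegree_map] at h2
        rw [coeff_eq_zero_of_natDegree_lt h3]
        rfl
      · have h3 : P.natDegree = m := by
          rwa [primal, hP.natDegree_map] at h2
        rw [← h3, hP.coeff_natDegree]
        rfl
    have h2 : W.degree < (R.map (algebraMap ℝ ℂ) * primal P).degree := by
      rw [hW, degree_mul, degree_mul, degree_eq_natDegree hRm.ne_zero]
      exact WithBot.add_lt_add_left (WithBot.coe_ne_bot) h1
    rw [degree_eq_natDegree (hRm.mul hZm).ne_zero, hdegZ, hU, degree_mul,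
      degree_eq_natDegree hDm.ne_zero, degree_eq_natDegree hU0] at h2
    rw [degree_eq_natDegree hU0]
    have h3 : D.natDegree + U.natDegree < D.natDegree + ((List.finRange h).map b).sum := by
      exact_mod_cast h2
    exact_mod_cast (by omega : U.natDegree < ((List.finRange h).map b).sum)
  have hspan := InSpan.flatMap_threeBlock (List.finRange h) (List.nodup_finRange h)
    (fun i => ne_conj_of_im_ne_zero (him i)) hα (fun i => (hab i).1) (fun i => (hab i).2) hdegU
  rw [← hU] at hspan
  have hblock : (List.finRange h).flatMap (fun i => threeBlock (α i) (a i) (b i) (c i)) =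
      (List.finRange h).flatMap (fun i => rootBlock (α i) (r i) (s i) (u i) (v i)) := rfl
  rw [hblock] at hspan
  set L := (List.finRange h).flatMap (fun i => rootBlock (α i) (r i) (s i) (u i) (v i)) with hL
  rw [← List.ofFn_get L] at hspan
  obtain ⟨w, hw⟩ := hspan.exists_sum
  refine ⟨R, L.length, fun j => ⟨L.get j, -w j⟩, ⟨h, α, r, s, u, v, w, hsr, hα, hZ, fun i => rfl,
    fun i => rfl, hRmap, List.ofFn_get L, hw, fun j => rfl⟩, fun j => ?_⟩
  obtain ⟨i, -, hi⟩ := List.mem_flatMap.1 (List.get_mem L j)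
  have h1 : L.get j = α i ∨ L.get j = conj (α i) := by
    simp only [rootBlock, List.mem_append, List.mem_replicate] at hi
    tauto
  change (L.get j).im ≠ 0
  rcases h1 with h1 | h1 <;> rw [h1]
  · exact him i
  · rw [Complex.conj_im]
    exact neg_ne_zero.2 (him i)

theorem natDegree_le_of_ofReal_dvd {P : Mot[X]} (hP : P.Monic) {T : ℝ[X]}
    (h : ofReal T ∣ P) : T.natDegree ≤ P.natDegree := by
  obtain ⟨Q, hQ⟩ := h
  have h1 : T.map (algebraMap ℝ ℂ) ∣ primal P := by
    rw [hQ, primal_mul, primal_ofReal]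
    exact dvd_mul_right _ _
  have h2 := natDegree_le_of_dvd h1 (hP.map Mot.ppHom).ne_zero
  rwa [natDegree_map, primal, hP.natDegree_map] at h2

/-- The quotient by a monic real factor of maximal degree has no real factors. -/
theorem noRealFactor_of_maximal {P P' : Mot[X]} {S : ℝ[X]} (hS : S.Monic)
    (hSP : P = ofReal S * P')
    (hmax : ∀ T : ℝ[X], T.Monic → ofReal T ∣ P → T.natDegree ≤ S.natDegree) :
    NoRealFactor P' := by
  rintro T hT ⟨Q, hQ⟩
  have h1 := hmax (S * T) (hS.mul hT) ⟨Q, by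
    rw [hSP, hQ, ofReal, ofReal, ofReal, Polynomial.map_mul, mul_assoc]⟩
  rw [hS.natDegree_mul hT] at h1
  omega

theorem exists_maximal_real_factor {P : Mot[X]} (hP : P.Monic) :
    ∃ (S : ℝ[X]) (P' : Mot[X]), S.Monic ∧ P = ofReal S * P' ∧
      ∀ T : ℝ[X], T.Monic → ofReal T ∣ P → T.natDegree ≤ S.natDegree := by
  classical
  obtain ⟨S, hS, hSP, hdeg⟩ := Nat.findGreatest_spec
    (P := fun d => ∃ S : ℝ[X], S.Monic ∧ ofReal S ∣ P ∧ S.natDegree = d)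
    (Nat.zero_le P.natDegree) ⟨1, monic_one, by simp [ofReal], natDegree_one⟩
  obtain ⟨P', hP'⟩ := hSP
  refine ⟨S, P', hS, hP', fun T hT hTP => ?_⟩
  rw [hdeg]
  exact Nat.le_findGreatest (natDegree_le_of_ofReal_dvd hP hTP) ⟨T, hT, hTP, rfl⟩

/-- For a given primal part, all but finitely many choices of the first rung lead to iterated flips
that satisfy the flip mobility condition: the secondary part of each rung is an injective affine
function of the one of the first rung. -/
theorem finite_bad_starts {n : ℕ} (k : Fin n → Mot) {lam : ℂ} (hl : lam.im ≠ 0)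
    (hk : ∀ i, (k i).pp.im ≠ 0 ∧ lam ≠ (k i).pp ∧ lam ≠ conj (k i).pp) :
    {x : ℂ | ¬ ∃ (kt : Fin n → Mot) (l : Fin (n + 1) → Mot), l 0 = ⟨lam, x⟩ ∧
      (∀ i : Fin n, IsFlip (l i.castSucc) (k i) (kt i) (l i.succ)) ∧
      ∀ i : Fin n, FlipMobility (l i.castSucc) (k i)}.Finite := by
  induction n with
  | zero =>
    refine Set.finite_empty.subset fun x hx => hx ?_
    exact ⟨Fin.elim0, fun _ => ⟨lam, x⟩, rfl, fun i => i.elim0, fun i => i.elim0⟩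
  | succ n ih =>
    have hbad := ih (fun i => k i.succ) fun i => hk i.succ
    obtain ⟨hk0, hne, hne'⟩ := hk 0
    set κ := (k 0).pp with hκ
    have hθ : conj κ - lam ≠ 0 := sub_ne_zero.2 hne'.symm
    have hδ : κ - lam ≠ 0 := sub_ne_zero.2 hne.symm
    have hll := conj_sub_self_ne_zero hl
    -- the secondary part of the second rung
    set d : ℂ → ℂ := fun x => ((κ - lam) * x + (conj lam - lam) * (k 0).sp) / (conj κ - lam) with hd
    have hdinj : Function.Injective d := by
      intro x y hxy
      simp only [hd] at hxy
      rw [div_left_inj' hθ, add_left_inj] at hxy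
      exact mul_left_cancel₀ hδ hxy
    refine ((hbad.preimage hdinj.injOn).union
      (Set.finite_singleton ((k 0).center * (conj lam - lam)))).subset ?_
    intro x hx
    by_contra hnot
    simp only [Set.mem_union, Set.mem_preimage, Set.mem_ofPred_eq, not_or, not_not,
      Set.mem_singleton_iff] at hnot
    obtain ⟨⟨kt, l, h0, h1, h2⟩, h3⟩ := hnot
    refine hx ⟨Fin.cons ⟨κ, x + (k 0).sp - d x⟩ kt, Fin.cons ⟨lam, x⟩ l, rfl, ?_, ?_⟩
    · intro i
      refine Fin.cases ?_ (fun i => ?_) i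
      · simp only [Fin.castSucc_zero, Fin.cons_zero, Fin.cons_succ, h0]
        rw [isFlip_iff]
        refine ⟨rfl, rfl, by simp, ?_⟩
        simp only [hd]
        field_simp
        ring
      · exact h1 i
    · intro i
      refine Fin.cases ?_ (fun i => ?_) i
      · refine ⟨hl, hk0, hne, hne', fun h => h3 ?_⟩
        have h4 : x / (conj lam - lam) = (k 0).center := h
        rw [← h4, div_mul_cancel₀ _ hll]
      · exact h2 i

theorem IsBoundedMotionPoly.of_ofReal_mul {P P' : Mot[X]} {S : ℝ[X]} (hP : IsBoundedMotionPoly P)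
    (hS : S.Monic) (hSP : P = ofReal S * P') : IsBoundedMotionPoly P' := by
  refine ⟨Monic.of_mul_monic_left (hS.map (algebraMap ℝ Mot)) (hSP ▸ hP.1), fun t ht => hP.2 t ?_⟩
  rw [hSP, primal_mul, eval_mul, ht, mul_zero]

theorem exists_constructStrongLinkage {P : Mot[X]} (hP : IsBoundedMotionPoly P) :
    ∃ (n : ℕ) (k kt : Fin n → Mot) (l : Fin (n + 1) → Mot), ConstructStrongLinkage P k kt l := by
  obtain ⟨S, P', hS, hSP, hmax⟩ := exists_maximal_real_factor hP.1
  have hP' := hP.of_ofReal_mul hS hSP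
  obtain ⟨R, n, k, hF, hk⟩ := exists_factorMotionPolynomial hP'.1 hP'.2
    (noRealFactor_of_maximal hS hSP hmax)
  have hinf : ((fun y : ℝ => (y * Complex.I : ℂ)) '' {0}ᶜ).Infinite := by
    refine Set.Infinite.image ?_ (Set.finite_singleton (0 : ℝ)).infinite_compl
    intro x _ y _ hxy
    have := congrArg Complex.im hxy
    simpa using this
  obtain ⟨_, ⟨y, hy, rfl⟩, hy'⟩ := hinf.exists_notMem_finite
    ((Set.finite_range fun i => (k i).pp).union (Set.finite_range fun i => conj (k i).pp))
  simp only [Set.mem_union, Set.mem_range, not_or, not_exists] at hy'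
  have hlam : ((y * Complex.I : ℂ)).im ≠ 0 := by simpa using hy
  obtain ⟨x, hx⟩ := (finite_bad_starts k hlam
    fun i => ⟨hk i, Ne.symm (hy'.1 i), Ne.symm (hy'.2 i)⟩).infinite_compl.nonempty
  obtain ⟨kt, l, h0, h1, h2⟩ := not_not.1 hx
  exact ⟨n, k, kt, l, S, R, P', hS, hSP, hmax, hF, by rw [h0]; exact hlam, h1, h2⟩

/-! ### Polynomial curves in projective space -/

theorem Mot.coord_injective : Function.Injective Mot.coord := by
  intro k m h
  have h0 := congrFun h 0
  have h1 := congrFun h 1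
  have h2 := congrFun h 2
  have h3 := congrFun h 3
  simp only [Mot.coord, Matrix.cons_val] at h0 h1 h2 h3
  exact Mot.ext (Complex.ext h0 h1) (Complex.ext h2 h3)

theorem ne_zero_of_pp_ne_zero {k : Mot} (hk : k.pp ≠ 0) : k ≠ 0 := fun h => hk (by rw [h]; rfl)

/-- The curve `t ↦ [k(t)]` in `ℙ³`, defined on the real line. -/
noncomputable def affineCurve (k : ℝ → Mot) (hk : ∀ t, k t ≠ 0) (t : ℝ) : ℙ ℝ Mot :=
  Projectivization.mk ℝ (k t) (hk t)

theorem eval_affineCurve_eq_zero_iff {k : ℝ → Mot} (hk : ∀ t, k t ≠ 0) {q : Fin 4 → ℝ[X]}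
    (hq : ∀ t j, (k t).coord j = (q j).eval t) {F : MvPolynomial (Fin 4) ℝ} {m : ℕ}
    (hF : F.IsHomogeneous m) (t : ℝ) :
    MvPolynomial.eval (affineCurve k hk t).rep.coord F = 0 ↔
      (MvPolynomial.aeval q F).eval t = 0 := by
  rw [affineCurve, eval_rep_mk_eq_zero_iff hF, eval_mvPolynomial_aeval]
  simp only [← hq]

theorem forall_eval_affineCurve_eq_zero_iff {k : ℝ → Mot} (hk : ∀ t, k t ≠ 0) {q : Fin 4 → ℝ[X]}
    (hq : ∀ t j, (k t).coord j = (q j).eval t) {F : MvPolynomial (Fin 4) ℝ} {m : ℕ}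
    (hF : F.IsHomogeneous m) :
    (∀ x ∈ Set.range (affineCurve k hk), MvPolynomial.eval x.rep.coord F = 0) ↔
      MvPolynomial.aeval q F = 0 := by
  rw [Set.forall_mem_range]
  simp only [eval_affineCurve_eq_zero_iff hk hq hF]
  exact ⟨fun h => Polynomial.funext fun t => by rw [h t, eval_zero], fun h t => by
    rw [h, eval_zero]⟩

theorem cofiniteContinuous_affineCurve {k : ℝ → Mot} (hk : ∀ t, k t ≠ 0) {q : Fin 4 → ℝ[X]}
    (hq : ∀ t j, (k t).coord j = (q j).eval t) : CofiniteContinuous (affineCurve k hk) := by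
  refine CofiniteContinuous.of_generateFrom ?_
  rintro U ⟨m, F, hF, rfl⟩
  by_cases h0 : MvPolynomial.aeval q F = 0
  · left
    refine Set.eq_empty_iff_forall_notMem.2 fun t ht => ht ?_
    rw [eval_affineCurve_eq_zero_iff hk hq hF, h0, eval_zero]
  · right
    refine ((MvPolynomial.aeval q F).roots.toFinset.finite_toSet).subset fun t ht => ?_
    have ht' : MvPolynomial.eval (affineCurve k hk t).rep.coord F = 0 := not_not.1 ht
    rw [eval_affineCurve_eq_zero_iff hk hq hF] at ht'
    rw [Finset.mem_coe, Multiset.mem_toFinset, mem_roots h0]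
    exact ht'

/-- If a polynomial curve that is not constant lies in the closure of another polynomial curve,
then the two closures agree. -/
theorem range_affineCurve_subset_closure {k k' : ℝ → Mot} (hk : ∀ t, k t ≠ 0)
    (hk' : ∀ t, k' t ≠ 0) {q q' : Fin 4 → ℝ[X]} (hq : ∀ t j, (k t).coord j = (q j).eval t)
    (hq' : ∀ t j, (k' t).coord j = (q' j).eval t)
    (hne : ∃ i j, q' i ≠ 0 ∧ ∀ r : ℝ, q' j ≠ C r * q' i)
    (hsub : Set.range (affineCurve k' hk') ⊆ closure (Set.range (affineCurve k hk))) :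
    Set.range (affineCurve k hk) ⊆ closure (Set.range (affineCurve k' hk')) := by
  intro y hy
  rw [mem_closure_iff_forall_form]
  intro m F hF h0
  rw [forall_eval_affineCurve_eq_zero_iff hk' hq' hF] at h0
  have h1 := aeval_eq_zero_of_aeval_eq_zero (f := q) (fun m G hG h2 => by
    rw [← forall_eval_affineCurve_eq_zero_iff hk' hq' hG]
    rw [← forall_eval_affineCurve_eq_zero_iff hk hq hG] at h2
    exact fun x hx => mem_closure_iff_forall_form.1 (hsub hx) m G hG h2) hne hF h0
  exact (forall_eval_affineCurve_eq_zero_iff hk hq hF).2 h1 y hy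

/-! ### The curves of relative positions of the end links -/

theorem IsPolyFun.coord_mul {a b : (Fin 2 → ℝ) → Mot} (ha : ∀ j, IsPolyFun fun v => (a v).coord j)
    (hb : ∀ j, IsPolyFun fun v => (b v).coord j) (j : Fin 4) :
    IsPolyFun fun v => (a v * b v).coord j := by
  have h0 := ((ha 0).mul (hb 0)).sub ((ha 1).mul (hb 1))
  have h1 := ((ha 0).mul (hb 1)).add ((ha 1).mul (hb 0))
  have h2 := (((ha 0).mul (hb 2)).add ((ha 1).mul (hb 3))).add
    (((hb 0).mul (ha 2)).sub ((hb 1).mul (ha 3)))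
  have h3 := (((ha 0).mul (hb 3)).sub ((ha 1).mul (hb 2))).add
    (((hb 0).mul (ha 3)).add ((hb 1).mul (ha 2)))
  fin_cases j
  · convert h0 using 2
    simp [Mot.coord]
  · convert h1 using 2
    simp [Mot.coord]
  · convert h2 using 2
    simp [Mot.coord]
  · convert h3 using 2
    simp [Mot.coord]
    ring

theorem IsPolyFun.coord_rotElt (p : ℂ) {a : (Fin 2 → ℝ) → Fin 2 → ℝ}
    (ha : ∀ i, IsPolyFun fun v => a v i) (j : Fin 4) :
    IsPolyFun fun v => (rotElt p (a v)).coord j := by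
  fin_cases j
  · convert ha 0 using 2
    simp [Mot.coord, rotElt]
  · convert ha 1 using 2
    simp [Mot.coord, rotElt]
  · convert (IsPolyFun.const (2 * p.im)).mul (ha 1) using 2
    simp [Mot.coord, rotElt]
    ring
  · convert (IsPolyFun.const (-2 * p.re)).mul (ha 1) using 2
    simp [Mot.coord, rotElt]
    ring

theorem firstRowElt_succ {n : ℕ} (u : Fin (n + 1) → ℂ) (v : Fin (n + 1) → Fin 2 → ℝ) :
    firstRowElt u v =
      rotElt (u 0) (v 0) * firstRowElt (fun i => u i.succ) fun i => v i.succ := by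
  rw [firstRowElt, List.ofFn_succ, List.prod_cons]
  rfl

theorem IsPolyFun.coord_firstRowElt {n : ℕ} (u : Fin n → ℂ) (g : Fin n → PlaneAut) (j : Fin 4) :
    IsPolyFun fun v => (firstRowElt u fun i => g i v).coord j := by
  induction n generalizing j with
  | zero =>
    simp only [firstRowElt, List.ofFn_zero]
    exact IsPolyFun.const _
  | succ n ih =>
    simp only [firstRowElt_succ]
    exact IsPolyFun.coord_mul (IsPolyFun.coord_rotElt _ fun i => IsPolyFun.aut _ i)
      (ih (fun i => u i.succ) fun i => g i.succ) j

theorem firstRowElt_smul {n : ℕ} (u : Fin n → ℂ) (c : Fin n → ℝ) (v : Fin n → Fin 2 → ℝ) :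
    (firstRowElt u fun i => c i • v i) = (∏ i, c i) • firstRowElt u v := by
  induction n with
  | zero => simp [firstRowElt]
  | succ n ih =>
    rw [firstRowElt_succ, firstRowElt_succ, ih, rotElt_smul, smul_mul_smul_comm,
      Fin.prod_univ_succ]

theorem firstRowElt_aut_ne_zero {n : ℕ} (u : Fin n → ℂ) (g : Fin n → PlaneAut) {v : Fin 2 → ℝ}
    (hv : v ≠ 0) : (firstRowElt u fun i => g i v) ≠ 0 :=
  ne_zero_of_pp_ne_zero (firstRowElt_pp_ne_zero u fun i => by simpa using hv)

/-- The curve in `ℙ³` of the positions of the last link relative to the first link of a chain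
with joints at the points `u i`, when the parameters of the joints are Möbius transformations `g i`
of a common parameter. -/
noncomputable def chainCurve {n : ℕ} (u : Fin n → ℂ) (g : Fin n → PlaneAut) (x : P1) : ℙ ℝ Mot :=
  Projectivization.mk ℝ (firstRowElt u fun i => g i x.rep)
    (firstRowElt_aut_ne_zero u g x.rep_nonzero)

theorem chainCurve_eq_mk {n : ℕ} (u : Fin n → ℂ) (g : Fin n → PlaneAut) (x : P1)
    {k : Mot} (hk : k ≠ 0)
    (h : ∃ c : ℝ, c ≠ 0 ∧ (firstRowElt u fun i => g i x.rep) = c • k) :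
    chainCurve u g x = Projectivization.mk ℝ k hk := by
  obtain ⟨c, -, hc⟩ := h
  rw [chainCurve, Projectivization.mk_eq_mk_iff']
  exact ⟨c, hc.symm⟩

theorem chainCurve_mk {n : ℕ} (u : Fin n → ℂ) (g : Fin n → PlaneAut) (v : Fin 2 → ℝ)
    (hv : v ≠ 0) : chainCurve u g (Projectivization.mk ℝ v hv) =
      Projectivization.mk ℝ (firstRowElt u fun i => g i v) (firstRowElt_aut_ne_zero u g hv) := by
  obtain ⟨c, hc⟩ := Projectivization.exists_smul_eq_mk_rep ℝ v hv
  refine chainCurve_eq_mk u g _ _ ⟨∏ _i : Fin n, (c : ℝ), ?_, ?_⟩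
  · exact Finset.prod_ne_zero_iff.2 fun _ _ => c.ne_zero
  · rw [← firstRowElt_smul, ← hc]
    simp only [Units.smul_def, map_smul]

theorem cofiniteContinuous_chainCurve {n : ℕ} (u : Fin n → ℂ) (g : Fin n → PlaneAut) :
    CofiniteContinuous (chainCurve u g) := by
  refine CofiniteContinuous.of_generateFrom ?_
  rintro U ⟨m, F, hF, rfl⟩
  have hpre : ∀ x, MvPolynomial.eval (chainCurve u g x).rep.coord F = 0 ↔
      MvPolynomial.eval (firstRowElt u fun i => g i x.rep).coord F = 0 := fun x =>
    eval_rep_mk_eq_zero_iff hF _ _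
  have hpoly : IsPolyFun fun v => MvPolynomial.eval (firstRowElt u fun i => g i v).coord F :=
    IsPolyFun.eval (fun j => IsPolyFun.coord_firstRowElt u g j) F
  rcases hpoly.zeros_finite_or (fun c v _ h => by
    have e : (firstRowElt u fun i => g i (c • v)) =
        (∏ _i : Fin n, c) • firstRowElt u fun i => g i v := by
      rw [← firstRowElt_smul]
      simp only [map_smul]
    rw [e, Mot.coord_smul, IsHomogeneous.eval_smul hF, h, mul_zero]) with h | h
  · left
    exact Set.eq_empty_iff_forall_notMem.2 fun x hx => hx ((hpre x).2 (h x))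
  · right
    exact h.subset fun x hx => (hpre x).1 (not_not.1 hx)

/-- On the complement of one point, the chain curve is a polynomial curve. -/
theorem exists_affineCurve_chainCurve {n : ℕ} (u : Fin n → ℂ) (g : Fin n → PlaneAut) :
    ∃ (k : ℝ → Mot) (hk : ∀ t, k t ≠ 0) (q : Fin 4 → ℝ[X]),
      (∀ t j, (k t).coord j = (q j).eval t) ∧
      Set.range (affineCurve k hk) ⊆ Set.range (chainCurve u g) ∧
      Set.range (chainCurve u g) ⊆ closure (Set.range (affineCurve k hk)) := by
  have hne : ∀ t : ℝ, ![t, 1] ≠ 0 := fun t h => by simpa using congrFun h 1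
  have hpoly : ∀ j, ∃ H : MvPolynomial (Fin 2) ℝ, ∀ v : Fin 2 → ℝ,
      (firstRowElt u fun i => g i v).coord j = MvPolynomial.eval v H :=
    IsPolyFun.coord_firstRowElt u g
  choose H hH using hpoly
  have hk : ∀ t : ℝ, (firstRowElt u fun i => g i ![t, 1]) ≠ 0 := fun t =>
    firstRowElt_aut_ne_zero u g (hne t)
  have e : affineCurve _ hk = chainCurve u g ∘ fun t => Projectivization.mk ℝ ![t, 1] (hne t) :=
    funext fun t => (chainCurve_mk u g _ (hne t)).symm
  refine ⟨_, hk, fun j => MvPolynomial.aeval ![X, C 1] (H j), fun t j => ?_, ?_, ?_⟩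
  · rw [hH, eval_mvPolynomial_aeval]
    congr 2
    ext i; fin_cases i <;> simp
  · rw [e]
    exact Set.range_comp_subset_range _ _
  · rw [e, Set.range_comp]
    refine (cofiniteContinuous_chainCurve u g).range_subset_closure_image ?_
    refine Set.infinite_range_of_injective fun s t hst => ?_
    obtain ⟨c, hc⟩ := (Projectivization.mk_eq_mk_iff' ..).1 hst
    have h0 := congrFun hc 0
    have h1 := congrFun hc 1
    simp only [Pi.smul_apply, smul_eq_mul, Matrix.cons_val] at h0 h1
    rw [mul_one] at h1
    rw [← h0, h1, one_mul]

/-- If the configurations of the ladder are the points of certain curves, then the relative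
positions of its end links are the points of the corresponding chain curves. -/
theorem inP3_relPos_ladder {n : ℕ} {u ut : Fin n → ℂ} {v : Fin (n + 1) → ℂ} {E : Type}
    {g : E → (ladderGraph n).Dart → PlaneAut}
    (hg : (ladderLinkage u ut v).confVariety = ⋃ ε, Set.range (mobiusCurve (g ε))) :
    inP3 ((ladderLinkage u ut v).relPos (0, Fin.last n) (0, 0)) =
      ⋃ ε, Set.range (chainCurve u fun i => g ε (dartFirst i)) := by
  have key : ∀ (ε : E) (y : P1), ∃ c : ℝ, c ≠ 0 ∧
      (firstRowElt u fun i => (mobiusCurve (g ε) y (dartFirst i)).rep) =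
        c • firstRowElt u fun i => g ε (dartFirst i) y.rep := by
    intro ε y
    choose c hc hc' using fun i : Fin n => rep_smul_eq (g ε (dartFirst i)) y
    refine ⟨∏ i, c i, Finset.prod_ne_zero_iff.2 fun i _ => hc i, ?_⟩
    rw [← firstRowElt_smul]
    exact congrArg _ (funext hc')
  ext x
  rw [Set.mem_iUnion]
  constructor
  · rintro ⟨hx, hσ⟩
    obtain ⟨z, hz, hz'⟩ := (mem_relPos_ladder_iff u ut v _).1 hσ
    have hz2 : z ∈ ⋃ ε, Set.range (mobiusCurve (g ε)) := hg ▸ hz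
    obtain ⟨ε, y, rfl⟩ := Set.mem_iUnion.1 hz2
    obtain ⟨c, hc, hcx⟩ := (Mot.toSE2_eq_iff _ _).1 hz'
    obtain ⟨d, hd, hdy⟩ := key ε y
    refine ⟨ε, y, ?_⟩
    conv_rhs => rw [← x.mk_rep]
    refine chainCurve_eq_mk u _ y x.rep_nonzero ⟨(c * d)⁻¹, inv_ne_zero (mul_ne_zero hc hd), ?_⟩
    rw [hcx, hdy, smul_smul, smul_smul, mul_assoc, inv_mul_cancel₀ (mul_ne_zero hc hd), one_smul]
  · rintro ⟨ε, y, rfl⟩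
    obtain ⟨d, hd, hdy⟩ := key ε y
    obtain ⟨c, hc⟩ := Projectivization.exists_smul_eq_mk_rep ℝ
      (firstRowElt u fun i => g ε (dartFirst i) y.rep)
      (firstRowElt_aut_ne_zero u _ y.rep_nonzero)
    have hpp : (firstRowElt u fun i => g ε (dartFirst i) y.rep).pp ≠ 0 :=
      firstRowElt_pp_ne_zero u fun i => by simpa using y.rep_nonzero
    have hc' : (chainCurve u (fun i => g ε (dartFirst i)) y).rep =
        (c : ℝ) • firstRowElt u fun i => g ε (dartFirst i) y.rep := hc.symm
    refine ⟨by rw [hc']; exact Mot.smul_pp_ne_zero c.ne_zero hpp, ?_⟩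
    rw [mem_relPos_ladder_iff]
    refine ⟨mobiusCurve (g ε) y, ?_, ?_⟩
    · have : mobiusCurve (g ε) y ∈ ⋃ ε, Set.range (mobiusCurve (g ε)) :=
        Set.mem_iUnion.2 ⟨ε, y, rfl⟩
      exact hg ▸ this
    · rw [Mot.toSE2_eq_iff]
      refine ⟨(c : ℝ) * d⁻¹, mul_ne_zero c.ne_zero (inv_ne_zero hd), ?_⟩
      refine hc'.trans (Eq.trans ?_ (congrArg (((c : ℝ) * d⁻¹) • ·) hdy).symm)
      rw [smul_smul, mul_assoc, inv_mul_cancel₀ hd, mul_one]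

/-! ### The image of a motion polynomial -/

/-- Evaluation at a real number; it is multiplicative since real numbers are central in `𝕂`. -/
noncomputable def evalReal (t : ℝ) : Mot[X] →+* Mot :=
  eval₂RingHom' (RingHom.id Mot) (algebraMap ℝ Mot t) fun a => (Algebra.commutes t a).symm

theorem evalReal_apply (t : ℝ) (P : Mot[X]) : evalReal t P = P.eval (algebraMap ℝ Mot t) := rfl

theorem evalReal_ofReal_mul (t : ℝ) (S : ℝ[X]) (P : Mot[X]) :
    evalReal t (ofReal S * P) = S.eval t • evalReal t P := by
  rw [map_mul, Algebra.smul_def]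
  congr 1
  rw [evalReal_apply, eval_map, eval₂_at_apply]

theorem evalReal_X_sub_C (t : ℝ) (k : Mot) : evalReal t (X - C k) = algebraMap ℝ Mot t - k := by
  rw [evalReal_apply, eval_sub, eval_X, eval_C]

theorem evalReal_pp (t : ℝ) (P : Mot[X]) : (evalReal t P).pp = (primal P).eval (t : ℂ) := by
  have h : (t : ℂ) = Mot.ppHom (algebraMap ℝ Mot t) := rfl
  rw [primal, h, eval_map, eval₂_at_apply]
  rfl

theorem evalReal_ne_zero {P : Mot[X]} (hroot : ∀ t : ℝ, (primal P).eval (t : ℂ) ≠ 0) (t : ℝ) :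
    evalReal t P ≠ 0 :=
  ne_zero_of_pp_ne_zero (by rw [evalReal_pp]; exact hroot t)

theorem motionImage_eq_range {P : Mot[X]} (hroot : ∀ t : ℝ, (primal P).eval (t : ℂ) ≠ 0) :
    motionImage P = Set.range (affineCurve (fun t => evalReal t P) (evalReal_ne_zero hroot)) := by
  ext x
  constructor
  · rintro ⟨t, h, rfl⟩
    exact ⟨t, rfl⟩
  · rintro ⟨t, rfl⟩
    exact ⟨t, evalReal_ne_zero hroot t, rfl⟩

/-- The four real coordinates of a polynomial with coefficients in `𝕂`. -/
noncomputable def coordPoly (P : Mot[X]) (j : Fin 4) : ℝ[X] :=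
  ∑ m ∈ Finset.range (P.natDegree + 1), C ((P.coeff m).coord j) * X ^ m

theorem Mot.coord_add (k m : Mot) : (k + m).coord = k.coord + m.coord := by
  ext j
  fin_cases j <;> simp [Mot.coord]

/-- The coordinates as a linear map. -/
def Mot.coordHom : Mot →ₗ[ℝ] Fin 4 → ℝ where
  toFun := Mot.coord
  map_add' := Mot.coord_add
  map_smul' := Mot.coord_smul

theorem coord_evalReal (P : Mot[X]) (t : ℝ) (j : Fin 4) :
    (evalReal t P).coord j = (coordPoly P j).eval t := by
  change Mot.coordHom (evalReal t P) j = _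
  rw [evalReal_apply, eval_eq_sum_range, map_sum, Finset.sum_apply, coordPoly, eval_finsetSum]
  refine Finset.sum_congr rfl fun m _ => ?_
  rw [← map_pow, ← Algebra.commutes, ← Algebra.smul_def, map_smul, Pi.smul_apply, smul_eq_mul,
    eval_mul, eval_C, eval_pow, eval_X, mul_comm]
  rfl

theorem coeff_coordPoly (P : Mot[X]) (j : Fin 4) (m : ℕ) :
    (coordPoly P j).coeff m = (P.coeff m).coord j := by
  have h : ∀ m, P.natDegree < m → (P.coeff m).coord j = 0 := fun m hm => by
    rw [coeff_eq_zero_of_natDegree_lt hm]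
    exact congrFun (map_zero Mot.coordHom) j
  rw [coordPoly, finsetSum_coeff]
  simp only [coeff_C_mul_X_pow, Finset.sum_ite_eq, Finset.mem_range]
  split_ifs with h1
  · rfl
  · exact (h m (by omega)).symm

/-- A monic motion polynomial that is not a real polynomial parametrizes a curve that is not
constant. -/
theorem exists_coordPoly_ne {P : Mot[X]} (hP : P.Monic) (hne : ∀ T : ℝ[X], P ≠ ofReal T) :
    ∃ i j, coordPoly P i ≠ 0 ∧ ∀ r : ℝ, coordPoly P j ≠ C r * coordPoly P i := by
  have hlead : ∀ j, (coordPoly P j).coeff P.natDegree = (1 : Mot).coord j := fun j => by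
    rw [coeff_coordPoly, coeff_natDegree, hP.leadingCoeff]
  have h0 : (1 : Mot).coord 0 = 1 := by simp [Mot.coord]
  have h1 : ∀ j, j ≠ 0 → (1 : Mot).coord j = 0 := fun j hj => by
    fin_cases j <;> simp [Mot.coord] at hj ⊢
  by_contra! hcon
  have hzero : ∀ j, j ≠ 0 → coordPoly P j = 0 := by
    intro j hj
    obtain ⟨r, hr⟩ := hcon 0 j fun h => by
      have := hlead 0
      rw [h, coeff_zero, h0] at this
      exact zero_ne_one this
    have h2 := congrArg (fun p => coeff p P.natDegree) hr
    simp only [coeff_C_mul, hlead, h0, h1 j hj, mul_one] at h2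
    rw [hr, ← h2, C_0, zero_mul]
  refine hne (coordPoly P 0) ?_
  ext m : 1
  rw [coeff_map, coeff_coordPoly]
  apply Mot.coord_injective
  ext j
  have e : (algebraMap ℝ Mot ((P.coeff m).coord 0)).coord j =
      (P.coeff m).coord 0 * (1 : Mot).coord j := by
    rw [Algebra.algebraMap_eq_smul_one, Mot.coord_smul, Pi.smul_apply, smul_eq_mul]
  rw [e]
  by_cases hj : j = 0
  · rw [hj, h0, mul_one]
  · rw [h1 j hj, mul_zero, ← coeff_coordPoly, hzero j hj, coeff_zero]

/-- If `P` is a real polynomial, then the construction leads to a ladder without squares. -/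
theorem eq_zero_of_constructStrongLinkage_ofReal {P : Mot[X]} (hP : P.Monic) {T : ℝ[X]}
    (hT : P = ofReal T) {n : ℕ} {k kt : Fin n → Mot} {l : Fin (n + 1) → Mot}
    (h : ConstructStrongLinkage P k kt l) : n = 0 := by
  obtain ⟨S, R, P', hS, hSP, hmax, hF, -⟩ := h
  have hinj : Function.Injective (algebraMap ℝ Mot) := fun a b hab => by
    have := congrArg (fun m : Mot => m.pp.re) hab
    exact this
  have : Nontrivial Mot := Mot.ppHom.domain_nontrivial
  have hSm : (ofReal S).Monic := hS.map _
  have hP' : P'.Monic := hSm.of_mul_monic_left (hSP ▸ hP)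
  have hTm : T.Monic := monic_of_injective hinj (by rw [← ofReal, ← hT]; exact hP)
  have h1 := hmax T hTm (dvd_of_eq hT.symm)
  have h2 : P.natDegree = S.natDegree + P'.natDegree := by
    rw [hSP, hSm.natDegree_mul hP', hS.natDegree_map]
  have h3 : P.natDegree = T.natDegree := by rw [hT, hTm.natDegree_map]
  have h4 : P' = 1 := hP'.natDegree_eq_zero.1 (by omega)
  obtain ⟨m, α, r, s, u, v, w, hsr, -, hZ, -, -, -, hq, -⟩ := hF
  have hm : m = 0 := by
    by_contra hm
    have h5 := congrArg (Polynomial.eval (α ⟨0, Nat.pos_of_ne_zero hm⟩)) hZ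
    rw [h4, primal, Polynomial.map_one, eval_one, eval_prod,
      Finset.prod_eq_zero (Finset.mem_univ (⟨0, Nat.pos_of_ne_zero hm⟩ : Fin m))] at h5
    · exact one_ne_zero h5
    · rw [eval_mul, eval_pow, eval_sub, eval_X, eval_C, sub_self,
        zero_pow (hsr _).2.ne', zero_mul]
  subst hm
  have h6 := congrArg List.length hq
  simpa using h6

/-! ### Strong realization -/

/-- Rotating the joints of the first row by the parameters `t - kᵢ` gives, up to a real factor, the
product of the motion polynomials `t - kᵢ` at `t`. -/
theorem firstRowElt_pointOf {n : ℕ} {k : Fin n → Mot} (hk : ∀ i, (k i).pp.im ≠ 0) {t : ℝ}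
    (h : ∀ i, (t - (k i).pp : ℂ) ≠ 0) {y : Fin n → P1}
    (hy : ∀ i, y i = pointOf (t - (k i).pp) (h i)) :
    ∃ c : ℝ, c ≠ 0 ∧ (firstRowElt (fun i => (k i).center) fun i => (y i).rep) =
      c • (List.ofFn fun i => algebraMap ℝ Mot t - k i).prod := by
  have h1 : ∀ i, ∃ c : ℝ, c ≠ 0 ∧
      rotElt (k i).center (y i).rep = c • (algebraMap ℝ Mot t - k i) := by
    intro i
    obtain ⟨c, hc, hc'⟩ := angleRep_pointOf _ (h i)
    refine ⟨c, hc, ?_⟩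
    have h2 : (algebraMap ℝ Mot t).pp = t := rfl
    have h3 : (algebraMap ℝ Mot t).sp = 0 := rfl
    have h4 := Mot.sp_eq_center_mul (hk i)
    rw [rotElt_rep, hy, hc']
    ext1
    · rw [Mot.smul_pp, Mot.sub_pp, h2]
    · rw [Mot.smul_sp, Mot.sub_sp, h3]
      simp only [map_mul, map_sub, Complex.conj_ofReal]
      rw [h4]
      ring
  clear hy
  induction n with
  | zero => exact ⟨1, one_ne_zero, by simp [firstRowElt]⟩
  | succ n ih =>
    obtain ⟨c, hc, hc'⟩ := h1 0
    obtain ⟨d, hd, hd'⟩ := ih (fun i => hk i.succ) (fun i => h i.succ) (y := fun i => y i.succ)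
      fun i => h1 i.succ
    refine ⟨c * d, mul_ne_zero hc hd, ?_⟩
    rw [firstRowElt_succ, hc', hd', List.ofFn_succ, List.prod_cons, smul_mul_smul_comm]

/-- If a motion that is not constant lies on a finite union of chain curves, then its Zariski
closure in this union is a component of the union. For `n = 0` the chain curves are a single point,
and the motion may be constant. -/
theorem isComponent_closure_inter {P : Mot[X]} (hroot : ∀ t : ℝ, (primal P).eval (t : ℂ) ≠ 0)
    {n : ℕ} {E : Type} [Finite E] (u : Fin n → ℂ) (g : E → Fin n → PlaneAut)
    (hne : n = 0 ∨ ∃ i j, coordPoly P i ≠ 0 ∧ ∀ r : ℝ, coordPoly P j ≠ C r * coordPoly P i)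
    (hsub : motionImage P ⊆ ⋃ ε, Set.range (chainCurve u (g ε))) :
    IsComponent (closure (motionImage P) ∩ ⋃ ε, Set.range (chainCurve u (g ε)))
      (⋃ ε, Set.range (chainCurve u (g ε))) := by
  have hirr : IsIrreducible (motionImage P) := by
    rw [motionImage_eq_range hroot]
    exact (cofiniteContinuous_affineCurve _ (coord_evalReal P)).isIrreducible_range
  -- the chain curve that contains the motion lies in the closure of the motion
  have hkey : ∀ ε, motionImage P ⊆ closure (Set.range (chainCurve u (g ε))) →
      Set.range (chainCurve u (g ε)) ⊆ closure (motionImage P) := by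
    intro ε hε
    rcases hne with rfl | hne
    · rintro _ ⟨y, rfl⟩
      obtain ⟨x, hx⟩ := hirr.1
      obtain ⟨ε', y', rfl⟩ := Set.mem_iUnion.1 (hsub hx)
      have e : chainCurve u (g ε) y = chainCurve u (g ε') y' := by
        simp only [chainCurve, firstRowElt, List.ofFn_zero]
      rw [e]
      exact subset_closure hx
    · obtain ⟨k, hk, q, hq, h1, h2⟩ := exists_affineCurve_chainCurve u (g ε)
      have h3 := closure_minimal h2 isClosed_closure
      rw [motionImage_eq_range hroot] at hε ⊢
      have h4 := range_affineCurve_subset_closure hk _ hq (coord_evalReal P) hne (hε.trans h3)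
      exact h2.trans (closure_minimal h4 isClosed_closure)
  rw [isComponent_iff_maximal]
  have hA : motionImage P ⊆ closure (motionImage P) ∩ ⋃ ε, Set.range (chainCurve u (g ε)) :=
    Set.subset_inter subset_closure hsub
  refine ⟨⟨?_, Set.inter_subset_right⟩, ?_⟩
  · rw [← isIrreducible_iff_closure]
    have e : closure (closure (motionImage P) ∩ ⋃ ε, Set.range (chainCurve u (g ε))) =
        closure (motionImage P) :=
      (closure_minimal Set.inter_subset_left isClosed_closure).antisymm (closure_mono hA)
    rw [e, isIrreducible_iff_closure]
    exact hirr
  · rintro T ⟨hT, hTX⟩ hYT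
    obtain ⟨ε, hε⟩ := IsIrreducible.subset_of_subset_iUnion hT (fun _ => isClosed_closure)
      (hTX.trans (Set.iUnion_mono fun ε => subset_closure (s := Set.range (chainCurve u (g ε)))))
    have h1 := hkey ε ((hA.trans hYT).trans hε)
    exact Set.subset_inter (hε.trans (closure_minimal h1 isClosed_closure)) hTX

/-- The motion `t ↦ P(t)` consists of relative positions of the end links of the ladder: in the
configuration at the time `t`, the `i`-th joint of the first row rotates by `t - kᵢ`, and all
rungs rotate by `t - l₀`. -/
theorem motionImage_subset_inP3_relPos {P : Mot[X]} (hP : IsBoundedMotionPoly P) {n : ℕ}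
    {k kt : Fin n → Mot} {l : Fin (n + 1) → Mot} (h : ConstructStrongLinkage P k kt l)
    {A B D : Fin n → PlaneAut} (hD : ∀ i, D i = 1)
    (hA : ∀ i (t : ℝ) (h : (t - (l i.castSucc).pp : ℂ) ≠ 0) (h' : (t - (k i).pp : ℂ) ≠ 0),
      pointOf (t - (k i).pp) h' = A i • pointOf (t - (l i.castSucc).pp) h)
    (hsub : ladderCurve A B D ⊆ (strongLinkage k kt l).confVariety) :
    motionImage P ⊆ inP3 ((strongLinkage k kt l).relPos (0, Fin.last n) (0, 0)) := by
  rintro _ ⟨t, hPt, rfl⟩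
  obtain ⟨S, R, P', hS, hSP, hmax, hF, hl0, hflip, hFM⟩ := h
  have hP' := hP.of_ofReal_mul hS hSP
  have him : ∀ z : ℂ, z.im ≠ 0 → (t - z : ℂ) ≠ 0 := fun z hz h => hz (by
    rw [← sub_eq_zero.1 h, Complex.ofReal_im])
  have hk : ∀ i, (k i).pp.im ≠ 0 := fun i => (hFM i).2.1
  have hl : ∀ j, (l j).pp = (l 0).pp := fun j => by
    induction j using Fin.induction with
    | zero => rfl
    | succ i ih => rw [(hflip i).2.1, ih]
  have hlne : ∀ j, (t - (l j).pp : ℂ) ≠ 0 := fun j => him _ (by rw [hl]; exact hl0)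
  obtain ⟨x, hx, hx0⟩ := exists_mem_ladderCurve A B D (pointOf (t - (l 0).pp) (hlne 0))
  have hrung : ∀ j, x (dartRung j) = pointOf (t - (l j).pp) (hlne j) := fun j => by
    have e : pointOf (t - (l j).pp) (hlne j) = pointOf (t - (l 0).pp) (hlne 0) := by
      simp only [hl j]
    rw [e]
    clear e
    induction j using Fin.induction with
    | zero => exact hx0
    | succ i ih => rw [(hx.2 i).2.2, hD, one_smul, ih]
  have hfirst : ∀ i, x (dartFirst i) = pointOf (t - (k i).pp) (him _ (hk i)) := fun i => by
    rw [(hx.2 i).1, hrung, hA i t (hlne _)]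
  obtain ⟨c, hc, hc'⟩ := firstRowElt_pointOf hk (fun i => him _ (hk i)) hfirst
  -- the product of the linear factors at `t` is a real multiple of `P(t)`
  have hprod : (List.ofFn fun i => algebraMap ℝ Mot t - k i).prod = R.eval t • evalReal t P' := by
    rw [← evalReal_ofReal_mul, hF.mul_eq_prod (noRealFactor_of_maximal hS hSP hmax) hP'.2,
      map_list_prod, List.map_ofFn]
    simp only [Function.comp_def, evalReal_X_sub_C]
  have hR : R.eval t ≠ 0 := fun h0 => by
    refine Mot.list_prod_pp_ne_zero (l := List.ofFn fun i => algebraMap ℝ Mot t - k i) ?_ ?_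
    · intro m hm
      obtain ⟨i, rfl⟩ := (List.mem_ofFn' _ _).1 hm
      exact him _ (hk i)
    · rw [hprod, h0, zero_smul, Mot.zero_pp]
  have hPS : evalReal t P = S.eval t • evalReal t P' := by rw [hSP, evalReal_ofReal_mul]
  have hPpp : (evalReal t P).pp ≠ 0 := by rw [evalReal_pp]; exact hP.2 t
  have hSt : S.eval t ≠ 0 := fun h0 => by
    rw [hPS, h0, zero_smul] at hPpp
    exact hPpp rfl
  obtain ⟨e, he⟩ := Projectivization.exists_smul_eq_mk_rep ℝ (evalReal t P) hPt
  have he' : (Projectivization.mk ℝ (P.eval (algebraMap ℝ Mot t)) hPt).rep =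
      (e : ℝ) • evalReal t P := he.symm
  refine ⟨by rw [he']; exact Mot.smul_pp_ne_zero e.ne_zero hPpp, ?_⟩
  refine (mem_relPos_ladder_iff _ _ _ _).2 ⟨x, hsub hx, (Mot.toSE2_eq_iff _ _).2
    ⟨e * S.eval t * (c * R.eval t)⁻¹, mul_ne_zero (mul_ne_zero e.ne_zero hSt)
      (inv_ne_zero (mul_ne_zero hc hR)), he'.trans ?_⟩⟩
  refine Eq.trans ?_ (congrArg (((e : ℝ) * S.eval t * (c * R.eval t)⁻¹) • ·) hc').symm
  rw [hprod, hPS]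
  simp only [smul_smul]
  rw [inv_mul_cancel_right₀ (mul_ne_zero hc hR)]

end PlanarMotion

theorem mainTheorem2 (P : Polynomial Mot) (hP : IsBoundedMotionPoly P) :
    (∃ (n : ℕ) (k kt : Fin n → Mot) (l : Fin (n + 1) → Mot), ConstructStrongLinkage P k kt l) ∧
    ∀ (n : ℕ) (k kt : Fin n → Mot) (l : Fin (n + 1) → Mot), ConstructStrongLinkage P k kt l →
      (strongLinkage k kt l).mobility = 1 ∧
      (∀ B : Fin n → Set (MultiProj (ladderGraph 1).Dart),
        (∀ h, IsComponent (B h)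
          (flipLinkage (l h.castSucc) (k h) (kt h) (l h.succ)).confVariety) →
        IsComponent (pullback (strongLinkage k kt l).confVariety B)
          (strongLinkage k kt l).confVariety ∧
        (∀ h, IsIsoOn (pullback (strongLinkage k kt l).confVariety B) (B h) (squareProj h)) ∧
        ∀ d, IsIsoOn (pullback (strongLinkage k kt l).confVariety B) Set.univ (jointProj d)) ∧
      (∀ C, IsComponent C (strongLinkage k kt l).confVariety →
        ∃ B : Fin n → Set (MultiProj (ladderGraph 1).Dart),
          (∀ h, IsComponent (B h)
            (flipLinkage (l h.castSucc) (k h) (kt h) (l h.succ)).confVariety) ∧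
          C = pullback (strongLinkage k kt l).confVariety B) ∧
      (strongLinkage k kt l).StronglyRealizes P (0, Fin.last n) (0, 0) := by
  refine ⟨exists_constructStrongLinkage hP, fun n k kt l hL => ?_⟩
  have hL' := hL
  obtain ⟨S, R, P', -, -, -, -, -, hflip, hFM⟩ := hL'
  choose A B D hD hA hsq using fun i => exists_square_aut (hflip i) (hFM i)
  -- the curve of configurations for a choice of a family in each square
  obtain ⟨X, hX⟩ : ∃ X : (Fin n → Bool) → Set (MultiProj (ladderGraph n).Dart), ∀ ε, X ε =
      ladderCurve (fun i => A i (ε i)) (fun i => B i (ε i)) (fun i => D i (ε i)) :=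
    ⟨_, fun _ => rfl⟩
  -- the components of the configuration spaces of the squares
  obtain ⟨Y, hY⟩ : ∃ Y : Fin n → Bool → Set (MultiProj (ladderGraph 1).Dart), ∀ i b, Y i b =
      ladderCurve (fun _ => A i b) (fun _ => B i b) (fun _ => D i b) :=
    ⟨_, fun _ _ => rfl⟩
  have hK : (strongLinkage k kt l).confVariety = ⋃ ε, X ε := by
    simp only [hX]
    exact confVariety_ladder_eq_iUnion hsq
  have hF : ∀ i, (flipLinkage (l i.castSucc) (k i) (kt i) (l i.succ)).confVariety =
      ⋃ b, Y i b := by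
    intro i
    refine (confVariety_ladder_eq_iUnion (n := 1) (A := fun _ => A i) (B := fun _ => B i)
      (D := fun _ => D i) fun j p q r s => ?_).trans ?_
    · rw [Subsingleton.elim j 0]
      exact hsq i p q r s
    · simp only [hY]
      ext x
      simp only [Set.mem_iUnion]
      have e : ∀ (b : Fin 1 → Bool) (j : Fin 1), b j = b 0 := fun b j => by
        rw [Subsingleton.elim j 0]
      constructor
      · rintro ⟨b, hb⟩
        simp only [e b] at hb
        exact ⟨b 0, hb⟩
      · rintro ⟨b, hb⟩
        exact ⟨fun _ => b, hb⟩
  choose g hg using fun ε => (hX ε) ▸ ladderCurve_eq_range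
    (fun i => A i (ε i)) (fun i => B i (ε i)) (fun i => D i (ε i))
  choose g' hg' using fun i b => (hY i b) ▸ ladderCurve_eq_range
    (fun _ : Fin 1 => A i b) (fun _ => B i b) (fun _ => D i b)
  have hXK : ∀ ε, X ε ⊆ (strongLinkage k kt l).confVariety := fun ε => by
    rw [hK]
    exact Set.subset_iUnion X ε
  have hcompK : ∀ C, IsComponent C (strongLinkage k kt l).confVariety ↔ ∃ ε, C = X ε := by
    intro C
    rw [hK]
    simp only [hg]
    exact isComponent_iUnion_iff (fun ε => cofiniteContinuous_mobiusCurve (g ε))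
      (fun ε => isClosed_range_mobiusCurve (g ε)) fun _ _ => range_mobiusCurve_eq_of_subset
  have hcompF : ∀ i C, IsComponent C
      (flipLinkage (l i.castSucc) (k i) (kt i) (l i.succ)).confVariety ↔ ∃ b, C = Y i b := by
    intro i C
    rw [hF]
    simp only [hg']
    exact isComponent_iUnion_iff (fun b => cofiniteContinuous_mobiusCurve (g' i b))
      (fun b => isClosed_range_mobiusCurve (g' i b)) fun _ _ => range_mobiusCurve_eq_of_subset
  -- a configuration of the ladder is on the curve of `ε` if its squares are in the families of `ε`
  have hpull : ∀ ε, pullback (strongLinkage k kt l).confVariety (fun h => Y h (ε h)) = X ε := by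
    intro ε
    ext x
    constructor
    · rintro ⟨hx, hx'⟩
      rw [hK] at hx
      obtain ⟨ε', hε'⟩ := Set.mem_iUnion.1 hx
      rw [hX] at hε' ⊢
      rw [mem_ladderCurve_iff_squareProj hε'.1]
      simpa only [hY] using hx'
    · intro hx
      refine ⟨hXK ε hx, ?_⟩
      rw [hX] at hx
      simpa only [hY] using (mem_ladderCurve_iff_squareProj hx.1).1 hx
  -- the motion takes place on the curve for the family of the factorizations in each square
  have hmotion := motionImage_subset_inP3_relPos hP hL hD hA
    (hX (fun _ => true) ▸ hXK fun _ => true)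
  have hK' : (strongLinkage k kt l).confVariety = ⋃ ε, Set.range (mobiusCurve (g ε)) :=
    hK.trans (Set.iUnion_congr hg)
  refine ⟨?_, ?_, ?_, ?_, ?_⟩
  · refine (congrArg (fun Z : Set (MultiProj (ladderGraph n).Dart) => topologicalKrullDim Z)
      hK').trans ?_
    exact topologicalKrullDim_iUnion (fun ε => cofiniteContinuous_mobiusCurve (g ε))
      (fun ε => mobiusCurve_injective (g ε)) (fun ε => isClosed_range_mobiusCurve (g ε))
      fun _ _ => range_mobiusCurve_eq_of_subset
  · intro C hC
    choose ε hε using fun h => (hcompF h _).1 (hC h)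
    obtain rfl : C = fun h => Y h (ε h) := funext hε
    rw [hpull]
    refine ⟨(hcompK _).2 ⟨ε, rfl⟩, fun h => ?_, fun d => ?_⟩
    · have hiso := isIsoOn_range_mobiusCurve (g ε) (squareHom h).mapDart
      rw [← hg] at hiso
      -- the image of the curve is contained in a curve of the same kind, hence equal to it
      have hsub : Set.range (mobiusCurve (g ε ∘ (squareHom h).mapDart)) ⊆ Y h (ε h) := by
        rintro _ ⟨y, rfl⟩
        have hy : mobiusCurve (g ε) y ∈ X ε := hg ε ▸ ⟨y, rfl⟩
        rw [← hpull] at hy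
        exact hy.2 h
      rw [hg'] at hsub
      rw [range_mobiusCurve_eq_of_subset hsub, ← hg'] at hiso
      exact hiso
    · have hiso := isIsoOn_range_mobiusCurve (g ε) fun _ : Unit => d
      have huniv : Set.range (mobiusCurve (g ε ∘ fun _ : Unit => d)) = Set.univ := by
        refine Set.eq_univ_of_forall fun x => ?_
        rw [mem_range_mobiusCurve_iff _ ()]
        exact funext fun _ => (smul_inv_smul _ _).symm
      rw [← hg, huniv] at hiso
      exact hiso
  · intro C hC
    obtain ⟨ε, rfl⟩ := (hcompK C).1 hC
    exact ⟨fun h => Y h (ε h), fun h => (hcompF h _).2 ⟨ε h, rfl⟩, (hpull ε).symm⟩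
  · exact hmotion
  · have hR := inP3_relPos_ladder (u := fun i => (k i).center) (ut := fun i => (kt i).center)
      (v := fun j => (l j).center) hK'
    have hR' : inP3 ((strongLinkage k kt l).relPos (0, Fin.last n) (0, 0)) =
        ⋃ ε, Set.range (chainCurve (fun i => (k i).center) fun i => g ε (dartFirst i)) := hR
    rw [hR'] at hmotion ⊢
    refine isComponent_closure_inter hP.2 _ (fun ε i => g ε (dartFirst i)) ?_ hmotion
    by_cases hreal : ∃ T : ℝ[X], P = ofReal T
    · obtain ⟨T, hT⟩ := hreal
      exact Or.inl (eq_zero_of_constructStrongLinkage_ofReal hP.1 hT hL)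
    · exact Or.inr (exists_coordPoly_ne hP.1 (not_exists.1 hreal))
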